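/- **Setting.** Let $n,J,K,L\ge 1$ be integers and $M=2^J$. There are $K$ single-antenna users, all active, and a base station with $L$ antennas. User $k$ has codewords $\mathbf x_{k,1},\dots,\mathbf x_{k,M}\in\mathbb C^n$ with $\|\mathbf x_{k,m}\|_2^2\le nP$. The messages $W_1,\dots,W_K$ are independent and uniform on $\{1,\dots,M\}$, and antenna $l$ receives $\mathbf y_l=\sum_{k}h_{k,l}\mathbf x_{k,W_k}+\mathbf z_l$ with $h_{k,l}$ i.i.d. $\mathcal{CN}(0,1)$ and $\mathbf z_l$ i.i.d. $\mathcal{CN}(\mathbf 0,\mathbf I_n)$, all independent of each other and of the messages. The decoder knows the codebooks, $\mathbf Y=[\mathbf y_1,\dots,\mathbf y_L]$ and $\mathbf H=(h_{k,l})$ (CSIR) and outputs $(\hat W_1,\dots,\hat W_K)$. For real $\epsilon$, an $(n,M,\epsilon,P)$ code is a choice of codebooks meeting the power constraint and of a (measurable) decoder with $\frac1K\sum_{k}\mathbb P[W_k\ne\hat W_k]\le\epsilon$. Put $$E_b^*(n,M,\epsilon)=\inf\{nP/J:\ P>0,\ \text{an }(n,M,\epsilon,P)\text{ code exists}\}.$$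 **Notation.** $|\cdot|$ of a matrix is the determinant; $\Gamma$ and $\gamma$ are the gamma and lower incomplete gamma functions, with $\gamma(\cdot,a)=0$ for $a\le0$; $\inf\emptyset=+\infty$; every "min" below is an infimum. **Claim 1.** $$E_b^*(n,M,\epsilon)\le\inf\frac{nP}{J},$$ where the infimum is over all $P>0$ with $$\epsilon\ \ge\ \min_{0<P'<P}\Big\{\tilde p_0+\sum_{t=1}^K\frac tK\min\{1,\tilde p_{1,t},\tilde p_{2,t}\}\Big\}.$$ The terms are as follows. * $\tilde p_0=K\big(1-\gamma(n,nP/P')/\Gamma(n)\big)$. * $\tilde p_{1,t}=\min_{0\le\omega\le1,\ \nu\ge0}\{q_{1,t}(\omega,\nu)+q_{2,t}(\omega,\nu)\}$. Here $S$ is an arbitrary set of $t$ users; $\mathbf A\in\mathbb C^{n\times MK}$ has i.i.d. $\mathcal{CN}(0,P')$ entries and its columns are indexed by pairs (user, message); $w,w'$ are arbitrary message vectors with $w_k\ne w_k'$ for all $k$; and $\mathbf A_1$ (resp. $\mathbf A_2$) is the $n\times K$ matrix whose $k$-th column is column $(k,w_k)$ (resp. $(k,w'_k)$) of $\mathbf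 A$ if $k\in S$ and $\mathbf 0$ otherwise. * $$q_{1,t}(\omega,\nu)=\binom Kt(M-1)^t\,\mathbb E\Big[\min_{u,r}\exp\{-L(n\ln(1+r(1-\omega))+\ln|\mathbf I_K+\tilde{\mathbf B}|-rn\nu)\}\Big],$$ where the minimum is over $u,r\ge0$ with $u\ne r\omega$ and $\lambda_{\min}(\tilde{\mathbf B})>-1$, and $$\tilde{\mathbf B}=\tfrac{(1+r-u)(u-r\omega)}{1+r(1-\omega)}\big(\mathbf A_1-\tfrac{u}{u-r\omega}\mathbf A_2\big)^H\big(\mathbf A_1-\tfrac{u}{u-r\omega}\mathbf A_2\big)-\tfrac{r\omega u}{u-r\omega}\mathbf A_2^H\mathbf A_2 .$$ * If $\omega=0$, then $q_{2,t}(\omega,\nu)=1-\frac{\gamma(nL,nL\nu)}{\Gamma(nL)}$. If $\omega\in(0,1]$ and $t<n$, then $$q_{2,t}(\omega,\nu)=\min_{\eta,\delta\ge0}\Big\{\tbinom Kt\mathbb E\Big[\tfrac{\gamma(tL,\,L(t(1+\eta)-n\nu+n(1+\delta)(1-\omega))|\mathbf I_n+\omega\mathbf A_1\mathbf A_1^H|^{-1/t})}{\Gamma(tL)}\Big]+\tbinom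 Kt\Big(2-\tfrac{\gamma(tL,tL(1+\eta))}{\Gamma(tL)}-\tfrac{\gamma(nL,nL(1+\delta))}{\Gamma(nL)}\Big)\Big\}.$$ If $\omega\in(0,1]$ and $t\ge n$, then $$q_{2,t}(\omega,\nu)=\min_{\eta\ge0}\Big\{\tbinom Kt\mathbb E\Big[\tfrac{1}{\Gamma(nL)}\gamma\Big(nL,\tfrac{nL(1+\eta-\nu)}{\omega|\mathbf I_n+\mathbf A_1\mathbf A_1^H|^{1/n}}\Big)\Big]+1-\tfrac{\gamma(nL,nL(1+\eta))}{\Gamma(nL)}\Big\}.$$ * $$\tilde p_{2,t}=\min_{\rho}\binom Kt M^{\rho t}\,\mathbb E\Big[\big|\mathbf I_t+\tfrac{P'}{1+\rho}\mathbf G\mathbf G^H\big|^{-L}\Big],$$ where the minimum is over $0\le\rho\le1$ with $\rho n\in\{0,1,2,\dots\}$, and $\mathbf G\in\mathbb C^{t\times\rho n}$ has i.i.d. $\mathcal{CN}(0,1)$ entries. **Claim 2.** For all $1\le t\le K$ and $P'>0$, $$\min\{1,\tilde p_{2,t}\}\le\tilde p_{2,t}^{\mathrm u}=\min_{0\le\rho\le1,\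 \rho n\in\{0,1,\dots\}}q(\rho),$$ where $$q(\rho)=\begin{cases}\binom Kt M^{\rho t}\big(\frac{P'}{1+\rho}\big)^{-Lt}\prod_{i=\rho n-t+1}^{\rho n}\frac{\Gamma(i-L)}{\Gamma(i)},&\rho n\ge t+L,\\[2pt]\binom Kt M^{\rho t}\big(\frac{P'}{1+\rho}\big)^{-L\rho n}\prod_{i=t-\rho n+1}^{t}\frac{\Gamma(i-L)}{\Gamma(i)},&\rho n\le t-L,\\[2pt]1,&t-L<\rho n<t+L.\end{cases}$$ Moreover $\tilde p_{2,t}\le q(\rho)$, without the cap at $1$, for every such $\rho$ with $\rho n\ge t+L$ or $\rho n\le t-L$. -/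

import Mathlib

open MeasureTheory ProbabilityTheory
open scoped Matrix

namespace MassiveAccess

noncomputable section

/-! ## The channel, codes, and the minimum energy-per-bit (all `K` users active, CSIR) -/

/-- The circularly symmetric complex Gaussian law `CN(0, v)`: independent real and imaginary
parts, each of variance `v / 2`. -/
def complexGaussian (v : ℝ) : Measure ℂ :=
  ((gaussianReal 0 (v / 2).toNNReal).prod (gaussianReal 0 (v / 2).toNNReal)).map
    (fun p : ℝ × ℝ => (⟨p.1, p.2⟩ : ℂ))

/-- The law of a matrix (rows indexed by `ι`, columns by `κ`) with i.i.d. `CN(0, v)` entries. -/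
def gaussianMatrix (ι κ : Type) [Fintype ι] [Fintype κ] (v : ℝ) : Measure (ι → κ → ℂ) :=
  Measure.pi fun _ : ι => Measure.pi fun _ : κ => complexGaussian v

/-- The joint law of the messages `W` (uniform on `[M]^K`), the fading matrix `H` (`K × L`, i.i.d.
`CN(0,1)`) and the noise matrix `Z` (`n × L`, i.i.d. `CN(0,1)`), which are independent. -/
def channelLaw (n M K L : ℕ) :
    Measure ((Fin K → Fin M) × (Fin K → Fin L → ℂ) × (Fin n → Fin L → ℂ)) :=
  (uniformOn (Set.univ : Set (Fin K → Fin M))).prod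
    ((gaussianMatrix (Fin K) (Fin L) 1).prod (gaussianMatrix (Fin n) (Fin L) 1))

/-- The received signal: its column `l` is `y_l = ∑ k, h_{k,l} x_{k,W_k} + z_l`. -/
def received {n M K L : ℕ} (enc : Fin K → Fin M → Fin n → ℂ) (W : Fin K → Fin M)
    (H : Fin K → Fin L → ℂ) (Z : Fin n → Fin L → ℂ) : Fin n → Fin L → ℂ :=
  fun i l => ∑ k, H k l * enc k (W k) i + Z i l

/-- The per-user probability of error `(1/K) ∑ k, P[W_k ≠ Ŵ_k]`; the decoder sees `(Y, H)`. -/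
def pupe {n M K L : ℕ} (enc : Fin K → Fin M → Fin n → ℂ)
    (dec : (Fin n → Fin L → ℂ) × (Fin K → Fin L → ℂ) → Fin K → Fin M) : ℝ :=
  1 / K * ∑ k, (channelLaw n M K L).real
    {ω | ω.1 k ≠ dec (received enc ω.1 ω.2.1 ω.2.2, ω.2.1) k}

/-- An `(n, M, ε, P)` massive random access code with CSIR, all `K` users being active. -/
structure Code (n M K L : ℕ) (ε P : ℝ) where
  enc : Fin K → Fin M → Fin n → ℂ
  power_le : ∀ k m, ∑ i, ‖enc k m i‖ ^ 2 ≤ n * P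
  dec : (Fin n → Fin L → ℂ) × (Fin K → Fin L → ℂ) → Fin K → Fin M
  measurable_dec : Measurable dec
  pupe_le : pupe enc dec ≤ ε

/-- The minimum energy-per-bit `inf {n P / J : there is an (n, 2^J, ε, P) code}`
(`⊤` if there is no such code). -/
def minEnergyPerBit (n J K L : ℕ) (ε : ℝ) : EReal :=
  ⨅ P ∈ {P : ℝ | 0 < P ∧ Nonempty (Code n (2 ^ J) K L ε P)}, ((n * P / J : ℝ) : EReal)

/-! ## The terms of the bound -/

/-- The lower incomplete gamma function `γ(s, a)`, equal to `0` for `a ≤ 0`. -/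
def lowerGamma (s a : ℝ) : ℝ :=
  ∫ x in Set.Ioc 0 a, x ^ (s - 1) * Real.exp (-x)

/-- The ratio `γ(s, a) / Γ(s)`. -/
def gammaRatio (s a : ℝ) : ℝ :=
  lowerGamma s a / Real.Gamma s

def p0 (n K : ℕ) (P P' : ℝ) : ℝ :=
  K * (1 - gammaRatio n (n * P / P'))

/-- The selection matrix (`MK × K`) that picks the codeword `w k` of each user `k ∈ S`. -/
def selection {M K : ℕ} (S : Finset (Fin K)) (w : Fin K → Fin M) :
    Matrix (Fin K × Fin M) (Fin K) ℂ :=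
  Matrix.of fun p k => if p.1 = k ∧ k ∈ S ∧ p.2 = w k then 1 else 0

/-- The matrix `B̃` built from `A₁ = Ã_{S₁}` and `A₂ = Ã'_{S₂}` (used for `u ≠ r ω`). -/
def Btilde {n K : ℕ} (A₁ A₂ : Matrix (Fin n) (Fin K) ℂ) (ω u r : ℝ) : Matrix (Fin K) (Fin K) ℂ :=
  ((1 + r - u) * (u - r * ω) / (1 + r * (1 - ω))) •
      ((A₁ - (u / (u - r * ω)) • A₂)ᴴ * (A₁ - (u / (u - r * ω)) • A₂))
    - (r * ω * u / (u - r * ω)) • (A₂ᴴ * A₂)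

/-- The minimum over `u, r ≥ 0` with `λ_min(B̃) > -1` of
`exp (-L (n ln (1 + r (1 - ω)) + ln |I + B̃| - r n ν))`. -/
def chernoffMin {n K : ℕ} (L : ℕ) (A₁ A₂ : Matrix (Fin n) (Fin K) ℂ) (ω ν : ℝ) : ℝ :=
  sInf {x : ℝ | ∃ u r : ℝ, 0 ≤ u ∧ 0 ≤ r ∧ u ≠ r * ω ∧
    (∀ μ ∈ spectrum ℝ (Btilde A₁ A₂ ω u r), -1 < μ) ∧
    x = Real.exp (-L * (n * Real.log (1 + r * (1 - ω))
      + Real.log (1 + Btilde A₁ A₂ ω u r).det.re - r * n * ν))}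

/-- `q_{1,t}(ω, ν)` with `S₁ = S₂ = S` of size `t` and `K_a = K`; only `t₀ = t` contributes, and
`C_{t,t} = (K choose t) (M - 1)^t`. `A` is the `n × MK` matrix of all codebooks, `w` the transmitted
and `w'` the decoded messages. -/
def q1 (n L : ℕ) {M K : ℕ} (t : ℕ) (P' : ℝ) (S : Finset (Fin K)) (w w' : Fin K → Fin M)
    (ω ν : ℝ) : ℝ :=
  K.choose t * ((M : ℝ) - 1) ^ t *
    ∫ A, chernoffMin L (Matrix.of A * selection S w) (Matrix.of A * selection S w') ω ν
      ∂(gaussianMatrix (Fin n) (Fin K × Fin M) P')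

/-- The determinant `|I_n + c Ã Ã^H|` (a real number). -/
def gramDet {n K : ℕ} (c : ℝ) (A : Matrix (Fin n) (Fin K) ℂ) : ℝ :=
  (1 + c • (A * Aᴴ)).det.re

/-- `q_{2,t}(ω, ν)` with `S₁ = S` and `K_a = K`. -/
def q2 (n L : ℕ) {M K : ℕ} (t : ℕ) (P' : ℝ) (S : Finset (Fin K)) (w : Fin K → Fin M)
    (ω ν : ℝ) : ℝ :=
  if ω = 0 then 1 - gammaRatio (n * L) (n * L * ν)
  else if t < n then
    sInf {x : ℝ | ∃ η δ : ℝ, 0 ≤ η ∧ 0 ≤ δ ∧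
      x = K.choose t * (∫ A, gammaRatio (t * L)
            (L * ((t * (1 + η) - n * ν + n * (1 + δ) * (1 - ω)) *
              gramDet ω (Matrix.of A * selection S w) ^ (-(1 / t : ℝ))))
            ∂(gaussianMatrix (Fin n) (Fin K × Fin M) P'))
        + K.choose t * (2 - gammaRatio (t * L) (t * L * (1 + η))
            - gammaRatio (n * L) (n * L * (1 + δ)))}
  else
    sInf {x : ℝ | ∃ η : ℝ, 0 ≤ η ∧
      x = K.choose t * (∫ A, gammaRatio (n * L)
            (n * L * (1 + η - ν) /
              (ω * gramDet 1 (Matrix.of A * selection S w) ^ (1 / n : ℝ)))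
            ∂(gaussianMatrix (Fin n) (Fin K × Fin M) P'))
        + 1 - gammaRatio (n * L) (n * L * (1 + η))}

/-- `p̃_{1,t}`, the minimum of `q_{1,t} + q_{2,t}` over `0 ≤ ω ≤ 1` and `0 ≤ ν`. -/
def p1 (n L : ℕ) {M K : ℕ} (t : ℕ) (P' : ℝ) (S : Finset (Fin K)) (w w' : Fin K → Fin M) : ℝ :=
  sInf {x : ℝ | ∃ ω ν : ℝ, 0 ≤ ω ∧ ω ≤ 1 ∧ 0 ≤ ν ∧
    x = q1 n L t P' S w w' ω ν + q2 n L t P' S w ω ν}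

/-- `E |I_t + c G G^H|^{-L}` for a `t × m` matrix `G` with i.i.d. `CN(0,1)` entries. -/
def detMoment (t m L : ℕ) (c : ℝ) : ℝ :=
  ∫ G, ((1 + c • (Matrix.of G * (Matrix.of G)ᴴ)).det.re ^ L)⁻¹ ∂(gaussianMatrix (Fin t) (Fin m) 1)

/-- `p̃_{2,t}`, the minimum over `0 ≤ ρ ≤ 1` for which `m = ρ n` is a nonnegative integer. -/
def p2 (n M K L t : ℕ) (P' : ℝ) : ℝ :=
  sInf {x : ℝ | ∃ (ρ : ℝ) (m : ℕ), 0 ≤ ρ ∧ ρ ≤ 1 ∧ ρ * n = m ∧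
    x = K.choose t * (M : ℝ) ^ (ρ * t) * detMoment t m L (P' / (1 + ρ))}

/-- The closed form `q(ρ)`, with `m = ρ n`. -/
def qClosed (M K L t : ℕ) (P' ρ : ℝ) (m : ℕ) : ℝ :=
  if t + L ≤ m then
    K.choose t * (M : ℝ) ^ (ρ * t) * ((P' / (1 + ρ)) ^ (L * t))⁻¹ *
      ∏ i ∈ Finset.Icc (m - t + 1) m, Real.Gamma ((i : ℝ) - L) / Real.Gamma i
  else if m + L ≤ t then
    K.choose t * (M : ℝ) ^ (ρ * t) * ((P' / (1 + ρ)) ^ (L * m))⁻¹ *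
      ∏ i ∈ Finset.Icc (t - m + 1) t, Real.Gamma ((i : ℝ) - L) / Real.Gamma i
  else 1

/-- `p̃^u_{2,t}`, the minimum of `q(ρ)` over the same `ρ`. -/
def p2u (n M K L t : ℕ) (P' : ℝ) : ℝ :=
  sInf {x : ℝ | ∃ (ρ : ℝ) (m : ℕ), 0 ≤ ρ ∧ ρ ≤ 1 ∧ ρ * n = m ∧ x = qClosed M K L t P' ρ m}

/-- The upper bound on the PUPE at power `P`: the infimum over `0 < P' < P` of
`p̃₀ + ∑_{t=1}^K (t/K) min {1, p̃_{1,t}, p̃_{2,t}}`, where `S t` is the set `S₁ = S₂` of size `t`. -/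
def pupeBound (n L : ℕ) {M K : ℕ} (P : ℝ) (S : ℕ → Finset (Fin K)) (w w' : Fin K → Fin M) : ℝ :=
  sInf {x : ℝ | ∃ P' : ℝ, 0 < P' ∧ P' < P ∧
    x = p0 n K P P' + ∑ t ∈ Finset.Icc 1 K,
      (t / K : ℝ) * min 1 (min (p1 n L t P' (S t) w w') (p2 n M K L t P'))}

end

end MassiveAccess

open MassiveAccess

namespace MassiveAccess

open scoped ENNReal ComplexOrder

/-! ## Product measures -/

section Product

variable {ι κ : Type*} [Fintype ι] [Fintype κ]

/-! Claim 1 is random coding. All codewords are drawn i.i.d. `CN(0, P')`, those above the power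
limit are replaced by `0`, and the receiver picks the message vector minimising the Frobenius
distance for the untruncated codebook. Truncation matters only if one of the `K` sent codewords is
too long, which costs `p0`. Otherwise, if `t` users are wrong, some rival differing from the truth
exactly on a set of size `t` is at least as close to the output, and the PUPE is charged `t / K`.
`lintegral_errorEvent_le` bounds the averaged probability of this event in three ways: by `1`, by
`p1` and by `p2`.

For `p1` the event is split according to whether the noise energy is at most `ω` times the residual
of the hypothesis missing the `t` users, plus `n L ν`. Inside this region a union bound and a
Chernoff bound with multipliers `u, r` lead to an explicit Gaussian integral
(`lintegral_goodErrorEvent_le`). Outside it (`lintegral_noiseEvent_le`) the main tool is a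
rearrangement inequality: among ellipsoids of equal volume the centred ball has the largest Gaussian
measure (`gaussianVec_sqn_mulVec_le`), which turns a small quadratic form into a gamma ratio with a
determinant. For `t < n` this is preceded by a reduction to `t` dimensions and a coupling of each
singular direction (`exists_unit_combination`, `measure_noise_gt_le`).

For `p2`, Gallager's `min 1 y ≤ y ^ ρ` is applied conditionally on fading, noise and sent codewords.
With tilt `1 / (1 + ρ)` the average factors over channel uses, each giving a determinant to the
power `-ρ`; together they give the exponent `ρ n = m` (`lintegral_rivalEvent_le`).

The bound is an infimum over `P'` that need not be attained, so averaging alone gives codes only for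
values above it. `exists_optimal_code` closes the gap: codebooks under a power constraint form a
compact set, the success probability of the Bayes decoder is continuous in the codebook, hence one
code is at least as good as all others and so meets the infimum.

Claim 2 rests on a duality. The inverse determinant is a Gaussian average of `exp (-c ‖Gᴴ h‖²)`, so
by Fubini the number of columns and the exponent in the negative determinant moment can be exchanged
(`lintegral_det_swap`). After the exchange the Gaussian factor `exp (-‖H‖²) ≤ 1` is dropped, and the
remaining Lebesgue integral is Hua's, computed column by column (`detMoment_le_of_add_le`). The
other regime follows by transposing the matrix. -/

theorem lintegral_fin_prod {n : ℕ} {X : Type*} [MeasurableSpace X] (μ : Fin n → Measure X)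
    [∀ i, SigmaFinite (μ i)] (f : Fin n → X → ℝ≥0∞) (hf : ∀ i, Measurable (f i)) :
    ∫⁻ x, ∏ i, f i (x i) ∂(Measure.pi μ) = ∏ i, ∫⁻ x, f i x ∂(μ i) := by
  induction n with
  | zero => simp
  | succ n ih =>
    rw [← ((measurePreserving_piFinSuccAbove μ 0).symm).lintegral_comp_emb
      (MeasurableEquiv.measurableEmbedding _)]
    have : ∀ a : X × (Fin n → X),
        ∏ i, f i ((MeasurableEquiv.piFinSuccAbove (fun _ => X) 0).symm a i)
          = f 0 a.1 * ∏ i : Fin n, f i.succ (a.2 i) := by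
      intro a
      rw [Fin.prod_univ_succ]
      simp [MeasurableEquiv.piFinSuccAbove]
    simp_rw [this]
    have hg : Measurable fun y : Fin n → X => ∏ i : Fin n, f i.succ (y i) :=
      Finset.measurable_prod _ fun i _ => (hf i.succ).comp (measurable_pi_apply i)
    rw [lintegral_prod_mul (hf 0).aemeasurable hg.aemeasurable, Fin.prod_univ_succ]
    congr 1
    exact ih (fun i => μ i.succ) (fun i => f i.succ) fun i => hf i.succ

theorem lintegral_pi_prod {X : Type*} [MeasurableSpace X] (μ : ι → Measure X)
    [∀ i, SigmaFinite (μ i)] (f : ι → X → ℝ≥0∞) (hf : ∀ i, Measurable (f i)) :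
    ∫⁻ x, ∏ i, f i (x i) ∂(Measure.pi μ) = ∏ i, ∫⁻ x, f i x ∂(μ i) := by
  let e := (Fintype.equivFin ι).symm
  rw [← (measurePreserving_piCongrLeft μ e).lintegral_comp_emb
      (MeasurableEquiv.measurableEmbedding _)]
  rw [← e.prod_comp (fun i => ∫⁻ x, f i x ∂(μ i)),
    ← lintegral_fin_prod (fun i => μ (e i)) (fun i => f (e i)) (fun i => hf (e i))]
  refine lintegral_congr fun a => ?_
  rw [← e.prod_comp]
  refine Finset.prod_congr rfl fun i _ => ?_
  congr 1
  exact Equiv.piCongrLeft_apply_apply (fun _ => X) e a i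

theorem pi_withDensity {X : Type*} [MeasurableSpace X] (μ : ι → Measure X)
    [∀ i, SigmaFinite (μ i)] (f : ι → X → ℝ≥0∞) (hf : ∀ i, Measurable (f i))
    [∀ i, SigmaFinite ((μ i).withDensity (f i))] :
    Measure.pi (fun i => (μ i).withDensity (f i))
      = (Measure.pi μ).withDensity (fun x => ∏ i, f i (x i)) := by
  refine Measure.pi_eq fun s hs => ?_
  rw [withDensity_apply _ (MeasurableSet.univ_pi hs), Measure.restrict_pi_pi,
    lintegral_pi_prod _ _ hf]
  exact Finset.prod_congr rfl fun i _ => (withDensity_apply _ (hs i)).symm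

/-- Uncurrying preserves product measures. -/
theorem measurePreserving_uncurry {X : Type*} [MeasurableSpace X] (μ : ι → κ → Measure X)
    [∀ i j, SigmaFinite (μ i j)] :
    MeasurePreserving (MeasurableEquiv.curry ι κ X).symm
      (Measure.pi fun i => Measure.pi fun j => μ i j) (Measure.pi fun p : ι × κ => μ p.1 p.2) := by
  refine ⟨MeasurableEquiv.measurable _, (Measure.pi_eq fun s hs => ?_).symm⟩
  rw [MeasurableEquiv.map_apply]
  have : (MeasurableEquiv.curry ι κ X).symm ⁻¹' (Set.univ.pi s)
      = Set.univ.pi fun i => Set.univ.pi fun j => s (i, j) := by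
    ext x
    simp [MeasurableEquiv.curry, Set.mem_pi, Function.uncurry]
  rw [this]
  simp_rw [Measure.pi_pi]
  rw [Fintype.prod_prod_type]

/-- Transposing a matrix preserves product measures. -/
theorem measurePreserving_swap {X : Type*} [MeasurableSpace X] (μ : ι → κ → Measure X)
    [∀ i j, SigmaFinite (μ i j)] :
    MeasurePreserving (fun (A : ι → κ → X) j i => A i j)
      (Measure.pi fun i => Measure.pi fun j => μ i j)
      (Measure.pi fun j => Measure.pi fun i => μ i j) := by
  have h1 := measurePreserving_uncurry μ
  have h2 := (measurePreserving_uncurry (fun j i => μ i j)).symm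
  have h3 : MeasurePreserving (fun (x : ι × κ → X) (p : κ × ι) => x p.swap)
      (Measure.pi fun p : ι × κ => μ p.1 p.2) (Measure.pi fun p : κ × ι => μ p.2 p.1) := by
    refine ⟨by fun_prop, (Measure.pi_eq fun s hs => ?_).symm⟩
    have hm : Measurable fun (x : ι × κ → X) (p : κ × ι) => x p.swap := by fun_prop
    rw [Measure.map_apply hm (MeasurableSet.univ_pi hs)]
    have : (fun (x : ι × κ → X) (p : κ × ι) => x p.swap) ⁻¹' (Set.univ.pi s)
        = Set.univ.pi fun p : ι × κ => s p.swap := by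
      ext x
      simp only [Set.mem_preimage, Set.mem_pi, Set.mem_univ, true_implies, Prod.forall,
        Prod.swap_prod_mk]
      exact forall_comm
    rw [this, Measure.pi_pi]
    exact (Equiv.prodComm ι κ).prod_comp fun p => (μ p.2 p.1) (s p)
  exact (h2.comp (h3.comp h1))

/-- Restricting along an injection preserves products of probability measures. -/
theorem measurePreserving_comp_injective {X : Type*} [MeasurableSpace X] (μ : ι → Measure X)
    [∀ i, IsProbabilityMeasure (μ i)] (f : κ → ι) (hf : Function.Injective f) :
    MeasurePreserving (fun (x : ι → X) k => x (f k)) (Measure.pi μ)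
      (Measure.pi fun k => μ (f k)) := by
  classical
  have hm : Measurable fun (x : ι → X) k => x (f k) := by fun_prop
  refine ⟨hm, (Measure.pi_eq fun s hs => ?_).symm⟩
  rw [Measure.map_apply hm (MeasurableSet.univ_pi hs)]
  -- The preimage of a box is a box whose side at `i` is an intersection over the fibre of `f`. By
  -- injectivity the fibre has at most one point; off the range the side is the whole space, which
  -- has mass one.
  have : (fun (x : ι → X) k => x (f k)) ⁻¹' (Set.univ.pi s)
      = Set.univ.pi fun i => ⋂ k, ⋂ _ : f k = i, s k := by
    ext x
    simp only [Set.mem_preimage, Set.mem_pi, Set.mem_univ, true_implies, Set.mem_iInter]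
    exact ⟨fun h i k hk => hk ▸ h k, fun h k => h _ k rfl⟩
  rw [this, Measure.pi_pi, ← Finset.prod_subset (Finset.subset_univ (Finset.univ.image f)),
    Finset.prod_image (fun a _ b _ h => hf h)]
  · refine Finset.prod_congr rfl fun k _ => ?_
    congr 1
    ext y
    simp only [Set.mem_iInter]
    exact ⟨fun h => h k rfl, fun h k' hk' => hf hk' ▸ h⟩
  · intro i _ hi
    have : (⋂ k, ⋂ _ : f k = i, s k) = Set.univ := by
      simp only [Set.iInter_eq_univ]
      intro k hk
      exact absurd (Finset.mem_image.2 ⟨k, Finset.mem_univ _, hk⟩) hi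
    rw [this, measure_univ]

end Product

/-! ## Complex Gaussian vectors and matrices -/

section Gaussian

/-- The squared Euclidean norm of a complex vector. -/
noncomputable def sqn {ι : Type*} [Fintype ι] (x : ι → ℂ) : ℝ := ∑ i, ‖x i‖ ^ 2

/-- The squared Frobenius norm of a complex matrix. -/
noncomputable def frob {ι κ : Type*} [Fintype ι] [Fintype κ] (x : ι → κ → ℂ) : ℝ := ∑ i, sqn (x i)

/-- The law of a column vector with i.i.d. `CN(0, v)` entries. -/
noncomputable def gaussianVec (ι : Type*) [Fintype ι] (v : ℝ) : Measure (ι → ℂ) :=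
  Measure.pi fun _ => complexGaussian v

variable {ι κ : Type} [Fintype ι] [Fintype κ]

theorem sqn_nonneg {ι : Type*} [Fintype ι] (x : ι → ℂ) : 0 ≤ sqn x :=
  Finset.sum_nonneg fun _ _ => sq_nonneg _

theorem frob_nonneg {ι κ : Type*} [Fintype ι] [Fintype κ] (x : ι → κ → ℂ) : 0 ≤ frob x :=
  Finset.sum_nonneg fun _ _ => sqn_nonneg _

theorem frob_swap {ι κ : Type*} [Fintype ι] [Fintype κ] (x : ι → κ → ℂ) :
    frob (fun j i => x i j) = frob x := by
  unfold frob sqn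
  exact Finset.sum_comm

@[fun_prop]
theorem continuous_sqn {ι : Type*} [Fintype ι] : Continuous (sqn : (ι → ℂ) → ℝ) := by
  unfold sqn
  fun_prop

@[fun_prop]
theorem continuous_frob {ι κ : Type*} [Fintype ι] [Fintype κ] :
    Continuous (frob : (ι → κ → ℂ) → ℝ) := by
  unfold frob
  exact continuous_finsetSum _ fun i _ => continuous_sqn.comp (continuous_apply i)

@[fun_prop]
theorem measurable_sqn {ι : Type*} [Fintype ι] : Measurable (sqn : (ι → ℂ) → ℝ) := by
  unfold sqn
  fun_prop

@[fun_prop]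
theorem measurable_frob {ι κ : Type*} [Fintype ι] [Fintype κ] :
    Measurable (frob : (ι → κ → ℂ) → ℝ) := by
  unfold frob sqn
  fun_prop

instance isProbabilityMeasure_complexGaussian (v : ℝ) :
    IsProbabilityMeasure (complexGaussian v) := by
  unfold complexGaussian
  refine Measure.isProbabilityMeasure_map ?_
  exact (Complex.measurableEquivRealProd.symm.measurable).aemeasurable

instance isProbabilityMeasure_gaussianVec {ι : Type*} [Fintype ι] (v : ℝ) :
    IsProbabilityMeasure (gaussianVec ι v) := by
  unfold gaussianVec
  infer_instance

instance isProbabilityMeasure_gaussianMatrix (v : ℝ) :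
    IsProbabilityMeasure (gaussianMatrix ι κ v) := by
  unfold gaussianMatrix
  infer_instance

theorem gaussianMatrix_eq (v : ℝ) :
    gaussianMatrix ι κ v = Measure.pi fun _ => gaussianVec κ v := rfl

/-- Both coordinates have variance `1 / 2`, so the two normalising constants `(√π)⁻¹` multiply to
`π⁻¹` and the exponents add up to `-‖z‖ ^ 2`. -/
theorem complexGaussian_one :
    complexGaussian 1
      = volume.withDensity fun z : ℂ => ENNReal.ofReal (Real.pi⁻¹ * Real.exp (-‖z‖ ^ 2)) := by
  have hv : ((1 : ℝ) / 2).toNNReal ≠ 0 := by simp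
  have hc : (((1 : ℝ) / 2).toNNReal : ℝ) = 1 / 2 := Real.coe_toNNReal _ (by norm_num)
  have hmap : (fun p : ℝ × ℝ => (⟨p.1, p.2⟩ : ℂ)) = Complex.measurableEquivRealProd.symm := by
    ext p
    simp
  rw [complexGaussian, hmap, gaussianReal_of_var_ne_zero 0 hv,
    prod_withDensity (measurable_gaussianPDF _ _) (measurable_gaussianPDF _ _)]
  ext s hs
  rw [MeasurableEquiv.map_apply, withDensity_apply _ (MeasurableEquiv.measurable _ hs),
    withDensity_apply _ hs,
    ← (Complex.volume_preserving_equiv_real_prod.symm _).setLIntegral_comp_preimage hs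
      (by fun_prop)]
  refine setLIntegral_congr_fun (MeasurableEquiv.measurable _ hs) fun p _ => ?_
  simp only [gaussianPDF, gaussianPDFReal]
  rw [← ENNReal.ofReal_mul (by positivity)]
  congr 1
  have h1 : ‖Complex.measurableEquivRealProd.symm p‖ ^ 2 = p.1 ^ 2 + p.2 ^ 2 := by
    rw [Complex.sq_norm, Complex.normSq_apply]
    simp [sq]
  rw [h1, hc]
  have h2 : √(2 * Real.pi * (1 / 2)) = √Real.pi := by congr 1; ring
  rw [h2]
  rw [mul_mul_mul_comm, ← mul_inv, Real.mul_self_sqrt Real.pi_pos.le, ← Real.exp_add]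
  congr 2
  ring

theorem gaussianVec_one {ι : Type*} [Fintype ι] :
    gaussianVec ι 1 = volume.withDensity fun x : ι → ℂ =>
      ENNReal.ofReal ((Real.pi ^ Fintype.card ι)⁻¹ * Real.exp (-sqn x)) := by
  have : ∀ _ : ι, SigmaFinite ((volume : Measure ℂ).withDensity fun z : ℂ =>
      ENNReal.ofReal (Real.pi⁻¹ * Real.exp (-‖z‖ ^ 2))) := by
    intro _
    rw [← complexGaussian_one]
    infer_instance
  rw [gaussianVec, complexGaussian_one, pi_withDensity _ _ (fun _ => by fun_prop), volume_pi]
  congr 1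
  ext x
  rw [← ENNReal.ofReal_prod_of_nonneg (fun _ _ => by positivity)]
  rw [Finset.prod_mul_distrib, ← Real.exp_sum]
  simp [sqn]

theorem gaussianMatrix_one :
    gaussianMatrix ι κ 1 = volume.withDensity fun x : ι → κ → ℂ =>
      ENNReal.ofReal ((Real.pi ^ (Fintype.card ι * Fintype.card κ))⁻¹ * Real.exp (-frob x)) := by
  have : ∀ _ : ι, SigmaFinite ((volume : Measure (κ → ℂ)).withDensity fun x =>
      ENNReal.ofReal ((Real.pi ^ Fintype.card κ)⁻¹ * Real.exp (-sqn x))) := by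
    intro _
    rw [← gaussianVec_one]
    infer_instance
  rw [gaussianMatrix_eq, gaussianVec_one, pi_withDensity _ _ (fun _ => by fun_prop), volume_pi]
  congr 1
  ext x
  rw [← ENNReal.ofReal_prod_of_nonneg (fun _ _ => by positivity)]
  rw [Finset.prod_mul_distrib, ← Real.exp_sum]
  simp [frob, pow_mul, mul_comm (Fintype.card ι)]

/-- `CN(0, v)` is the law of `√v` times a `CN(0, 1)` variable. -/
theorem measurePreserving_complexGaussian_smul {v : ℝ} (hv : 0 ≤ v) :
    MeasurePreserving (fun z : ℂ => (√v : ℂ) * z) (complexGaussian 1) (complexGaussian v) := by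
  refine ⟨by fun_prop, ?_⟩
  have hm : Measurable (fun p : ℝ × ℝ => (⟨p.1, p.2⟩ : ℂ)) :=
    Complex.measurableEquivRealProd.symm.measurable
  have h1 : gaussianReal 0 (v / 2).toNNReal
      = (gaussianReal 0 ((1 : ℝ) / 2).toNNReal).map (√v * ·) := by
    rw [gaussianReal_map_const_mul]
    congr 1
    · simp
    · ext
      rw [NNReal.coe_mul, Real.coe_toNNReal _ (by positivity), Real.coe_toNNReal _ (by positivity)]
      simp only [NNReal.coe_mk, Real.sq_sqrt hv]
      ring
  rw [complexGaussian, complexGaussian, h1, Measure.map_prod_map _ _ (by fun_prop) (by fun_prop),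
    Measure.map_map (by fun_prop) hm, Measure.map_map hm (by fun_prop)]
  congr 1
  ext p
  apply Complex.ext <;> simp

theorem measurePreserving_gaussianVec_smul {ι : Type*} [Fintype ι] {v : ℝ} (hv : 0 ≤ v) :
    MeasurePreserving (fun (x : ι → ℂ) i => (√v : ℂ) * x i) (gaussianVec ι 1)
      (gaussianVec ι v) :=
  measurePreserving_pi _ _ fun _ => measurePreserving_complexGaussian_smul hv

theorem measurePreserving_gaussianMatrix_swap (v : ℝ) :
    MeasurePreserving (fun (x : ι → κ → ℂ) j i => x i j) (gaussianMatrix ι κ v)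
      (gaussianMatrix κ ι v) :=
  measurePreserving_swap fun _ _ => complexGaussian v

/-- Integrating a product over the columns of a Gaussian matrix. -/
theorem lintegral_gaussianMatrix_columns (v : ℝ) (f : (ι → ℂ) → ℝ≥0∞) (hf : Measurable f) :
    ∫⁻ x, ∏ j, f (fun i => x i j) ∂(gaussianMatrix ι κ v)
      = (∫⁻ y, f y ∂(gaussianVec ι v)) ^ Fintype.card κ := by
  rw [(measurePreserving_gaussianMatrix_swap v).lintegral_comp (f := fun x => ∏ j, f (x j))
    (by fun_prop), gaussianMatrix_eq, lintegral_pi_prod _ _ fun _ => hf]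
  simp

end Gaussian

/-! ## Gaussian integrals of quadratic forms -/

section QuadForm

variable {ι κ : Type*} [Fintype ι] [Fintype κ]

theorem re_star_dotProduct_self (x : ι → ℂ) : (star x ⬝ᵥ x).re = sqn x := by
  simp only [dotProduct, sqn, Complex.re_sum]
  refine Finset.sum_congr rfl fun i _ => ?_
  rw [Pi.star_apply, Complex.star_def, Complex.conj_mul', ← Complex.ofReal_pow, Complex.ofReal_re]

theorem sqn_add (x y : ι → ℂ) : sqn (x + y) = sqn x + sqn y + 2 * (star x ⬝ᵥ y).re := by
  have h : (star y ⬝ᵥ x).re = (star x ⬝ᵥ y).re := by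
    rw [← Complex.conj_re, ← Complex.star_def, Matrix.star_dotProduct, star_star, dotProduct_comm]
  rw [← re_star_dotProduct_self, star_add, add_dotProduct, dotProduct_add, dotProduct_add,
    Complex.add_re, Complex.add_re, Complex.add_re, h, re_star_dotProduct_self,
    re_star_dotProduct_self]
  ring

theorem sqn_smul (c : ℝ) (x : ι → ℂ) : sqn (c • x) = c ^ 2 * sqn x := by
  simp [sqn, Finset.mul_sum, mul_pow]

theorem sqn_neg (x : ι → ℂ) : sqn (-x) = sqn x := by
  simp [sqn]

theorem sqn_sub (x y : ι → ℂ) : sqn (x - y) = sqn x + sqn y - 2 * (star x ⬝ᵥ y).re := by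
  rw [sub_eq_add_neg, sqn_add, sqn_neg, dotProduct_neg, Complex.neg_re]
  ring

theorem sqn_mulVec (A : Matrix κ ι ℂ) (x : ι → ℂ) :
    sqn (A *ᵥ x) = (star x ⬝ᵥ ((Aᴴ * A) *ᵥ x)).re := by
  rw [← re_star_dotProduct_self, Matrix.star_mulVec, ← Matrix.dotProduct_mulVec,
    Matrix.mulVec_mulVec]

theorem star_dotProduct_mulVec (A : Matrix κ ι ℂ) (y : κ → ℂ) (x : ι → ℂ) :
    star y ⬝ᵥ (A *ᵥ x) = star (Aᴴ *ᵥ y) ⬝ᵥ x := by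
  rw [Matrix.star_mulVec, Matrix.conjTranspose_conjTranspose, Matrix.dotProduct_mulVec]

/-- No integration is needed: this is the statement that the standard Gaussian density has total
mass one. -/
theorem lintegral_exp_neg_sqn :
    ∫⁻ x : ι → ℂ, ENNReal.ofReal (Real.exp (-sqn x))
      = ENNReal.ofReal (Real.pi ^ Fintype.card ι) := by
  have h := measure_univ (μ := gaussianVec ι 1)
  rw [gaussianVec_one, withDensity_apply _ MeasurableSet.univ, Measure.restrict_univ] at h
  simp_rw [ENNReal.ofReal_mul (show 0 ≤ (Real.pi ^ Fintype.card ι)⁻¹ by positivity)] at h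
  rw [lintegral_const_mul _ (by fun_prop)] at h
  have hp : ENNReal.ofReal (Real.pi ^ Fintype.card ι)
      * ENNReal.ofReal ((Real.pi ^ Fintype.card ι)⁻¹) = 1 := by
    rw [← ENNReal.ofReal_mul (by positivity), mul_inv_cancel₀ (by positivity), ENNReal.ofReal_one]
  calc _ = ENNReal.ofReal (Real.pi ^ Fintype.card ι) * (ENNReal.ofReal ((Real.pi ^ Fintype.card ι)⁻¹)
        * ∫⁻ x : ι → ℂ, ENNReal.ofReal (Real.exp (-sqn x))) := by
        rw [← mul_assoc, hp, one_mul]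
    _ = _ := by rw [h, mul_one]

/-- Lebesgue measure sees a complex matrix as a real one of twice the size; this is the source of
the squared modulus in every change of variables below. -/
theorem det_restrictScalars_mulVec [DecidableEq ι] (B : Matrix ι ι ℂ) :
    LinearMap.det ((Matrix.toLin' B).restrictScalars ℝ) = ‖B.det‖ ^ 2 := by
  rw [LinearMap.det_restrictScalars, LinearMap.det_toLin', Algebra.norm_complex_apply,
    Complex.sq_norm]

theorem map_mulVec_volume [DecidableEq ι] {B : Matrix ι ι ℂ} (hB : B.det ≠ 0) :
    (volume : Measure (ι → ℂ)).map (fun x => B *ᵥ x)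
      = ENNReal.ofReal ((‖B.det‖ ^ 2)⁻¹) • volume := by
  have hd : LinearMap.det ((Matrix.toLin' B).restrictScalars ℝ) ≠ 0 := by
    rw [det_restrictScalars_mulVec]
    exact pow_ne_zero _ (norm_ne_zero_iff.2 hB)
  have h := Measure.map_linearMap_addHaar_eq_smul_addHaar (volume : Measure (ι → ℂ)) hd
  rw [det_restrictScalars_mulVec, abs_of_nonneg (by positivity)] at h
  exact h

theorem lintegral_comp_mulVec [DecidableEq ι] {B : Matrix ι ι ℂ} (hB : B.det ≠ 0)
    {f : (ι → ℂ) → ℝ≥0∞} (hf : Measurable f) :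
    ∫⁻ x, f (B *ᵥ x) = ENNReal.ofReal ((‖B.det‖ ^ 2)⁻¹) * ∫⁻ x, f x := by
  rw [← smul_eq_mul, ← lintegral_smul_measure, ← map_mulVec_volume hB,
    lintegral_map hf (by fun_prop)]

open scoped MatrixOrder in
theorem exists_eq_conjTranspose_mul_self_of_posDef [DecidableEq ι] {C : Matrix ι ι ℂ}
    (hC : C.PosDef) : ∃ B : Matrix ι ι ℂ, C = Bᴴ * B ∧ B.det ≠ 0 := by
  obtain ⟨B, hB⟩ := CStarAlgebra.nonneg_iff_eq_star_mul_self.mp hC.posSemidef.nonneg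
  refine ⟨B, hB, fun h => ?_⟩
  have := hC.det_pos
  rw [hB, Matrix.det_mul, h, mul_zero] at this
  exact lt_irrefl _ this

theorem det_conjTranspose_mul_self [DecidableEq ι] (B : Matrix ι ι ℂ) :
    (Bᴴ * B).det = ((‖B.det‖ ^ 2 : ℝ) : ℂ) := by
  rw [Matrix.det_mul, Matrix.det_conjTranspose, Complex.star_def, Complex.conj_mul',
    Complex.ofReal_pow]

theorem det_re_pos_of_posDef [DecidableEq ι] {C : Matrix ι ι ℂ} (hC : C.PosDef) :
    0 < C.det.re :=
  (Complex.pos_iff.1 hC.det_pos).1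

theorem det_eq_re_of_posDef [DecidableEq ι] {C : Matrix ι ι ℂ} (hC : C.PosDef) :
    C.det = (C.det.re : ℂ) := by
  apply Complex.ext
  · simp
  · simpa using (Complex.pos_iff.1 hC.det_pos).2.symm

/-- Substitution by the scalar matrix `√s`, whose real Jacobian is `s` to the power of the complex
dimension. -/
theorem lintegral_exp_neg_mul_sqn {s : ℝ} (hs : 0 < s) :
    ∫⁻ x : ι → ℂ, ENNReal.ofReal (Real.exp (-(s * sqn x)))
      = ENNReal.ofReal ((Real.pi / s) ^ Fintype.card ι) := by
  have hm : Measurable fun x : ι → ℂ => ENNReal.ofReal (Real.exp (-sqn x)) := by fun_prop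
  classical
  have hd : ((√s : ℂ) • (1 : Matrix ι ι ℂ)).det = (√s : ℂ) ^ Fintype.card ι := by
    rw [Matrix.det_smul, Matrix.det_one, mul_one]
  have hs' : (√s : ℂ) ≠ 0 := by
    rw [Complex.ofReal_ne_zero]
    positivity
  have := lintegral_comp_mulVec (B := (√s : ℂ) • (1 : Matrix ι ι ℂ))
    (by rw [hd]; exact pow_ne_zero _ hs') hm
  rw [hd, lintegral_exp_neg_sqn, ← ENNReal.ofReal_mul (by positivity)] at this
  rw [show (Real.pi / s) ^ Fintype.card ι
    = (‖(√s : ℂ) ^ Fintype.card ι‖ ^ 2)⁻¹ * Real.pi ^ Fintype.card ι from ?_, ← this]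
  · refine lintegral_congr fun x => ?_
    congr 3
    rw [Matrix.smul_mulVec, Matrix.one_mulVec]
    have : (√s : ℂ) • x = √s • x := by
      ext i
      simp
    rw [this, sqn_smul, Real.sq_sqrt hs.le]
  · rw [norm_pow, pow_right_comm, Complex.norm_real, Real.norm_eq_abs, sq_abs,
      Real.sq_sqrt hs.le, div_pow]
    field_simp

/-- The Gaussian integral of a positive definite Hermitian form. -/
theorem lintegral_exp_neg_quadForm [DecidableEq ι] {C : Matrix ι ι ℂ} (hC : C.PosDef) :
    ∫⁻ x : ι → ℂ, ENNReal.ofReal (Real.exp (-(star x ⬝ᵥ (C *ᵥ x)).re))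
      = ENNReal.ofReal (Real.pi ^ Fintype.card ι / C.det.re) := by
  obtain ⟨B, rfl, hB⟩ := exists_eq_conjTranspose_mul_self_of_posDef hC
  simp_rw [← sqn_mulVec]
  rw [lintegral_comp_mulVec hB (f := fun x => ENNReal.ofReal (Real.exp (-sqn x))) (by fun_prop),
    lintegral_exp_neg_sqn, ← ENNReal.ofReal_mul (by positivity), det_conjTranspose_mul_self,
    Complex.ofReal_re, div_eq_inv_mul]

theorem posDef_one_add_mul_conjTranspose [DecidableEq ι] (A : Matrix ι κ ℂ) :
    (1 + A * Aᴴ).PosDef :=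
  Matrix.PosDef.one.add_posSemidef (Matrix.posSemidef_self_mul_conjTranspose A)

theorem posDef_one_add_conjTranspose_mul [DecidableEq κ] (A : Matrix ι κ ℂ) :
    (1 + Aᴴ * A).PosDef :=
  Matrix.PosDef.one.add_posSemidef (Matrix.posSemidef_conjTranspose_mul_self A)

theorem lintegral_gaussianVec_one {f : (ι → ℂ) → ℝ≥0∞} (hf : Measurable f) :
    ∫⁻ x, f x ∂(gaussianVec ι 1) = ENNReal.ofReal ((Real.pi ^ Fintype.card ι)⁻¹)
      * ∫⁻ x, ENNReal.ofReal (Real.exp (-sqn x)) * f x := by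
  rw [gaussianVec_one, lintegral_withDensity_eq_lintegral_mul _ (by fun_prop) hf,
    ← lintegral_const_mul _ (by fun_prop)]
  refine lintegral_congr fun x => ?_
  rw [Pi.mul_apply, ENNReal.ofReal_mul (by positivity), mul_assoc]

/-- Completing the square: `‖y - A h‖² + ‖h‖²` in terms of `h - Aᴴ (1 + A Aᴴ)⁻¹ y`. -/
theorem sqn_sub_mulVec_add_sqn [DecidableEq ι] [DecidableEq κ] (A : Matrix ι κ ℂ) (y : ι → ℂ)
    (h : κ → ℂ) :
    sqn (y - A *ᵥ (h + Aᴴ *ᵥ ((1 + A * Aᴴ)⁻¹ *ᵥ y))) + sqn (h + Aᴴ *ᵥ ((1 + A * Aᴴ)⁻¹ *ᵥ y))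
      = (star h ⬝ᵥ ((1 + Aᴴ * A) *ᵥ h)).re + (star y ⬝ᵥ ((1 + A * Aᴴ)⁻¹ *ᵥ y)).re := by
  -- Since `y = p + A Aᴴ p`, every term can be expressed through `p` and `h`; the cross terms are
  -- then `⟨p, A h⟩` and `⟨Aᴴ p, h⟩`, which cancel.
  set p := (1 + A * Aᴴ)⁻¹ *ᵥ y with hp
  have hy : y = p + A *ᵥ (Aᴴ *ᵥ p) := by
    have : (1 + A * Aᴴ) *ᵥ p = y := by
      rw [hp, Matrix.mulVec_mulVec, Matrix.mul_nonsing_inv _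
        ((posDef_one_add_mul_conjTranspose A).isUnit.map Matrix.detMonoidHom), Matrix.one_mulVec]
    conv_lhs => rw [← this, Matrix.add_mulVec, Matrix.one_mulVec, ← Matrix.mulVec_mulVec]
  have h1 : y - A *ᵥ (h + Aᴴ *ᵥ p) = p - A *ᵥ h := by
    rw [hy, Matrix.mulVec_add]
    abel
  have h2 : (star y ⬝ᵥ p).re = sqn p + sqn (Aᴴ *ᵥ p) := by
    conv_lhs => rw [hy]
    rw [star_add, add_dotProduct, Complex.add_re, re_star_dotProduct_self, Matrix.star_mulVec,
      ← Matrix.dotProduct_mulVec, re_star_dotProduct_self]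
  have h3 : (star h ⬝ᵥ ((1 + Aᴴ * A) *ᵥ h)).re = sqn h + sqn (A *ᵥ h) := by
    rw [Matrix.add_mulVec, Matrix.one_mulVec, dotProduct_add, Complex.add_re,
      re_star_dotProduct_self, ← sqn_mulVec]
  rw [h1, h2, h3, sqn_sub, add_comm h, sqn_add, ← star_dotProduct_mulVec]
  ring

/-- The Gaussian average of `exp (-‖y - A h‖²)`. -/
theorem lintegral_gaussianVec_exp_neg_sqn_sub [DecidableEq ι] [DecidableEq κ] (A : Matrix ι κ ℂ)
    (y : ι → ℂ) :
    ∫⁻ h, ENNReal.ofReal (Real.exp (-sqn (y - A *ᵥ h))) ∂(gaussianVec κ 1)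
      = ENNReal.ofReal (((1 + A * Aᴴ).det.re)⁻¹
          * Real.exp (-(star y ⬝ᵥ ((1 + A * Aᴴ)⁻¹ *ᵥ y)).re)) := by
  have hm : Measurable fun h : κ → ℂ => ENNReal.ofReal (Real.exp (-sqn (y - A *ᵥ h))) := by
    fun_prop
  -- Translation invariance moves the centre of the square to the origin, so that only the form `1 +
  -- Aᴴ A` is left to integrate.
  rw [lintegral_gaussianVec_one hm,
    ← lintegral_add_right_eq_self _ (Aᴴ *ᵥ ((1 + A * Aᴴ)⁻¹ *ᵥ y))]
  have key : ∀ h : κ → ℂ,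
      ENNReal.ofReal (Real.exp (-sqn (h + Aᴴ *ᵥ ((1 + A * Aᴴ)⁻¹ *ᵥ y))))
        * ENNReal.ofReal (Real.exp (-sqn (y - A *ᵥ (h + Aᴴ *ᵥ ((1 + A * Aᴴ)⁻¹ *ᵥ y)))))
      = ENNReal.ofReal (Real.exp (-(star y ⬝ᵥ ((1 + A * Aᴴ)⁻¹ *ᵥ y)).re))
        * ENNReal.ofReal (Real.exp (-(star h ⬝ᵥ ((1 + Aᴴ * A) *ᵥ h)).re)) := by
    intro h
    rw [← ENNReal.ofReal_mul (by positivity), ← ENNReal.ofReal_mul (by positivity),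
      ← Real.exp_add, ← Real.exp_add]
    congr 2
    linarith [sqn_sub_mulVec_add_sqn A y h]
  simp_rw [key]
  rw [lintegral_const_mul _ (by unfold dotProduct Matrix.mulVec; fun_prop),
    lintegral_exp_neg_quadForm (posDef_one_add_conjTranspose_mul A),
    ← ENNReal.ofReal_mul (by positivity), ← ENNReal.ofReal_mul (by positivity),
    Matrix.det_one_add_mul_comm A Aᴴ]
  congr 1
  field_simp

end QuadForm

/-! ## Negative moments of `det (1 + c G Gᴴ)` -/

section DetMoment

variable {ι κ κ' : Type} [Fintype ι] [Fintype κ] [Fintype κ'] [DecidableEq ι]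

theorem posDef_one_add_smul_mul_conjTranspose {ι κ : Type*} [Fintype ι] [Fintype κ]
    [DecidableEq ι] {c : ℝ} (hc : 0 ≤ c) (A : Matrix ι κ ℂ) : (1 + c • (A * Aᴴ)).PosDef :=
  Matrix.PosDef.one.add_posSemidef ((Matrix.posSemidef_self_mul_conjTranspose A).smul hc)

/-- Rescaling by `√c`. -/
theorem sqrt_smul_mul_conjTranspose {ι κ : Type*} [Fintype ι] [Fintype κ] {c : ℝ} (hc : 0 ≤ c)
    (A : Matrix ι κ ℂ) : (√c • A) * (√c • A)ᴴ = c • (A * Aᴴ) := by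
  rw [Matrix.conjTranspose_smul, Matrix.smul_mul, Matrix.mul_smul, smul_smul, star_trivial,
    Real.mul_self_sqrt hc]

/-- The swap `det (1 + c A Aᴴ) = det (1 + c Aᴴ A)`. -/
theorem det_one_add_smul_mul_comm {ι κ : Type*} [Fintype ι] [Fintype κ] [DecidableEq ι]
    [DecidableEq κ] (c : ℝ) (A : Matrix ι κ ℂ) (B : Matrix κ ι ℂ) :
    (1 + c • (A * B)).det = (1 + c • (B * A)).det := by
  rw [← Matrix.smul_mul, Matrix.det_one_add_mul_comm, Matrix.mul_smul]

/-- The preceding Gaussian average at `y = 0` with `A = √c Gᴴ`. Writing an inverse determinant as an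
average of exponentials is what makes the duality possible. -/
theorem lintegral_exp_neg_sqn_conjTranspose_mulVec {c : ℝ} (hc : 0 ≤ c) (G : Matrix ι κ ℂ) :
    ∫⁻ h, ENNReal.ofReal (Real.exp (-(c * sqn (Gᴴ *ᵥ h)))) ∂(gaussianVec ι 1)
      = ENNReal.ofReal (((1 + c • (G * Gᴴ)).det.re)⁻¹) := by
  classical
  have h := lintegral_gaussianVec_exp_neg_sqn_sub (√c • Gᴴ) 0
  rw [sqrt_smul_mul_conjTranspose hc, Matrix.conjTranspose_conjTranspose,
    det_one_add_smul_mul_comm] at h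
  simp only [zero_sub, sqn_neg, Matrix.smul_mulVec, sqn_smul, Real.sq_sqrt hc, star_zero,
    zero_dotProduct, Complex.zero_re, neg_zero, Real.exp_zero, mul_one] at h
  exact h

/-- Independent columns multiply, so a negative integer power of the determinant is an average over
that many columns. -/
theorem lintegral_prod_exp_neg_sqn_conjTranspose_mulVec {c : ℝ} (hc : 0 ≤ c) (G : Matrix ι κ ℂ) :
    ∫⁻ H, ∏ l, ENNReal.ofReal (Real.exp (-(c * sqn (Gᴴ *ᵥ fun i => H i l))))
        ∂(gaussianMatrix ι κ' 1)
      = ENNReal.ofReal (((1 + c • (G * Gᴴ)).det.re ^ Fintype.card κ')⁻¹) := by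
  rw [lintegral_gaussianMatrix_columns 1
      (fun h => ENNReal.ofReal (Real.exp (-(c * sqn (Gᴴ *ᵥ h))))) (by fun_prop),
    lintegral_exp_neg_sqn_conjTranspose_mulVec hc, ← inv_pow, ENNReal.ofReal_pow]
  exact inv_nonneg.2 (det_re_pos_of_posDef (posDef_one_add_smul_mul_conjTranspose hc G)).le

/-- Both sides are squared Frobenius norms, of `Gᴴ H` and of its adjoint `Hᴴ G`. -/
theorem sum_sqn_conjTranspose_mulVec_comm {ι κ κ' : Type*} [Fintype ι] [Fintype κ] [Fintype κ']
    (G : ι → κ → ℂ) (H : ι → κ' → ℂ) :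
    ∑ l, sqn ((Matrix.of G)ᴴ *ᵥ fun i => H i l) = ∑ j, sqn ((Matrix.of H)ᴴ *ᵥ fun i => G i j) := by
  unfold sqn
  rw [Finset.sum_comm]
  refine Finset.sum_congr rfl fun j _ => Finset.sum_congr rfl fun l _ => ?_
  congr 1
  rw [← Complex.norm_conj]
  congr 1
  simp [Matrix.mulVec, dotProduct, mul_comm]

omit [Fintype κ] [Fintype κ'] in
@[fun_prop]
theorem continuous_det_one_add_smul [Fintype κ] (c : ℝ) :
    Continuous fun G : ι → κ → ℂ => (1 + c • (Matrix.of G * (Matrix.of G)ᴴ)).det.re := by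
  refine Complex.continuous_re.comp (Continuous.matrix_det ?_)
  refine continuous_const.add (Continuous.const_smul ?_ c)
  have : Continuous fun G : ι → κ → ℂ => Matrix.of G := continuous_id
  exact this.matrix_mul this.matrix_conjTranspose

@[fun_prop]
theorem measurable_det_one_add_smul (c : ℝ) :
    Measurable fun G : ι → κ → ℂ => (1 + c • (Matrix.of G * (Matrix.of G)ᴴ)).det.re :=
  (continuous_det_one_add_smul c).measurable

/-- Duality: the exponent and the number of columns may be interchanged. -/
theorem lintegral_det_swap {c : ℝ} (hc : 0 ≤ c) :
    ∫⁻ G : ι → κ → ℂ, ENNReal.ofReal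
        (((1 + c • (Matrix.of G * (Matrix.of G)ᴴ)).det.re ^ Fintype.card κ')⁻¹)
        ∂(gaussianMatrix ι κ 1)
      = ∫⁻ H : ι → κ' → ℂ, ENNReal.ofReal
        (((1 + c • (Matrix.of H * (Matrix.of H)ᴴ)).det.re ^ Fintype.card κ)⁻¹)
        ∂(gaussianMatrix ι κ' 1) := by
  simp_rw [← fun G : ι → κ → ℂ =>
      lintegral_prod_exp_neg_sqn_conjTranspose_mulVec (κ' := κ') hc (Matrix.of G),
    ← fun H : ι → κ' → ℂ =>
      lintegral_prod_exp_neg_sqn_conjTranspose_mulVec (κ' := κ) hc (Matrix.of H)]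
  -- Each side is now the double average of `exp (-c ‖Gᴴ H‖²)`, with `G` and `H` in opposite orders.
  rw [lintegral_lintegral_swap]
  · refine lintegral_congr fun H => lintegral_congr fun G => ?_
    rw [← ENNReal.ofReal_prod_of_nonneg fun _ _ => (Real.exp_pos _).le,
      ← ENNReal.ofReal_prod_of_nonneg fun _ _ => (Real.exp_pos _).le, ← Real.exp_sum,
      ← Real.exp_sum, Finset.sum_neg_distrib, Finset.sum_neg_distrib, ← Finset.mul_sum,
      ← Finset.mul_sum, sum_sqn_conjTranspose_mulVec_comm]
  · refine Measurable.aemeasurable ?_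
    refine Finset.measurable_prod _ fun l _ => ?_
    refine ENNReal.measurable_ofReal.comp (Real.measurable_exp.comp (Measurable.neg ?_))
    refine Measurable.const_mul ?_ c
    refine measurable_sqn.comp (measurable_pi_lambda _ fun j => ?_)
    simp only [Matrix.mulVec, dotProduct, Matrix.conjTranspose_apply, Matrix.of_apply]
    fun_prop

/-- The determinant is at least one, which is read off from the representation as an average of
exponentials with nonpositive exponents. -/
theorem lintegral_det_le_one {c : ℝ} (hc : 0 ≤ c) (N : ℕ) :
    ∫⁻ G : ι → κ → ℂ, ENNReal.ofReal
        (((1 + c • (Matrix.of G * (Matrix.of G)ᴴ)).det.re ^ N)⁻¹) ∂(gaussianMatrix ι κ 1) ≤ 1 := by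
  have h : ∀ G : ι → κ → ℂ, ENNReal.ofReal
      (((1 + c • (Matrix.of G * (Matrix.of G)ᴴ)).det.re ^ N)⁻¹) ≤ 1 := by
    intro G
    have := lintegral_prod_exp_neg_sqn_conjTranspose_mulVec (κ' := Fin N) hc (Matrix.of G)
    rw [Fintype.card_fin] at this
    rw [← this]
    calc _ ≤ ∫⁻ _, 1 ∂(gaussianMatrix ι (Fin N) 1) := by
          refine lintegral_mono fun H => Finset.prod_le_one' fun l _ => ?_
          rw [ENNReal.ofReal_le_one, Real.exp_le_one_iff, neg_nonpos]
          exact mul_nonneg hc (sqn_nonneg _)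
      _ = 1 := by simp
  calc _ ≤ ∫⁻ _, 1 ∂(gaussianMatrix ι κ 1) := lintegral_mono h
    _ = 1 := by simp

theorem det_re_pow_inv_nonneg {c : ℝ} (hc : 0 ≤ c) (N : ℕ) (G : ι → κ → ℂ) :
    0 ≤ ((1 + c • (Matrix.of G * (Matrix.of G)ᴴ)).det.re ^ N)⁻¹ :=
  inv_nonneg.2 (pow_nonneg
    (det_re_pos_of_posDef (posDef_one_add_smul_mul_conjTranspose hc (Matrix.of G))).le _)

theorem detMoment_nonneg (t m L : ℕ) {c : ℝ} (hc : 0 ≤ c) : 0 ≤ detMoment t m L c :=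
  integral_nonneg fun _ => det_re_pow_inv_nonneg hc L _

theorem ofReal_detMoment (t m L : ℕ) {c : ℝ} (hc : 0 ≤ c) :
    ENNReal.ofReal (detMoment t m L c)
      = ∫⁻ G : Fin t → Fin m → ℂ, ENNReal.ofReal
        (((1 + c • (Matrix.of G * (Matrix.of G)ᴴ)).det.re ^ L)⁻¹)
        ∂(gaussianMatrix (Fin t) (Fin m) 1) := by
  rw [detMoment, integral_eq_lintegral_of_nonneg_ae
    (Filter.Eventually.of_forall fun G => det_re_pow_inv_nonneg hc L G)
    (by fun_prop : Measurable _).aestronglyMeasurable, ENNReal.ofReal_toReal]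
  exact ne_top_of_le_ne_top ENNReal.one_ne_top (lintegral_det_le_one hc L)

/-- Transposing keeps the Gaussian law. Sylvester's identity then leaves the determinant of the
transpose of a Hermitian matrix, which equals the original one. -/
theorem detMoment_comm (t m L : ℕ) {c : ℝ} :
    detMoment t m L c = detMoment m t L c := by
  rw [detMoment, detMoment]
  have hmp := measurePreserving_gaussianMatrix_swap (ι := Fin m) (κ := Fin t) 1
  rw [← hmp.map_eq, integral_map hmp.measurable.aemeasurable
    (by fun_prop : Measurable _).aestronglyMeasurable]
  refine integral_congr_ae (Filter.Eventually.of_forall fun G => ?_)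
  simp only
  congr 2
  have h : Matrix.of (fun (j : Fin t) (i : Fin m) => G i j) = (Matrix.of G)ᵀ := rfl
  rw [h, det_one_add_smul_mul_comm, ← Complex.conj_re, ← Complex.star_def,
    ← Matrix.det_conjTranspose]
  congr 1
  rw [← Matrix.det_transpose]
  congr 1
  simp only [Matrix.conjTranspose_add, Matrix.conjTranspose_one, Matrix.conjTranspose_smul,
    Matrix.conjTranspose_mul, Matrix.conjTranspose_conjTranspose, star_trivial,
    Matrix.transpose_add, Matrix.transpose_one, Matrix.transpose_smul, Matrix.transpose_mul,
    Matrix.transpose_transpose]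
  rfl

end DetMoment

/-! ### Hua's matrix integral and ratios of gamma functions -/

section HuaIntegral

variable {ι : Type*} [Fintype ι] [DecidableEq ι]

theorem lintegral_rpow_mul_exp_neg_mul_Ioi {a r : ℝ} (ha : 0 < a) (hr : 0 < r) :
    ∫⁻ s in Set.Ioi 0, ENNReal.ofReal (s ^ (a - 1) * Real.exp (-(r * s)))
      = ENNReal.ofReal ((1 / r) ^ a * Real.Gamma a) := by
  have h := Real.integral_rpow_mul_exp_neg_mul_Ioi ha hr
  rw [← h, ofReal_integral_eq_lintegral_ofReal]
  · refine Integrable.of_integral_ne_zero ?_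
    rw [h]
    have := Real.Gamma_pos_of_pos ha
    positivity
  · refine (ae_restrict_iff' measurableSet_Ioi).2 (Filter.Eventually.of_forall fun s hs => ?_)
    have : (0 : ℝ) < s := hs
    simp only [Pi.zero_apply]
    positivity

/-- `(1 + c hᴴ Q h)^{-m}` integrated over `h`. -/
theorem lintegral_one_add_quadForm_pow_inv {Q : Matrix ι ι ℂ} (hQ : Q.PosDef) {c : ℝ} (hc : 0 < c)
    {m : ℕ} (hm : Fintype.card ι < m) :
    ∫⁻ h : ι → ℂ, ENNReal.ofReal (((1 + c * (star h ⬝ᵥ (Q *ᵥ h)).re) ^ m)⁻¹)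
      = ENNReal.ofReal ((Real.pi / c) ^ Fintype.card ι / Q.det.re
        * (Real.Gamma ((m : ℝ) - Fintype.card ι) / Real.Gamma m)) := by
  set t := Fintype.card ι
  have hm0 : 0 < (m : ℝ) := by exact_mod_cast (Nat.zero_le _).trans_lt hm
  have hmt : 0 < (m : ℝ) - t := by
    rw [sub_pos]
    exact_mod_cast hm
  have hΓ := Real.Gamma_pos_of_pos hm0
  have hq : ∀ h : ι → ℂ, 0 ≤ (star h ⬝ᵥ (Q *ᵥ h)).re := fun h =>
    hQ.posSemidef.re_dotProduct_nonneg h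
  have hdet := det_re_pos_of_posDef hQ
  have hmeas : Measurable fun h : ι → ℂ => (star h ⬝ᵥ (Q *ᵥ h)).re := by
    unfold dotProduct Matrix.mulVec
    fun_prop
  -- The negative power is written as a Gamma integral over `s`, so that after exchanging integrals
  -- the variable `h` occurs only in a Gaussian.
  have h1 : ∀ h : ι → ℂ, ENNReal.ofReal (((1 + c * (star h ⬝ᵥ (Q *ᵥ h)).re) ^ m)⁻¹)
      = ENNReal.ofReal ((Real.Gamma m)⁻¹) * ∫⁻ s in Set.Ioi 0, ENNReal.ofReal
        (s ^ ((m : ℝ) - 1) * Real.exp (-((1 + c * (star h ⬝ᵥ (Q *ᵥ h)).re) * s))) := by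
    intro h
    have := hq h
    rw [lintegral_rpow_mul_exp_neg_mul_Ioi hm0 (by positivity), ← ENNReal.ofReal_mul (by positivity),
      Real.rpow_natCast]
    congr 1
    rw [one_div, inv_pow]
    field_simp
  simp_rw [h1]
  have hjoint : Measurable fun p : (ι → ℂ) × ℝ => ENNReal.ofReal (p.2 ^ ((m : ℝ) - 1) *
      Real.exp (-((1 + c * (star p.1 ⬝ᵥ (Q *ᵥ p.1)).re) * p.2))) := by
    have : Measurable fun p : (ι → ℂ) × ℝ => (star p.1 ⬝ᵥ (Q *ᵥ p.1)).re :=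
      hmeas.comp measurable_fst
    fun_prop
  rw [lintegral_const_mul _ hjoint.lintegral_prod_right',
    lintegral_lintegral_swap hjoint.aemeasurable]
  -- The Gaussian integral for the matrix `s c Q` costs `s ^ (-t)`, which turns `Γ(m)` into `Γ(m -
  -- t)`; convergence at `0` is where `t < m` enters.
  have h2 : ∀ s ∈ Set.Ioi (0 : ℝ), ∫⁻ h : ι → ℂ, ENNReal.ofReal
        (s ^ ((m : ℝ) - 1) * Real.exp (-((1 + c * (star h ⬝ᵥ (Q *ᵥ h)).re) * s)))
      = ENNReal.ofReal ((Real.pi / c) ^ t / Q.det.re)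
        * ENNReal.ofReal (s ^ (((m : ℝ) - t) - 1) * Real.exp (-(1 * s))) := by
    intro s hs
    have hs0 : (0 : ℝ) < s := hs
    have hsc : 0 < s * c := by positivity
    have hP : ((s * c) • Q).PosDef := hQ.smul hsc
    have hG := lintegral_exp_neg_quadForm hP
    have hdet' : ((s * c) • Q).det.re = (s * c) ^ t * Q.det.re := by
      rw [Matrix.det_smul_of_tower, Complex.smul_re, smul_eq_mul]
    have h3 : ∀ h : ι → ℂ, ENNReal.ofReal
        (s ^ ((m : ℝ) - 1) * Real.exp (-((1 + c * (star h ⬝ᵥ (Q *ᵥ h)).re) * s)))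
        = ENNReal.ofReal (s ^ ((m : ℝ) - 1) * Real.exp (-s))
          * ENNReal.ofReal (Real.exp (-(star h ⬝ᵥ (((s * c) • Q) *ᵥ h)).re)) := by
      intro h
      rw [← ENNReal.ofReal_mul (by positivity), mul_assoc, ← Real.exp_add, Matrix.smul_mulVec,
        dotProduct_smul, Complex.smul_re, smul_eq_mul]
      congr 3
      ring
    simp_rw [h3]
    rw [lintegral_const_mul _ (by unfold dotProduct Matrix.mulVec; fun_prop), hG, hdet',
      ← ENNReal.ofReal_mul (by positivity), ← ENNReal.ofReal_mul (by positivity)]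
    congr 1
    rw [show ((m : ℝ) - t) - 1 = ((m : ℝ) - 1) - t by ring, Real.rpow_sub hs0 _ (t : ℝ),
      Real.rpow_natCast, one_mul, div_pow, mul_pow]
    field_simp
    rfl
  rw [setLIntegral_congr_fun measurableSet_Ioi h2, lintegral_const_mul _ (by fun_prop),
    lintegral_rpow_mul_exp_neg_mul_Ioi hmt one_pos, ← ENNReal.ofReal_mul (by positivity),
    ← ENNReal.ofReal_mul (by positivity)]
  congr 1
  simp
  ring

/-- The rank-one determinant formula: it isolates the dependence on one column so that this column
can be integrated out alone. -/
theorem det_add_smul_vecMulVec {C : Matrix ι ι ℂ} (hC : C.PosDef) (c : ℝ) (h : ι → ℂ) :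
    (C + c • Matrix.vecMulVec h (star h)).det.re
      = C.det.re * (1 + c * (star h ⬝ᵥ (C⁻¹ *ᵥ h)).re) := by
  have hu : IsUnit C.det := hC.isUnit.map Matrix.detMonoidHom
  have h1 : c • Matrix.vecMulVec h (star h)
      = Matrix.replicateCol Unit (c • h) * Matrix.replicateRow Unit (star h) := by
    rw [← Matrix.vecMulVec_eq Unit, Matrix.smul_vecMulVec]
  rw [h1, Matrix.det_add_replicateCol_mul_replicateRow hu, Matrix.det_unique (n := Unit)]
  have h2 : ((1 : Matrix Unit Unit ℂ) + Matrix.replicateRow Unit (star h) * C⁻¹ * Matrix.replicateCol Unit (c • h))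
      default default = 1 + (c : ℂ) * (star h ⬝ᵥ (C⁻¹ *ᵥ h)) := by
    rw [Matrix.add_apply, Matrix.one_apply_eq, Matrix.mul_assoc, ← Matrix.replicateCol_mulVec,
      Matrix.mulVec_smul, Matrix.mul_apply]
    simp only [Matrix.replicateRow_apply, Matrix.replicateCol_apply, dotProduct, Finset.mul_sum]
    congr 1
    refine Finset.sum_congr rfl fun i _ => ?_
    simp
    ring
  rw [h2, det_eq_re_of_posDef hC]
  simp

omit [DecidableEq ι] in
theorem posDef_add_smul_sum_vecMulVec {C : Matrix ι ι ℂ} (hC : C.PosDef) {c : ℝ} (hc : 0 ≤ c)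
    {L : ℕ} (H : Fin L → ι → ℂ) :
    (C + c • ∑ l, Matrix.vecMulVec (H l) (star (H l))).PosDef :=
  hC.add_posSemidef ((Matrix.posSemidef_sum _ fun _ _ =>
    Matrix.posSemidef_vecMulVec_self_star _).smul hc)

theorem measurable_det_add_smul_sum_vecMulVec (C : Matrix ι ι ℂ) (c : ℝ) (L : ℕ) :
    Measurable fun H : Fin L → ι → ℂ =>
      (C + c • ∑ l, Matrix.vecMulVec (H l) (star (H l))).det.re := by
  refine Continuous.measurable ?_
  refine Complex.continuous_re.comp (Continuous.matrix_det ?_)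
  refine continuous_const.add (Continuous.const_smul ?_ c)
  refine continuous_finsetSum _ fun l _ => ?_
  exact (continuous_apply l).matrix_vecMulVec (continuous_apply l).star

/-- Hua's integral of `det (C + c H Hᴴ)^{-m}` over all `H`, by integrating out the columns. -/
theorem lintegral_det_add_pow_inv {c : ℝ} (hc : 0 < c) (L : ℕ) {m : ℕ}
    (hm : Fintype.card ι + L ≤ m) {C : Matrix ι ι ℂ} (hC : C.PosDef) :
    ∫⁻ H : Fin L → ι → ℂ, ENNReal.ofReal
        (((C + c • ∑ l, Matrix.vecMulVec (H l) (star (H l))).det.re ^ m)⁻¹)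
      = ENNReal.ofReal ((C.det.re ^ (m - L))⁻¹ * ∏ j ∈ Finset.range L,
        ((Real.pi / c) ^ Fintype.card ι
          * (Real.Gamma ((m : ℝ) - j - Fintype.card ι) / Real.Gamma ((m : ℝ) - j)))) := by
  set t := Fintype.card ι
  induction L generalizing m with
  | zero =>
    simp [volume_pi]
  | succ L ih =>
    -- Each integrated column lowers the exponent by one, so the induction hypothesis is used at the
    -- predecessor of the exponent.
    obtain ⟨m, rfl⟩ : ∃ k, m = k + 1 := ⟨m - 1, by omega⟩
    have hm' : t + L ≤ m := by omega
    have hmt : t < m + 1 := by omega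
    rw [volume_pi, ← ((measurePreserving_piFinSuccAbove
      (fun _ : Fin (L + 1) => (volume : Measure (ι → ℂ))) 0).symm).lintegral_comp_emb
      (MeasurableEquiv.measurableEmbedding _)]
    have hf : ∀ a : (ι → ℂ) × (Fin L → ι → ℂ),
        C + c • ∑ l, Matrix.vecMulVec ((MeasurableEquiv.piFinSuccAbove (fun _ => ι → ℂ) 0).symm a l)
          (star ((MeasurableEquiv.piFinSuccAbove (fun _ => ι → ℂ) 0).symm a l))
        = (C + c • ∑ l, Matrix.vecMulVec (a.2 l) (star (a.2 l)))
          + c • Matrix.vecMulVec a.1 (star a.1) := by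
      intro a
      rw [Fin.sum_univ_succ]
      simp [MeasurableEquiv.piFinSuccAbove, smul_add]
      abel
    simp_rw [hf, det_add_smul_vecMulVec (posDef_add_smul_sum_vecMulVec hC hc.le _)]
    rw [lintegral_prod_symm' _ (by
      simp_rw [← det_add_smul_vecMulVec (posDef_add_smul_sum_vecMulVec hC hc.le _), ← hf]
      have h0 := (measurable_det_add_smul_sum_vecMulVec C c (L + 1)).comp
        (MeasurableEquiv.piFinSuccAbove (fun _ : Fin (L + 1) => ι → ℂ) 0).symm.measurable
      exact ENNReal.measurable_ofReal.comp (h0.pow_const _).inv)]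
    -- With `D` the matrix of the remaining columns, the integrand carries `det D ^ (-(m + 1))`, and
    -- integrating over `h` returns one factor `det D` because the form is that of `D⁻¹`.
    have hin : ∀ H : Fin L → ι → ℂ, ∫⁻ h : ι → ℂ, ENNReal.ofReal
        ((((C + c • ∑ l, Matrix.vecMulVec (H l) (star (H l))).det.re
          * (1 + c * (star h ⬝ᵥ
            ((C + c • ∑ l, Matrix.vecMulVec (H l) (star (H l)))⁻¹ *ᵥ h)).re)) ^ (m + 1))⁻¹)
        = ENNReal.ofReal ((Real.pi / c) ^ t
          * (Real.Gamma (((m + 1 : ℕ) : ℝ) - t) / Real.Gamma ((m + 1 : ℕ) : ℝ)))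
        * ENNReal.ofReal (((C + c • ∑ l, Matrix.vecMulVec (H l) (star (H l))).det.re ^ m)⁻¹) := by
      intro H
      have hD := posDef_add_smul_sum_vecMulVec hC hc.le H
      set D := C + c • ∑ l, Matrix.vecMulVec (H l) (star (H l))
      have hd := det_re_pos_of_posDef hD
      have hdi : D⁻¹.det.re = (D.det.re)⁻¹ := by
        rw [Matrix.det_nonsing_inv, Ring.inverse_eq_inv', det_eq_re_of_posDef hD,
          ← Complex.ofReal_inv, Complex.ofReal_re, Complex.ofReal_re]
      have hmeas : Measurable fun h : ι → ℂ => (star h ⬝ᵥ (D⁻¹ *ᵥ h)).re := by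
        unfold dotProduct Matrix.mulVec
        fun_prop
      simp_rw [mul_pow, mul_inv]
      simp_rw [fun h : ι → ℂ => ENNReal.ofReal_mul (p := (D.det.re ^ (m + 1))⁻¹)
        (q := ((1 + c * (star h ⬝ᵥ (D⁻¹ *ᵥ h)).re) ^ (m + 1))⁻¹) (by positivity)]
      rw [lintegral_const_mul _ (by fun_prop),
        lintegral_one_add_quadForm_pow_inv hD.inv hc hmt, hdi,
        ← ENNReal.ofReal_mul (by positivity), ← ENNReal.ofReal_mul' (by positivity)]
      congr 1
      rw [pow_succ]
      field_simp
      rfl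
    simp_rw [hin]
    have hmL : Measurable fun H : Fin L → ι → ℂ => ENNReal.ofReal
        (((C + c • ∑ l, Matrix.vecMulVec (H l) (star (H l))).det.re ^ m)⁻¹) :=
      ((measurable_det_add_smul_sum_vecMulVec C c L).pow_const m).inv.ennreal_ofReal
    rw [lintegral_const_mul _ hmL]
    have hG : 0 ≤ Real.Gamma (((m + 1 : ℕ) : ℝ) - t) :=
      (Real.Gamma_pos_of_pos (by rw [sub_pos]; exact_mod_cast hmt)).le
    have hG' : 0 ≤ Real.Gamma ((m + 1 : ℕ) : ℝ) := (Real.Gamma_pos_of_pos (by positivity)).le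
    have := ih hm'
    rw [volume_pi] at this
    rw [this, ← ENNReal.ofReal_mul (by positivity), Finset.prod_range_succ']
    congr 1
    have : ∀ j : ℕ, ((m + 1 : ℕ) : ℝ) - ((j + 1 : ℕ) : ℝ) = (m : ℝ) - j := by
      intro j
      push_cast
      ring
    simp_rw [this]
    rw [Nat.add_sub_add_right]
    simp only [Nat.cast_zero, sub_zero]
    ring

/-- The two ways of writing a ratio of multivariate gamma functions. -/
theorem prod_Gamma_ratio (t L m : ℕ) (h : t + L ≤ m) :
    ∏ j ∈ Finset.range L, Real.Gamma ((m : ℝ) - j - t) / Real.Gamma ((m : ℝ) - j)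
      = ∏ i ∈ Finset.Icc (m - t + 1) m, Real.Gamma ((i : ℝ) - L) / Real.Gamma i := by
  induction L with
  | zero =>
    simp only [Finset.range_zero, Finset.prod_empty, Nat.cast_zero, sub_zero]
    refine (Finset.prod_eq_one fun i hi => div_self ?_).symm
    have : 0 < (i : ℝ) := by
      have := (Finset.mem_Icc.1 hi).1
      exact_mod_cast (by omega : 0 < i)
    exact (Real.Gamma_pos_of_pos this).ne'
  | succ L ih =>
    rw [Finset.prod_range_succ, ih (by omega)]
    -- The new factor is a telescoping product. Its length is freed from `t` to a variable `k`, with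
    -- `m` and `L` fixed, so that it can be proved by induction.
    have htel : ∀ k : ℕ, k + (L + 1) ≤ m →
        ∏ i ∈ Finset.Icc (m - k + 1) m, Real.Gamma ((i : ℝ) - (L + 1 : ℕ)) / Real.Gamma ((i : ℝ) - L)
          = Real.Gamma ((m : ℝ) - L - k) / Real.Gamma ((m : ℝ) - L) := by
      intro k hk
      induction k with
      | zero =>
        have : 0 < (m : ℝ) - L := by
          rw [sub_pos]
          exact_mod_cast (by omega : L < m)
        simp [div_self (Real.Gamma_pos_of_pos this).ne']
      | succ k ihk =>
        have h1 : m - (k + 1) + 1 = m - k := by omega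
        rw [h1, ← Finset.insert_Icc_succ_left_eq_Icc (by omega : m - k ≤ m),
          Finset.prod_insert (by simp), Order.succ_eq_add_one, ihk (by omega)]
        rw [Nat.cast_sub (by omega : k ≤ m)]
        have : 0 < (m : ℝ) - L - k := by
          rw [sub_sub, sub_pos]
          exact_mod_cast (by omega : L + k < m)
        have h2 := (Real.Gamma_pos_of_pos this).ne'
        push_cast
        rw [show (m : ℝ) - k - (L + 1) = (m : ℝ) - L - (k + 1) by ring,
          show (m : ℝ) - k - L = (m : ℝ) - L - k by ring]
        field_simp
    rw [← htel t h, ← Finset.prod_mul_distrib]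
    refine Finset.prod_congr rfl fun i hi => ?_
    have : 0 < (i : ℝ) - L := by
      have := (Finset.mem_Icc.1 hi).1
      rw [sub_pos]
      exact_mod_cast (by omega : L < i)
    have h2 := (Real.Gamma_pos_of_pos this).ne'
    field_simp

end HuaIntegral

/-! ## The closed form of the Gallager-type bound -/

section ClosedForm

theorem of_swap_mul_conjTranspose {ι : Type*} {L : ℕ} (H : Fin L → ι → ℂ) :
    Matrix.of (fun i l => H l i) * (Matrix.of fun i l => H l i)ᴴ
      = ∑ l, Matrix.vecMulVec (H l) (star (H l)) := by
  ext i j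
  simp [Matrix.mul_apply, Matrix.sum_apply, Matrix.vecMulVec_apply]

/-- Duality replaces `t × m` matrices and exponent `L` by `t × L` matrices and exponent `m`. The
only loss is bounding `exp (-‖H‖²)` by one; the rest is Hua's integral, which converges because `t +
L ≤ m`. -/
theorem detMoment_le_of_add_le {t m L : ℕ} (h : t + L ≤ m) {c : ℝ} (hc : 0 < c) :
    detMoment t m L c ≤ (c ^ (L * t))⁻¹ *
      ∏ i ∈ Finset.Icc (m - t + 1) m, Real.Gamma ((i : ℝ) - L) / Real.Gamma i := by
  have hpos : 0 ≤ ∏ i ∈ Finset.Icc (m - t + 1) m, Real.Gamma ((i : ℝ) - L) / Real.Gamma i := by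
    refine Finset.prod_nonneg fun i hi => ?_
    have := (Finset.mem_Icc.1 hi).1
    have h1 : 0 < (i : ℝ) - L := by
      rw [sub_pos]
      exact_mod_cast (by omega : L < i)
    have h2 : 0 < (i : ℝ) := by exact_mod_cast (by omega : 0 < i)
    exact div_nonneg (Real.Gamma_pos_of_pos h1).le (Real.Gamma_pos_of_pos h2).le
  refine (ENNReal.ofReal_le_ofReal_iff (by positivity)).1 ?_
  rw [ofReal_detMoment t m L hc.le]
  have hs := lintegral_det_swap (ι := Fin t) (κ := Fin m) (κ' := Fin L) hc.le
  simp only [Fintype.card_fin] at hs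
  rw [hs, ← (measurePreserving_gaussianMatrix_swap (ι := Fin L) (κ := Fin t) 1).lintegral_comp
    (by fun_prop)]
  simp_rw [of_swap_mul_conjTranspose]
  have hm : Measurable fun H : Fin L → Fin t → ℂ => ENNReal.ofReal
      (((1 + c • ∑ l, Matrix.vecMulVec (H l) (star (H l))).det.re ^ m)⁻¹) :=
    ((measurable_det_add_smul_sum_vecMulVec 1 c L).pow_const m).inv.ennreal_ofReal
  rw [gaussianMatrix_one, lintegral_withDensity_eq_lintegral_mul _ (by fun_prop) hm]
  have hH := lintegral_det_add_pow_inv (ι := Fin t) hc L (by simpa using h) Matrix.PosDef.one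
  calc _ ≤ ∫⁻ H : Fin L → Fin t → ℂ, ENNReal.ofReal ((Real.pi ^ (L * t))⁻¹) * ENNReal.ofReal
        (((1 + c • ∑ l, Matrix.vecMulVec (H l) (star (H l))).det.re ^ m)⁻¹) := by
        refine lintegral_mono fun H => ?_
        rw [Pi.mul_apply]
        gcongr
        simp only [Fintype.card_fin]
        refine mul_le_of_le_one_right (by positivity) ?_
        rw [Real.exp_le_one_iff, neg_nonpos]
        exact frob_nonneg _
    _ = ENNReal.ofReal ((c ^ (L * t))⁻¹ *
      ∏ i ∈ Finset.Icc (m - t + 1) m, Real.Gamma ((i : ℝ) - L) / Real.Gamma i) := by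
        rw [lintegral_const_mul _ hm, hH, ← ENNReal.ofReal_mul (by positivity)]
        congr 1
        rw [Finset.prod_mul_distrib, Fintype.card_fin, prod_Gamma_ratio t L m h]
        simp only [Finset.prod_const, Finset.card_range, Matrix.det_one, Complex.one_re, one_pow,
          inv_one, one_mul, ← pow_mul]
        rw [div_pow, mul_comm t L]
        have := Real.pi_pos
        field_simp
    _ ≤ _ := le_rfl

theorem p2_mem_le {n M K L t : ℕ} {P' : ℝ} (hP' : 0 < P') {ρ : ℝ} {m : ℕ} (h0 : 0 ≤ ρ) (h1 : ρ ≤ 1)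
    (hm : ρ * n = m) : p2 n M K L t P' ≤
      K.choose t * (M : ℝ) ^ (ρ * t) * detMoment t m L (P' / (1 + ρ)) := by
  refine csInf_le ⟨0, ?_⟩ ⟨ρ, m, h0, h1, hm, rfl⟩
  rintro x ⟨ρ, m, h0, -, -, rfl⟩
  have := detMoment_nonneg t m L (c := P' / (1 + ρ)) (by positivity)
  positivity

/-- The regime `m + L ≤ t` is the other one with the roles of `t` and `m` exchanged by
transposition. -/
theorem p2_le_qClosed {n M K L t : ℕ} {P' : ℝ} (hP' : 0 < P') {ρ : ℝ} {m : ℕ} (h0 : 0 ≤ ρ)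
    (h1 : ρ ≤ 1) (hm : ρ * n = m) (h : t + L ≤ m ∨ m + L ≤ t) :
    p2 n M K L t P' ≤ qClosed M K L t P' ρ m := by
  refine (p2_mem_le hP' h0 h1 hm).trans ?_
  have hc : 0 < P' / (1 + ρ) := by positivity
  have hcm : 0 ≤ (K.choose t : ℝ) * (M : ℝ) ^ (ρ * t) := by positivity
  unfold qClosed
  split_ifs with h2 h3
  · rw [mul_assoc (_ * _)]
    exact mul_le_mul_of_nonneg_left (detMoment_le_of_add_le h2 hc) hcm
  · rw [mul_assoc (_ * _), detMoment_comm]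
    exact mul_le_mul_of_nonneg_left (detMoment_le_of_add_le h3 hc) hcm
  · omega

/-- The cap at one is what covers the middle range of `ρ n`, where the closed form is set to `1`. -/
theorem min_one_p2_le_p2u {n M K L t : ℕ} {P' : ℝ} (hP' : 0 < P') :
    min 1 (p2 n M K L t P') ≤ p2u n M K L t P' := by
  refine le_csInf ⟨_, 0, 0, le_rfl, zero_le_one, by simp, rfl⟩ ?_
  rintro x ⟨ρ, m, h0, h1, hm, rfl⟩
  by_cases h : t + L ≤ m ∨ m + L ≤ t
  · exact (min_le_right _ _).trans (p2_le_qClosed hP' h0 h1 hm h)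
  · have h2 : ¬ t + L ≤ m := fun h' => h (Or.inl h')
    have h3 : ¬ m + L ≤ t := fun h' => h (Or.inr h')
    rw [qClosed, if_neg h2, if_neg h3]
    exact min_le_left _ _

end ClosedForm

/-! ## The Chernoff bound inside the good region -/

section Chernoff

/-- The product `A H`, as an array. -/
def mulCols {ι κ μ : Type*} [Fintype κ] (A : Matrix ι κ ℂ) (H : κ → μ → ℂ) : ι → μ → ℂ :=
  fun i l => (A *ᵥ fun k => H k l) i

variable {ι κ : Type} [Fintype ι] [Fintype κ]

@[fun_prop]
theorem measurable_mulCols {ι κ μ : Type*} [Fintype κ] (A : Matrix ι κ ℂ) :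
    Measurable fun H : κ → μ → ℂ => mulCols A H := by
  unfold mulCols Matrix.mulVec dotProduct
  fun_prop

theorem frob_eq_sum_columns {ι κ : Type*} [Fintype ι] [Fintype κ] (Z : ι → κ → ℂ) :
    frob Z = ∑ l, sqn fun i => Z i l := (frob_swap Z).symm

theorem frob_add_mulCols {ι κ μ : Type*} [Fintype ι] [Fintype κ] [Fintype μ] (A : Matrix ι κ ℂ)
    (H : κ → μ → ℂ) (Z : ι → μ → ℂ) :
    frob (Z + mulCols A H) = ∑ l, sqn ((fun i => Z i l) + A *ᵥ fun k => H k l) :=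
  frob_eq_sum_columns _

/-- The form `B̃` in terms of vectors, with general index types. -/
theorem sqn_linear_combination {ι : Type*} [Fintype ι] (x y w : ℝ) (z a b : ι → ℂ) :
    sqn (x • z + y • a + w • b) = x ^ 2 * sqn z + y ^ 2 * sqn a + w ^ 2 * sqn b
      + 2 * (x * y) * (star z ⬝ᵥ a).re + 2 * (x * w) * (star z ⬝ᵥ b).re
      + 2 * (y * w) * (star a ⬝ᵥ b).re := by
  rw [sqn_add, sqn_add, sqn_smul, sqn_smul, sqn_smul]
  simp only [star_add, star_smul, star_trivial, add_dotProduct, smul_dotProduct, dotProduct_smul,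
    Complex.add_re, Complex.smul_re, smul_eq_mul]
  ring

/-- Completing the square in the exponent of the Chernoff bound. -/
theorem chernoff_exponent {n K : ℕ} (A₁ A₂ : Matrix (Fin n) (Fin K) ℂ) {ω u r : ℝ}
    (hα : 1 + r * (1 - ω) ≠ 0) (hu : u - r * ω ≠ 0) (z : Fin n → ℂ) (h : Fin K → ℂ) :
    u * sqn (z + (A₁ - A₂) *ᵥ h) + (r - u) * sqn z - r * ω * sqn (z + A₁ *ᵥ h) + sqn z + sqn h
      = (1 + r * (1 - ω)) * sqn (z + (((u - r * ω) / (1 + r * (1 - ω))) • (A₁ *ᵥ h)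
          + (-u / (1 + r * (1 - ω))) • (A₂ *ᵥ h)))
        + (star h ⬝ᵥ ((1 + Btilde A₁ A₂ ω u r) *ᵥ h)).re := by
  have hB : (star h ⬝ᵥ ((1 + Btilde A₁ A₂ ω u r) *ᵥ h)).re
      = sqn h + (1 + r - u) * (u - r * ω) / (1 + r * (1 - ω))
          * sqn ((A₁ - (u / (u - r * ω)) • A₂) *ᵥ h)
        - r * ω * u / (u - r * ω) * sqn (A₂ *ᵥ h) := by
    rw [Btilde, Matrix.add_mulVec, Matrix.sub_mulVec, Matrix.smul_mulVec, Matrix.smul_mulVec,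
      Matrix.one_mulVec, dotProduct_add, dotProduct_sub, dotProduct_smul, dotProduct_smul,
      Complex.add_re, Complex.sub_re, Complex.smul_re, Complex.smul_re, re_star_dotProduct_self,
      ← sqn_mulVec, ← sqn_mulVec]
    simp only [smul_eq_mul]
    ring
  rw [hB]
  -- All vectors are written in the common family `z, A₁ h, A₂ h`, so that the claim becomes a
  -- polynomial identity in six inner products.
  have e1 : z + (A₁ - A₂) *ᵥ h = (1 : ℝ) • z + (1 : ℝ) • (A₁ *ᵥ h) + (-1 : ℝ) • (A₂ *ᵥ h) := by
    rw [Matrix.sub_mulVec]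
    module
  have e2 : z + A₁ *ᵥ h = (1 : ℝ) • z + (1 : ℝ) • (A₁ *ᵥ h) + (0 : ℝ) • (A₂ *ᵥ h) := by
    module
  have e3 : z + (((u - r * ω) / (1 + r * (1 - ω))) • (A₁ *ᵥ h)
      + (-u / (1 + r * (1 - ω))) • (A₂ *ᵥ h))
      = (1 : ℝ) • z + ((u - r * ω) / (1 + r * (1 - ω))) • (A₁ *ᵥ h)
      + (-u / (1 + r * (1 - ω))) • (A₂ *ᵥ h) := by
    module
  have e4 : (A₁ - (u / (u - r * ω)) • A₂) *ᵥ h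
      = (0 : ℝ) • z + (1 : ℝ) • (A₁ *ᵥ h) + (-(u / (u - r * ω))) • (A₂ *ᵥ h) := by
    rw [Matrix.sub_mulVec, Matrix.smul_mulVec]
    module
  rw [e1, e2, e3, e4]
  simp only [sqn_linear_combination]
  field_simp
  ring

theorem isHermitian_Btilde {n K : ℕ} (A₁ A₂ : Matrix (Fin n) (Fin K) ℂ) (ω u r : ℝ) :
    (Btilde A₁ A₂ ω u r).IsHermitian := by
  unfold Btilde
  refine Matrix.IsHermitian.sub ?_ ?_
  · exact (Matrix.isHermitian_conjTranspose_mul_self _).smul (IsSelfAdjoint.all _)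
  · exact (Matrix.isHermitian_conjTranspose_mul_self _).smul (IsSelfAdjoint.all _)

/-- Adding the identity shifts the spectrum by one; this converts the eigenvalue constraint on `B̃`
into the condition needed for the Gaussian integral to converge. -/
theorem posDef_one_add_iff_spectrum {ι : Type*} [Fintype ι] [DecidableEq ι] {B : Matrix ι ι ℂ}
    (hB : B.IsHermitian) : (1 + B).PosDef ↔ ∀ μ ∈ spectrum ℝ B, -1 < μ := by
  have hB1 : (1 + B).IsHermitian := Matrix.isHermitian_one.add hB
  rw [hB1.posDef_iff_eigenvalues_pos]
  have hs : ∀ μ : ℝ, μ ∈ spectrum ℝ B ↔ 1 + μ ∈ spectrum ℝ (1 + B) := by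
    intro μ
    have := spectrum.add_mem_add_iff (R := ℝ) (a := B) (r := μ) (s := 1)
    rw [map_one, add_comm μ 1] at this
    exact this.symm
  constructor
  · intro h μ hμ
    rw [hs, hB1.spectrum_real_eq_range_eigenvalues] at hμ
    obtain ⟨i, hi⟩ := hμ
    linarith [h i]
  · intro h i
    have : hB1.eigenvalues i ∈ spectrum ℝ (1 + B) := by
      rw [hB1.spectrum_real_eq_range_eigenvalues]
      exact ⟨i, rfl⟩
    have h2 := h (hB1.eigenvalues i - 1) (by rw [hs]; convert this using 1; ring)
    linarith

/-- The joint Gaussian integral in the Chernoff bound, for a single antenna. -/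
theorem lintegral_chernoff {n K : ℕ} (A₁ A₂ : Matrix (Fin n) (Fin K) ℂ) {ω u r : ℝ}
    (hα : 0 < 1 + r * (1 - ω)) (hu : u - r * ω ≠ 0) (hB : (1 + Btilde A₁ A₂ ω u r).PosDef) :
    ∫⁻ h, ∫⁻ z, ENNReal.ofReal (Real.exp (-(u * sqn (z + (A₁ - A₂) *ᵥ h) + (r - u) * sqn z
        - r * ω * sqn (z + A₁ *ᵥ h)))) ∂(gaussianVec (Fin n) 1) ∂(gaussianVec (Fin K) 1)
      = ENNReal.ofReal (((1 + r * (1 - ω)) ^ n * (1 + Btilde A₁ A₂ ω u r).det.re)⁻¹) := by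
  have hpi := Real.pi_pos
  have hd := det_re_pos_of_posDef hB
  -- For fixed `h` the exponent, density included, is a square in `z` with coefficient `1 + r (1 -
  -- ω)` centred at `-a`. The leftover `exp (sqn h)` later cancels the density of `h`.
  have hin : ∀ h : Fin K → ℂ, ∫⁻ z, ENNReal.ofReal (Real.exp (-(u * sqn (z + (A₁ - A₂) *ᵥ h)
        + (r - u) * sqn z - r * ω * sqn (z + A₁ *ᵥ h)))) ∂(gaussianVec (Fin n) 1)
      = ENNReal.ofReal (((1 + r * (1 - ω)) ^ n)⁻¹ * Real.exp (sqn h)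
        * Real.exp (-(star h ⬝ᵥ ((1 + Btilde A₁ A₂ ω u r) *ᵥ h)).re)) := by
    intro h
    rw [lintegral_gaussianVec_one (by fun_prop)]
    set a := ((u - r * ω) / (1 + r * (1 - ω))) • (A₁ *ᵥ h)
      + (-u / (1 + r * (1 - ω))) • (A₂ *ᵥ h) with ha
    have : ∀ z : Fin n → ℂ, ENNReal.ofReal (Real.exp (-sqn z)) *
        ENNReal.ofReal (Real.exp (-(u * sqn (z + (A₁ - A₂) *ᵥ h)
        + (r - u) * sqn z - r * ω * sqn (z + A₁ *ᵥ h))))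
        = ENNReal.ofReal (Real.exp (sqn h)
        * Real.exp (-(star h ⬝ᵥ ((1 + Btilde A₁ A₂ ω u r) *ᵥ h)).re))
          * ENNReal.ofReal (Real.exp (-((1 + r * (1 - ω)) * sqn (z + a)))) := by
      intro z
      rw [← ENNReal.ofReal_mul (by positivity), ← ENNReal.ofReal_mul (by positivity),
        ← Real.exp_add, ← Real.exp_add, ← Real.exp_add]
      congr 2
      have := chernoff_exponent A₁ A₂ hα.ne' hu z h
      rw [← ha] at this
      linarith
    simp_rw [this]
    rw [lintegral_const_mul _ (by fun_prop), lintegral_add_right_eq_self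
      (fun z : Fin n → ℂ => ENNReal.ofReal (Real.exp (-((1 + r * (1 - ω)) * sqn z)))) a,
      lintegral_exp_neg_mul_sqn hα, ← ENNReal.ofReal_mul (by positivity),
      ← ENNReal.ofReal_mul (by positivity), Fintype.card_fin, div_pow]
    congr 1
    field_simp
  simp_rw [hin]
  have hmq : Measurable fun h : Fin K → ℂ => (star h ⬝ᵥ ((1 + Btilde A₁ A₂ ω u r) *ᵥ h)).re := by
    unfold dotProduct Matrix.mulVec
    fun_prop
  rw [lintegral_gaussianVec_one (by fun_prop)]
  have : ∀ h : Fin K → ℂ, ENNReal.ofReal (Real.exp (-sqn h)) *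
      ENNReal.ofReal (((1 + r * (1 - ω)) ^ n)⁻¹ * Real.exp (sqn h)
        * Real.exp (-(star h ⬝ᵥ ((1 + Btilde A₁ A₂ ω u r) *ᵥ h)).re))
      = ENNReal.ofReal (((1 + r * (1 - ω)) ^ n)⁻¹) * ENNReal.ofReal
        (Real.exp (-(star h ⬝ᵥ ((1 + Btilde A₁ A₂ ω u r) *ᵥ h)).re)) := by
    intro h
    rw [← ENNReal.ofReal_mul (by positivity), ← ENNReal.ofReal_mul (by positivity)]
    congr 1
    rw [Real.exp_neg (sqn h)]
    field_simp
  simp_rw [this]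
  rw [lintegral_const_mul _ (by fun_prop), lintegral_exp_neg_quadForm hB,
    ← ENNReal.ofReal_mul (by positivity), ← ENNReal.ofReal_mul (by positivity), Fintype.card_fin]
  congr 1
  field_simp

/-- Integrating a product over the antennas. -/
theorem lintegral_lintegral_prod_columns {μ : Type} [Fintype μ] (f : (κ → ℂ) → (ι → ℂ) → ℝ≥0∞)
    (hf : Measurable (Function.uncurry f)) :
    ∫⁻ H, ∫⁻ Z, ∏ l : μ, f (fun k => H k l) (fun i => Z i l) ∂(gaussianMatrix ι μ 1)
        ∂(gaussianMatrix κ μ 1)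
      = (∫⁻ h, ∫⁻ z, f h z ∂(gaussianVec ι 1) ∂(gaussianVec κ 1)) ^ Fintype.card μ := by
  have hin : ∀ H : κ → μ → ℂ,
      ∫⁻ Z, ∏ l : μ, f (fun k => H k l) (fun i => Z i l) ∂(gaussianMatrix ι μ 1)
        = ∏ l : μ, ∫⁻ z, f (fun k => H k l) z ∂(gaussianVec ι 1) := by
    intro H
    have hm : ∀ l, Measurable (f fun k => H k l) := fun l => hf.of_uncurry_left
    rw [(measurePreserving_gaussianMatrix_swap 1).lintegral_comp
      (f := fun Z => ∏ l, f (fun k => H k l) (Z l))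
      (Finset.measurable_prod _ fun l _ => (hm l).comp (measurable_pi_apply l)),
      gaussianMatrix_eq, lintegral_pi_prod _ (fun l => f fun k => H k l) hm]
  simp_rw [hin]
  exact lintegral_gaussianMatrix_columns 1
    (fun h => ∫⁻ z, f h z ∂(gaussianVec ι 1)) hf.lintegral_prod_right'

/-- The event that the decoded messages beat the transmitted ones inside the good region. -/
def goodErrorEvent {n K : ℕ} (L : ℕ) (A₁ A₂ : Matrix (Fin n) (Fin K) ℂ) (ω ν : ℝ) :
    Set ((Fin K → Fin L → ℂ) × (Fin n → Fin L → ℂ)) :=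
  {p | frob (p.2 + mulCols (A₁ - A₂) p.1) ≤ frob p.2 ∧
    frob p.2 ≤ ω * frob (p.2 + mulCols A₁ p.1) + n * L * ν}

theorem measurable_frob_add_mulCols {ι κ μ : Type*} [Fintype ι] [Fintype κ] [Fintype μ]
    (A : Matrix ι κ ℂ) :
    Measurable fun p : (κ → μ → ℂ) × (ι → μ → ℂ) => frob (p.2 + mulCols A p.1) :=
  measurable_frob.comp (measurable_snd.add ((measurable_mulCols A).comp measurable_fst))

theorem measurableSet_goodErrorEvent {n K : ℕ} (L : ℕ) (A₁ A₂ : Matrix (Fin n) (Fin K) ℂ)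
    (ω ν : ℝ) : MeasurableSet (goodErrorEvent L A₁ A₂ ω ν) :=
  (measurableSet_le (measurable_frob_add_mulCols _) (measurable_frob.comp measurable_snd)).inter
    (measurableSet_le (measurable_frob.comp measurable_snd)
      (((measurable_frob_add_mulCols _).const_mul ω).add_const _))

/-- Chernoff's bound with one multiplier per inequality: `u` for the rival beating the truth and `r`
for lying in the good region. On the event both slacks are nonnegative, so the indicator is at most
the exponential of their weighted sum, which then factors over the antennas. -/
theorem measure_goodErrorEvent_le {n K : ℕ} (L : ℕ) (A₁ A₂ : Matrix (Fin n) (Fin K) ℂ) {ω ν u r : ℝ}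
    (hω : ω ≤ 1) (hu0 : 0 ≤ u) (hr0 : 0 ≤ r) (hu : u ≠ r * ω)
    (hB : (1 + Btilde A₁ A₂ ω u r).PosDef) :
    ((gaussianMatrix (Fin K) (Fin L) 1).prod (gaussianMatrix (Fin n) (Fin L) 1))
        (goodErrorEvent L A₁ A₂ ω ν)
      ≤ ENNReal.ofReal (Real.exp (-L * (n * Real.log (1 + r * (1 - ω))
        + Real.log (1 + Btilde A₁ A₂ ω u r).det.re - r * n * ν))) := by
  have hα : 0 < 1 + r * (1 - ω) := by nlinarith
  have hd := det_re_pos_of_posDef hB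
  set g : (Fin K → ℂ) → (Fin n → ℂ) → ℝ := fun h z =>
    u * sqn (z + (A₁ - A₂) *ᵥ h) + (r - u) * sqn z - r * ω * sqn (z + A₁ *ᵥ h) with hg
  have hgm : Measurable (Function.uncurry g) := by
    unfold Function.uncurry
    simp only [hg]
    unfold Matrix.mulVec dotProduct
    fun_prop
  have hfm : Measurable (Function.uncurry fun h z => ENNReal.ofReal (Real.exp (-g h z))) :=
    ENNReal.measurable_ofReal.comp (Real.measurable_exp.comp hgm.neg)
  have hprod : ∀ H : Fin K → Fin L → ℂ, ∀ Z : Fin n → Fin L → ℂ,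
      ∏ l, ENNReal.ofReal (Real.exp (-g (fun k => H k l) fun i => Z i l))
      = ENNReal.ofReal (Real.exp (-(u * frob (Z + mulCols (A₁ - A₂) H) + (r - u) * frob Z
        - r * ω * frob (Z + mulCols A₁ H)))) := by
    intro H Z
    rw [← ENNReal.ofReal_prod_of_nonneg fun _ _ => (Real.exp_pos _).le, ← Real.exp_sum,
      frob_add_mulCols, frob_add_mulCols, frob_eq_sum_columns Z]
    simp only [hg, Finset.sum_neg_distrib, Finset.sum_sub_distrib, Finset.sum_add_distrib,
      Finset.mul_sum]
  have hbound : ((gaussianMatrix (Fin K) (Fin L) 1).prod (gaussianMatrix (Fin n) (Fin L) 1))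
      (goodErrorEvent L A₁ A₂ ω ν) ≤ ∫⁻ p, ENNReal.ofReal (Real.exp (r * (n * L * ν)))
        * ∏ l, ENNReal.ofReal (Real.exp (-g (fun k => p.1 k l) fun i => p.2 i l))
        ∂((gaussianMatrix (Fin K) (Fin L) 1).prod (gaussianMatrix (Fin n) (Fin L) 1)) := by
    rw [← lintegral_indicator_one₀]
    · refine lintegral_mono fun p => ?_
      by_cases hp : p ∈ goodErrorEvent L A₁ A₂ ω ν
      swap
      · rw [Set.indicator_of_notMem hp]
        exact zero_le
      rw [Set.indicator_of_mem hp]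
      obtain ⟨h1, h2⟩ := hp
      rw [hprod, ← ENNReal.ofReal_mul (by positivity), ← Real.exp_add, Pi.one_apply,
        ENNReal.one_le_ofReal, Real.one_le_exp_iff]
      nlinarith [mul_nonneg hu0 (sub_nonneg.2 h1), mul_nonneg hr0 (sub_nonneg.2 h2)]
    · exact (measurableSet_goodErrorEvent L A₁ A₂ ω ν).nullMeasurableSet
  refine hbound.trans (le_of_eq ?_)
  have hm2 : Measurable fun p : (Fin K → Fin L → ℂ) × (Fin n → Fin L → ℂ) =>
      ∏ l, ENNReal.ofReal (Real.exp (-g (fun k => p.1 k l) fun i => p.2 i l)) :=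
    Finset.measurable_prod _ fun l _ => hfm.comp
      (g := Function.uncurry fun h z => ENNReal.ofReal (Real.exp (-g h z)))
      (f := fun p : (Fin K → Fin L → ℂ) × (Fin n → Fin L → ℂ) =>
        ((fun k => p.1 k l), (fun i => p.2 i l))) (by fun_prop)
  rw [lintegral_const_mul _ hm2, lintegral_prod _ hm2.aemeasurable]
  rw [lintegral_lintegral_prod_columns (fun h z => ENNReal.ofReal (Real.exp (-g h z))) hfm]
  simp only [hg]
  rw [lintegral_chernoff A₁ A₂ hα (sub_ne_zero.2 hu) hB, ← ENNReal.ofReal_pow (by positivity),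
    ← ENNReal.ofReal_mul (by positivity), Fintype.card_fin]
  congr 1
  rw [show -(L : ℝ) * (n * Real.log (1 + r * (1 - ω)) + Real.log (1 + Btilde A₁ A₂ ω u r).det.re
      - r * n * ν) = r * (n * L * ν) + L * -(n * Real.log (1 + r * (1 - ω))
      + Real.log (1 + Btilde A₁ A₂ ω u r).det.re) by ring, Real.exp_add, Real.exp_nat_mul,
    Real.exp_neg, Real.exp_add, Real.exp_nat_mul, Real.exp_log hα, Real.exp_log hd]

/-- The choice `u = 1`, `r = 0` makes `B̃` vanish. It shows both that the infimum is over a nonempty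
set and that it is at most one, hence integrable. -/
theorem chernoffMin_set_nonempty {n K : ℕ} (L : ℕ) (A₁ A₂ : Matrix (Fin n) (Fin K) ℂ) (ω ν : ℝ) :
    (1 : ℝ) ∈ {x : ℝ | ∃ u r : ℝ, 0 ≤ u ∧ 0 ≤ r ∧ u ≠ r * ω ∧
    (∀ μ ∈ spectrum ℝ (Btilde A₁ A₂ ω u r), -1 < μ) ∧
    x = Real.exp (-L * (n * Real.log (1 + r * (1 - ω))
      + Real.log (1 + Btilde A₁ A₂ ω u r).det.re - r * n * ν))} := by
  have h0 : Btilde A₁ A₂ ω 1 0 = 0 := by simp [Btilde]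
  refine ⟨1, 0, zero_le_one, le_rfl, by simp, ?_, ?_⟩
  · rw [← posDef_one_add_iff_spectrum (isHermitian_Btilde _ _ _ _ _), h0, add_zero]
    exact Matrix.PosDef.one
  · rw [h0]
    simp

theorem chernoffMin_nonneg {n K : ℕ} (L : ℕ) (A₁ A₂ : Matrix (Fin n) (Fin K) ℂ) (ω ν : ℝ) :
    0 ≤ chernoffMin L A₁ A₂ ω ν := by
  refine Real.sInf_nonneg ?_
  rintro x ⟨u, r, -, -, -, -, rfl⟩
  positivity

theorem chernoffMin_bddBelow {n K : ℕ} (L : ℕ) (A₁ A₂ : Matrix (Fin n) (Fin K) ℂ) (ω ν : ℝ) :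
    BddBelow {x : ℝ | ∃ u r : ℝ, 0 ≤ u ∧ 0 ≤ r ∧ u ≠ r * ω ∧
    (∀ μ ∈ spectrum ℝ (Btilde A₁ A₂ ω u r), -1 < μ) ∧
    x = Real.exp (-L * (n * Real.log (1 + r * (1 - ω))
      + Real.log (1 + Btilde A₁ A₂ ω u r).det.re - r * n * ν))} := by
  refine ⟨0, ?_⟩
  rintro x ⟨u, r, -, -, -, -, rfl⟩
  positivity

theorem chernoffMin_le_one {n K : ℕ} (L : ℕ) (A₁ A₂ : Matrix (Fin n) (Fin K) ℂ) (ω ν : ℝ) :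
    chernoffMin L A₁ A₂ ω ν ≤ 1 :=
  csInf_le (chernoffMin_bddBelow L A₁ A₂ ω ν) (chernoffMin_set_nonempty L A₁ A₂ ω ν)

theorem measure_goodErrorEvent_le_chernoffMin {n K : ℕ} (L : ℕ) (A₁ A₂ : Matrix (Fin n) (Fin K) ℂ)
    {ω : ℝ} (ν : ℝ) (hω : ω ≤ 1) :
    ((gaussianMatrix (Fin K) (Fin L) 1).prod (gaussianMatrix (Fin n) (Fin L) 1))
        (goodErrorEvent L A₁ A₂ ω ν) ≤ ENNReal.ofReal (chernoffMin L A₁ A₂ ω ν) := by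
  rw [← ENNReal.ofReal_toReal (measure_ne_top _ (goodErrorEvent L A₁ A₂ ω ν))]
  refine ENNReal.ofReal_le_ofReal (le_csInf ⟨1, chernoffMin_set_nonempty L A₁ A₂ ω ν⟩ ?_)
  rintro x ⟨u, r, hu0, hr0, hu, hs, rfl⟩
  refine ENNReal.toReal_le_of_le_ofReal (by positivity) ?_
  exact measure_goodErrorEvent_le L A₁ A₂ hω hu0 hr0 hu
    ((posDef_one_add_iff_spectrum (isHermitian_Btilde _ _ _ _ _)).2 hs)

/-- A continuous family of Hermitian matrices is positive definite on an open set. -/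
theorem isOpen_setOf_posDef {X ι : Type*} [TopologicalSpace X] [Fintype ι] {F : X → Matrix ι ι ℂ}
    (hF : Continuous F) (hH : ∀ x, (F x).IsHermitian) : IsOpen {x | (F x).PosDef} := by
  -- By homogeneity positivity need only be tested on the unit sphere, whose compactness makes the
  -- condition open in `x`.
  have hset : {x | (F x).PosDef}
      = {x | ∀ v ∈ Metric.sphere (0 : ι → ℂ) 1, 0 < (star v ⬝ᵥ (F x *ᵥ v)).re} := by
    ext x
    simp only [Set.mem_ofPred_eq]
    constructor
    · intro h v hv
      refine h.re_dotProduct_pos ?_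
      rintro rfl
      simp at hv
    · intro h
      refine Matrix.PosDef.of_dotProduct_mulVec_pos (hH x) fun v hv => ?_
      have hn : 0 < ‖v‖ := norm_pos_iff.2 hv
      have h1 := h ((‖v‖⁻¹ : ℝ) • v) (by
        rw [mem_sphere_zero_iff_norm, norm_smul, norm_inv, norm_norm, inv_mul_cancel₀ hn.ne'])
      rw [star_smul, star_trivial, Matrix.mulVec_smul, smul_dotProduct, dotProduct_smul,
        Complex.smul_re, Complex.smul_re, smul_eq_mul, smul_eq_mul] at h1
      have h2 : 0 < (star v ⬝ᵥ (F x *ᵥ v)).re := by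
        by_contra hcon
        have hi : 0 < ‖v‖⁻¹ := inv_pos.2 hn
        nlinarith [mul_pos hi hi]
      refine Complex.pos_iff.2 ⟨h2, ?_⟩
      exact ((hH x).im_star_dotProduct_mulVec_self v).symm
  rw [hset, isOpen_iff_eventually]
  intro x hx
  have hc : Continuous fun p : X × (ι → ℂ) => (star p.2 ⬝ᵥ (F p.1 *ᵥ p.2)).re := by
    refine Complex.continuous_re.comp ?_
    exact Continuous.dotProduct continuous_snd.star
      ((hF.comp continuous_fst).matrix_mulVec continuous_snd)
  refine (isCompact_sphere (0 : ι → ℂ) 1).eventually_forall_of_forall_eventually fun v hv => ?_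
  exact (hc.tendsto (x, v)).eventually (lt_mem_nhds (hx v hv))

theorem continuous_Btilde {X : Type*} [TopologicalSpace X] {n K : ℕ}
    {A₁ A₂ : X → Matrix (Fin n) (Fin K) ℂ} (h₁ : Continuous A₁) (h₂ : Continuous A₂) (ω u r : ℝ) :
    Continuous fun x => Btilde (A₁ x) (A₂ x) ω u r := by
  unfold Btilde
  have h3 : Continuous fun x => A₁ x - (u / (u - r * ω)) • A₂ x := h₁.sub
    (h₂.const_smul (u / (u - r * ω)) : Continuous fun x => (u / (u - r * ω)) • A₂ x)
  exact Continuous.sub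
    (Continuous.const_smul (h3.matrix_conjTranspose.matrix_mul h3)
      ((1 + r - u) * (u - r * ω) / (1 + r * (1 - ω))))
    (Continuous.const_smul (h₂.matrix_conjTranspose.matrix_mul h₂) (r * ω * u / (u - r * ω)))

/-- `chernoffMin` is upper semicontinuous, hence measurable. -/
theorem measurable_chernoffMin {X : Type*} [TopologicalSpace X] [MeasurableSpace X]
    [OpensMeasurableSpace X] {n K : ℕ} (L : ℕ)
    {A₁ A₂ : X → Matrix (Fin n) (Fin K) ℂ} (h₁ : Continuous A₁) (h₂ : Continuous A₂) (ω ν : ℝ) :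
    Measurable fun x => chernoffMin L (A₁ x) (A₂ x) ω ν := by
  refine measurable_of_Iio fun y => IsOpen.measurableSet ?_
  -- The union over `u, r` is uncountable, so measurability of each member would not suffice; what
  -- saves the argument is that each member is open.
  have hset : (fun x => chernoffMin L (A₁ x) (A₂ x) ω ν) ⁻¹' Set.Iio y
      = ⋃ u : ℝ, ⋃ r : ℝ, ⋃ _ : 0 ≤ u ∧ 0 ≤ r ∧ u ≠ r * ω,
        {x | (1 + Btilde (A₁ x) (A₂ x) ω u r).PosDef ∧ Real.exp (-L * (n * Real.log (1 + r * (1 - ω))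
      + Real.log (1 + Btilde (A₁ x) (A₂ x) ω u r).det.re - r * n * ν)) < y} := by
    ext x
    simp only [Set.mem_preimage, Set.mem_Iio, Set.mem_iUnion, Set.mem_ofPred_eq, exists_prop]
    rw [chernoffMin, csInf_lt_iff (chernoffMin_bddBelow L _ _ ω ν)
      ⟨1, chernoffMin_set_nonempty L _ _ ω ν⟩]
    constructor
    · rintro ⟨_, ⟨u, r, hu0, hr0, hu, hs, rfl⟩, hy⟩
      exact ⟨u, r, ⟨hu0, hr0, hu⟩,
        (posDef_one_add_iff_spectrum (isHermitian_Btilde _ _ _ _ _)).2 hs, hy⟩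
    · rintro ⟨u, r, ⟨hu0, hr0, hu⟩, hs, hy⟩
      exact ⟨_, ⟨u, r, hu0, hr0, hu,
        (posDef_one_add_iff_spectrum (isHermitian_Btilde _ _ _ _ _)).1 hs, rfl⟩, hy⟩
  rw [hset]
  refine isOpen_iUnion fun u => isOpen_iUnion fun r => isOpen_iUnion fun _ => ?_
  have hcB : Continuous fun x => 1 + Btilde (A₁ x) (A₂ x) ω u r :=
    continuous_const.add (continuous_Btilde h₁ h₂ ω u r)
  have hopen := isOpen_setOf_posDef hcB fun x =>
    Matrix.isHermitian_one.add (isHermitian_Btilde (A₁ x) (A₂ x) ω u r)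
  refine ContinuousOn.isOpen_inter_preimage (f := fun x => Real.exp
    (-L * (n * Real.log (1 + r * (1 - ω))
      + Real.log (1 + Btilde (A₁ x) (A₂ x) ω u r).det.re - r * n * ν))) ?_ hopen isOpen_Iio
  have hdet : Continuous fun x => (1 + Btilde (A₁ x) (A₂ x) ω u r).det.re :=
    Complex.continuous_re.comp hcB.matrix_det
  refine Real.continuous_exp.comp_continuousOn (continuousOn_const.mul
    ((continuousOn_const.add (hdet.continuousOn.log fun x hx => ?_)).sub continuousOn_const))
  exact (det_re_pos_of_posDef hx).ne'

end Chernoff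

/-! ## The law of the squared norm, and a rearrangement inequality -/

section Radial

/-- Integrating a function of the squared norm. -/
theorem exists_integral_fun_sqn (ι : Type*) [Fintype ι] [Nonempty ι] : ∃ c : ℝ, ∀ g : ℝ → ℝ,
    ∫ x : ι → ℂ, g (sqn x) = c * ∫ y in Set.Ioi 0, y ^ ((Fintype.card ι : ℝ) - 1) * g y := by
  let e := (PiLp.continuousLinearEquiv 2 ℝ (fun _ : ι => ℂ)).symm
  let E := PiLp 2 fun _ : ι => ℂ
  let μ : Measure E := (volume : Measure (ι → ℂ)).map e
  have hμ : μ.IsAddHaarMeasure := e.isAddHaarMeasure_map _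
  have hfin : FiniteDimensional ℝ E := e.toLinearEquiv.finiteDimensional
  have hdim : Module.finrank ℝ E = 2 * Fintype.card ι := by
    rw [← e.toLinearEquiv.finrank_eq, Module.finrank_pi_fintype]
    simp [mul_comm]
  have hnon : Nontrivial E := by
    apply Module.nontrivial_of_finrank_pos (R := ℝ)
    rw [hdim]
    have := Fintype.card_pos (α := ι)
    omega
  have hN : 0 < Fintype.card ι := Fintype.card_pos
  -- The real dimension and unit-ball volume come from polar coordinates, the factor `2⁻¹` from the
  -- substitution `y = r ^ 2`. The value is never used: it is eliminated by normalisation.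
  refine ⟨(2 * Fintype.card ι : ℕ) * (μ.real (Metric.ball 0 1) * 2⁻¹), fun g => ?_⟩
  have h1 := integral_fun_norm_addHaar μ (fun r => g (r ^ 2))
  have h2 : ∫ x : E, g (‖x‖ ^ 2) ∂μ = ∫ x : ι → ℂ, g (sqn x) := by
    have : μ = (volume : Measure (ι → ℂ)).map e.toHomeomorph.toMeasurableEquiv := rfl
    rw [this, integral_map_equiv]
    refine integral_congr_ae (Filter.Eventually.of_forall fun x => ?_)
    simp only [sqn]
    congr 1
    exact EuclideanSpace.norm_sq_eq (e x)
  have h3 : ∫ y in Set.Ioi (0 : ℝ), y ^ ((Fintype.card ι : ℝ) - 1) * g y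
      = 2 * ∫ y in Set.Ioi (0 : ℝ), y ^ (2 * Fintype.card ι - 1) • g (y ^ 2) := by
    rw [← integral_comp_rpow_Ioi (fun y : ℝ => y ^ ((Fintype.card ι : ℝ) - 1) * g y)
      (two_ne_zero : (2 : ℝ) ≠ 0), ← integral_const_mul]
    refine setIntegral_congr_fun measurableSet_Ioi fun y hy => ?_
    have hy0 : (0 : ℝ) < y := hy
    simp only [smul_eq_mul]
    have e1 : y ^ (2 : ℝ) = y ^ 2 := Real.rpow_two y
    rw [← e1, ← Real.rpow_mul hy0.le, abs_two, ← Real.rpow_natCast y (2 * Fintype.card ι - 1),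
      Nat.cast_sub (by omega)]
    push_cast
    have e2 : y ^ ((2 : ℝ) * Fintype.card ι - 1)
        = y ^ ((2 : ℝ) - 1) * y ^ ((2 : ℝ) * ((Fintype.card ι : ℝ) - 1)) := by
      rw [← Real.rpow_add hy0]
      congr 1
      ring
    rw [e2]
    ring
  rw [h3, ← h2, h1, hdim]
  simp only [nsmul_eq_mul, smul_eq_mul]
  ring

theorem lowerGamma_eq_integral_Ioi (s a : ℝ) :
    lowerGamma s a
      = ∫ y in Set.Ioi 0, y ^ (s - 1) * (Set.Iic a).indicator (fun y => Real.exp (-y)) y := by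
  have h : ∀ y : ℝ, y ^ (s - 1) * (Set.Iic a).indicator (fun y => Real.exp (-y)) y
      = (Set.Iic a).indicator (fun y => y ^ (s - 1) * Real.exp (-y)) y := by
    intro y
    by_cases hy : y ∈ Set.Iic a <;> simp [hy]
  simp_rw [h]
  rw [setIntegral_indicator measurableSet_Iic, Set.Ioi_inter_Iic, lowerGamma]

variable {ι κ : Type} [Fintype ι] [Fintype κ]

theorem integral_gaussianVec_one {ι : Type*} [Fintype ι] (f : (ι → ℂ) → ℝ) :
    ∫ x, f x ∂(gaussianVec ι 1)
      = (Real.pi ^ Fintype.card ι)⁻¹ * ∫ x, Real.exp (-sqn x) * f x := by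
  rw [gaussianVec_one, integral_withDensity_eq_integral_toReal_smul (by fun_prop)
    (Filter.Eventually.of_forall fun _ => ENNReal.ofReal_lt_top), ← integral_const_mul]
  refine integral_congr_ae (Filter.Eventually.of_forall fun x => ?_)
  simp only [smul_eq_mul]
  rw [ENNReal.toReal_ofReal (by positivity), mul_assoc]

theorem measurableSet_sqn_le {ι : Type*} [Fintype ι] (a : ℝ) :
    MeasurableSet {x : ι → ℂ | sqn x ≤ a} :=
  measurableSet_le measurable_sqn measurable_const

/-- The squared norm of a standard complex Gaussian vector is Gamma distributed. -/
theorem gaussianVec_real_sqn_le {ι : Type*} [Fintype ι] [Nonempty ι] (a : ℝ) :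
    (gaussianVec ι 1).real {x | sqn x ≤ a} = gammaRatio (Fintype.card ι) a := by
  obtain ⟨c, hc⟩ := exists_integral_fun_sqn ι
  have hN : (0 : ℝ) < Fintype.card ι := by exact_mod_cast Fintype.card_pos (α := ι)
  have h1 : (gaussianVec ι 1).real {x | sqn x ≤ a}
      = (Real.pi ^ Fintype.card ι)⁻¹ * (c * lowerGamma (Fintype.card ι) a) := by
    rw [← integral_indicator_one (measurableSet_sqn_le a), integral_gaussianVec_one,
      lowerGamma_eq_integral_Ioi, ← hc]
    congr 1
    refine integral_congr_ae (Filter.Eventually.of_forall fun x => ?_)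
    simp only [Set.indicator_apply, Set.mem_ofPred_eq, Set.mem_Iic, Pi.one_apply]
    split_ifs <;> simp
  -- Applying the same radial formula to the constant function one determines the unknown constant
  -- `c` in terms of the Gamma function.
  have h2 : 1 = (Real.pi ^ Fintype.card ι)⁻¹ * (c * Real.Gamma (Fintype.card ι)) := by
    have h := integral_gaussianVec_one (ι := ι) fun _ => 1
    simp only [integral_const, probReal_univ, smul_eq_mul, mul_one] at h
    rw [h, hc (fun y => Real.exp (-y)), Real.Gamma_eq_integral hN]
    congr 2
    refine integral_congr_ae (Filter.Eventually.of_forall fun x => ?_)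
    simp only
    ring
  have hΓ := (Real.Gamma_pos_of_pos hN).ne'
  rw [h1, gammaRatio, eq_div_iff hΓ]
  calc _ = lowerGamma (Fintype.card ι) a
        * ((Real.pi ^ Fintype.card ι)⁻¹ * (c * Real.Gamma (Fintype.card ι))) := by ring
    _ = _ := by rw [← h2, mul_one]

theorem measurePreserving_gaussianMatrix_uncurry (v : ℝ) :
    MeasurePreserving (MeasurableEquiv.curry ι κ ℂ).symm (gaussianMatrix ι κ v)
      (gaussianVec (ι × κ) v) :=
  measurePreserving_uncurry fun _ _ => complexGaussian v

theorem sqn_curry_symm (x : ι → κ → ℂ) : sqn ((MeasurableEquiv.curry ι κ ℂ).symm x) = frob x := by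
  simp only [sqn, frob, Fintype.sum_prod_type]
  rfl

theorem gaussianMatrix_real_frob_le [Nonempty ι] [Nonempty κ] (a : ℝ) :
    (gaussianMatrix ι κ 1).real {x | frob x ≤ a}
      = gammaRatio (Fintype.card ι * Fintype.card κ) a := by
  have h := gaussianVec_real_sqn_le (ι := ι × κ) a
  rw [Fintype.card_prod, Nat.cast_mul] at h
  rw [← h, ← (measurePreserving_gaussianMatrix_uncurry 1).map_eq, measureReal_def, measureReal_def,
    MeasurableEquiv.map_apply]
  congr 2
  ext x
  simp only [Set.mem_preimage, Set.mem_ofPred_eq, sqn_curry_symm]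

theorem gammaRatio_nonneg {s : ℝ} (hs : 0 < s) (a : ℝ) : 0 ≤ gammaRatio s a := by
  refine div_nonneg (setIntegral_nonneg measurableSet_Ioc fun x hx => ?_)
    (Real.Gamma_pos_of_pos hs).le
  have : 0 < x := hx.1
  positivity

/-- At positive integer order the ratio is a distribution function, so this bound and monotonicity
need no estimate of the integral. -/
theorem gammaRatio_le_one {N : ℕ} (hN : 0 < N) (a : ℝ) : gammaRatio N a ≤ 1 := by
  have : Nonempty (Fin N) := ⟨⟨0, hN⟩⟩
  have h := gaussianVec_real_sqn_le (ι := Fin N) a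
  rw [Fintype.card_fin] at h
  rw [← h]
  exact measureReal_le_one

theorem gammaRatio_mono {N : ℕ} (hN : 0 < N) : Monotone (gammaRatio N) := by
  intro a b hab
  have : Nonempty (Fin N) := ⟨⟨0, hN⟩⟩
  have h := fun a => gaussianVec_real_sqn_le (ι := Fin N) a
  simp only [Fintype.card_fin] at h
  rw [← h, ← h]
  exact measureReal_mono fun x (hx : sqn x ≤ a) => hx.trans hab

/-- If `E` and `F` have the same volume and the density is larger on `F \ E` than on `E \ F`, then
`F` has the larger measure. -/
theorem withDensity_le_of_rearrangement {X : Type*} [MeasurableSpace X] {μ : Measure X}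
    {f : X → ℝ≥0∞} {E F : Set X} (hE : MeasurableSet E) (hF : MeasurableSet F) (hEF : μ E = μ F)
    (hfin : μ F ≠ ∞) (c : ℝ≥0∞) (h1 : ∀ x ∈ E \ F, f x ≤ c) (h2 : ∀ x ∈ F \ E, c ≤ f x) :
    μ.withDensity f E ≤ μ.withDensity f F := by
  -- Equal finite volumes stay equal after removing the intersection, which contributes the same to
  -- both sides.
  have hd : μ (E \ F) = μ (F \ E) := by
    have hi : μ (E ∩ F) ≠ ∞ := ne_top_of_le_ne_top hfin (measure_mono Set.inter_subset_right)
    have a1 := measure_sdiff_add_inter (μ := μ) E hF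
    have a2 := measure_sdiff_add_inter (μ := μ) F hE
    rw [Set.inter_comm F E, ← hEF, ← a1] at a2
    exact ((ENNReal.add_left_inj hi).1 a2).symm
  rw [← measure_sdiff_add_inter (μ := μ.withDensity f) E hF,
    ← measure_sdiff_add_inter (μ := μ.withDensity f) F hE, Set.inter_comm F E]
  gcongr ?_ + _
  rw [withDensity_apply _ (MeasurableSet.diff hE hF), withDensity_apply _ (MeasurableSet.diff hF hE)]
  calc ∫⁻ x in E \ F, f x ∂μ ≤ ∫⁻ _ in E \ F, c ∂μ := setLIntegral_mono measurable_const h1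
    _ = c * μ (E \ F) := by rw [setLIntegral_const]
    _ = ∫⁻ _ in F \ E, c ∂μ := by rw [setLIntegral_const, hd]
    _ ≤ ∫⁻ x in F \ E, f x ∂μ := setLIntegral_mono' (MeasurableSet.diff hF hE) h2

theorem volume_preimage_mulVec {ι : Type*} [Fintype ι] [DecidableEq ι] {B : Matrix ι ι ℂ}
    (hB : B.det ≠ 0) {s : Set (ι → ℂ)} (hs : MeasurableSet s) :
    volume ((fun x => B *ᵥ x) ⁻¹' s) = ENNReal.ofReal ((‖B.det‖ ^ 2)⁻¹) * volume s := by
  rw [← Measure.map_apply (by fun_prop) hs, map_mulVec_volume hB, Measure.smul_apply, smul_eq_mul]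

theorem volume_sqn_le_ne_top {ι : Type*} [Fintype ι] (a : ℝ) :
    volume {x : ι → ℂ | sqn x ≤ a} ≠ ∞ := by
  refine ne_top_of_le_ne_top (measure_closedBall_lt_top (x := (0 : ι → ℂ)) (r := √a)).ne
    (measure_mono fun x (hx : sqn x ≤ a) => ?_)
  rw [mem_closedBall_zero_iff, pi_norm_le_iff_of_nonneg (Real.sqrt_nonneg _)]
  intro i
  refine Real.le_sqrt_of_sq_le (le_trans ?_ hx)
  exact Finset.single_le_sum (f := fun i => ‖x i‖ ^ 2) (fun _ _ => sq_nonneg _) (Finset.mem_univ i)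

/-- Among ellipsoids of equal volume, the ball has the largest Gaussian measure. -/
theorem gaussianVec_sqn_mulVec_le {ι : Type*} [Fintype ι] [Nonempty ι] [DecidableEq ι]
    {B : Matrix ι ι ℂ} (hB : B.det ≠ 0) (b : ℝ) :
    gaussianVec ι 1 {x | sqn (B *ᵥ x) ≤ b}
      ≤ gaussianVec ι 1 {x | sqn x ≤ b / (‖B.det‖ ^ 2) ^ (1 / (Fintype.card ι : ℝ))} := by
  have hN : (Fintype.card ι : ℝ) ≠ 0 := by exact_mod_cast Fintype.card_ne_zero
  have hd : 0 < ‖B.det‖ ^ 2 := by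
    have := norm_pos_iff.2 hB
    positivity
  -- The scale is chosen so that the scalar matrix `√s` has the same Jacobian as `B`; the ellipsoid
  -- and the ball then have equal volume.
  set s := (‖B.det‖ ^ 2) ^ (1 / (Fintype.card ι : ℝ)) with hs
  have hs0 : 0 < s := Real.rpow_pos_of_pos hd _
  have hsN : s ^ Fintype.card ι = ‖B.det‖ ^ 2 := by
    rw [hs, ← Real.rpow_natCast, ← Real.rpow_mul hd.le, one_div, inv_mul_cancel₀ hN, Real.rpow_one]
  have hsd : ((√s : ℂ) • (1 : Matrix ι ι ℂ)).det = (√s : ℂ) ^ Fintype.card ι := by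
    rw [Matrix.det_smul, Matrix.det_one, mul_one]
  have hsn : ‖((√s : ℂ) • (1 : Matrix ι ι ℂ)).det‖ ^ 2 = ‖B.det‖ ^ 2 := by
    rw [hsd, norm_pow, pow_right_comm, Complex.norm_real, Real.norm_eq_abs, sq_abs,
      Real.sq_sqrt hs0.le, hsN]
  have hE : {x : ι → ℂ | sqn (B *ᵥ x) ≤ b} = (fun x => B *ᵥ x) ⁻¹' {x | sqn x ≤ b} := rfl
  have hF : {x : ι → ℂ | sqn x ≤ b / s}
      = (fun x => ((√s : ℂ) • (1 : Matrix ι ι ℂ)) *ᵥ x) ⁻¹' {x | sqn x ≤ b} := by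
    ext x
    have h1 : ((√s : ℂ) • (1 : Matrix ι ι ℂ)) *ᵥ x = √s • x := by
      rw [Matrix.smul_mulVec, Matrix.one_mulVec]
      ext i
      simp
    simp only [Set.mem_ofPred_eq, Set.mem_preimage]
    rw [h1, sqn_smul, Real.sq_sqrt hs0.le, le_div_iff₀ hs0, mul_comm]
  have hmE : MeasurableSet {x : ι → ℂ | sqn (B *ᵥ x) ≤ b} :=
    measurableSet_le (by fun_prop) measurable_const
  rw [gaussianVec_one]
  -- The threshold is the Gaussian density on the boundary sphere `sqn x = b / s`; radial decrease
  -- gives the two comparisons.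
  refine withDensity_le_of_rearrangement hmE (measurableSet_sqn_le _) ?_ (volume_sqn_le_ne_top _)
    (ENNReal.ofReal ((Real.pi ^ Fintype.card ι)⁻¹ * Real.exp (-(b / s)))) ?_ ?_
  · rw [hE, hF, volume_preimage_mulVec hB (measurableSet_sqn_le _),
      volume_preimage_mulVec (by
        rw [← norm_ne_zero_iff]
        intro h0
        rw [h0] at hsn
        exact hd.ne' (by rw [← hsn]; norm_num)) (measurableSet_sqn_le _), hsn]
  · rintro x ⟨-, hx⟩
    have : b / s < sqn x := not_le.1 hx
    gcongr
  · rintro x ⟨hx, -⟩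
    have : sqn x ≤ b / s := hx
    gcongr

open scoped Kronecker in
-- Acting by `B` on each column is the Kronecker product of `B` with the identity on the vectorised
-- matrix. Its determinant is a power of `det B`, and the root of order `|ι| |κ|` undoes that power.
theorem gaussianMatrix_frob_mulCols_le [Nonempty ι] [Nonempty κ] [DecidableEq ι]
    {B : Matrix ι ι ℂ} (hB : B.det ≠ 0) (b : ℝ) :
    gaussianMatrix ι κ 1 {x | frob (mulCols B x) ≤ b}
      ≤ ENNReal.ofReal (gammaRatio (Fintype.card ι * Fintype.card κ)
        (b / (‖B.det‖ ^ 2) ^ (1 / (Fintype.card ι : ℝ)))) := by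
  classical
  have hdet : (B ⊗ₖ (1 : Matrix κ κ ℂ)).det = B.det ^ Fintype.card κ := by
    rw [Matrix.det_kronecker, Matrix.det_one, one_pow, mul_one]
  have h := gaussianVec_sqn_mulVec_le (B := B ⊗ₖ (1 : Matrix κ κ ℂ))
    (by rw [hdet]; exact pow_ne_zero _ hB) b
  have hd : 0 < ‖B.det‖ ^ 2 := by
    have := norm_pos_iff.2 hB
    positivity
  have hexp : (‖B.det ^ Fintype.card κ‖ ^ 2) ^ (1 / (Fintype.card (ι × κ) : ℝ))
      = (‖B.det‖ ^ 2) ^ (1 / (Fintype.card ι : ℝ)) := by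
    rw [norm_pow, pow_right_comm, ← Real.rpow_natCast _ (Fintype.card κ), ← Real.rpow_mul hd.le]
    congr 1
    rw [Fintype.card_prod, Nat.cast_mul]
    have : (Fintype.card κ : ℝ) ≠ 0 := by exact_mod_cast Fintype.card_ne_zero
    field_simp
  rw [hdet, hexp] at h
  rw [← gaussianMatrix_real_frob_le, ofReal_measureReal]
  have hset : ∀ c : ℝ, gaussianMatrix ι κ 1 {x | frob x ≤ c}
      = gaussianVec (ι × κ) 1 {x | sqn x ≤ c} := by
    intro c
    rw [← (measurePreserving_gaussianMatrix_uncurry 1).map_eq, MeasurableEquiv.map_apply]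
    congr 1
    ext x
    simp only [Set.mem_preimage, Set.mem_ofPred_eq, sqn_curry_symm]
  rw [hset]
  refine le_trans (le_of_eq ?_) h
  rw [← (measurePreserving_gaussianMatrix_uncurry 1).map_eq, MeasurableEquiv.map_apply]
  congr 1
  ext x
  simp only [Set.mem_preimage, Set.mem_ofPred_eq]
  rw [← sqn_curry_symm]
  have : (MeasurableEquiv.curry ι κ ℂ).symm (mulCols B x)
      = (B ⊗ₖ (1 : Matrix κ κ ℂ)) *ᵥ (MeasurableEquiv.curry ι κ ℂ).symm x := by
    ext ⟨i, l⟩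
    simp only [Matrix.mulVec, dotProduct, Fintype.sum_prod_type, Matrix.kroneckerMap_apply,
      Matrix.one_apply, mul_ite, mul_one, mul_zero, ite_mul, zero_mul, Finset.sum_ite_eq,
      Finset.mem_univ, if_true]
    rfl
  rw [this]

end Radial

/-! ## Linear images of Gaussian matrices -/

section LinearImage

variable {ι κ μ : Type} [Fintype ι] [Fintype κ] [Fintype μ]

/-- The law of `z + A h` for independent standard Gaussian `z`, `h`. -/
theorem lintegral_gaussianVec_add_mulVec [DecidableEq ι] [DecidableEq κ] (A : Matrix ι κ ℂ)
    {B : Matrix ι ι ℂ} (hB : B * Bᴴ = 1 + A * Aᴴ) {f : (ι → ℂ) → ℝ≥0∞} (hf : Measurable f) :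
    ∫⁻ h, ∫⁻ z, f (z + A *ᵥ h) ∂(gaussianVec ι 1) ∂(gaussianVec κ 1)
      = ∫⁻ z, f (B *ᵥ z) ∂(gaussianVec ι 1) := by
  have hpd := posDef_one_add_mul_conjTranspose A
  have hBdet : B.det ≠ 0 := by
    intro h
    have := det_re_pos_of_posDef hpd
    rw [← hB, Matrix.det_mul, h, zero_mul] at this
    simp at this
  have hBu : IsUnit B.det := isUnit_iff_ne_zero.2 hBdet
  have hin : ∀ h : κ → ℂ, ∫⁻ z, f (z + A *ᵥ h) ∂(gaussianVec ι 1)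
      = ENNReal.ofReal ((Real.pi ^ Fintype.card ι)⁻¹)
        * ∫⁻ y, ENNReal.ofReal (Real.exp (-sqn (y - A *ᵥ h))) * f y := by
    intro h
    rw [lintegral_gaussianVec_one (by fun_prop), ← lintegral_add_right_eq_self
      (fun y => ENNReal.ofReal (Real.exp (-sqn (y - A *ᵥ h))) * f y) (A *ᵥ h)]
    simp_rw [add_sub_cancel_right]
  simp_rw [hin]
  have hjoint : Measurable fun p : (κ → ℂ) × (ι → ℂ) =>
      ENNReal.ofReal (Real.exp (-sqn (p.2 - A *ᵥ p.1))) * f p.2 := by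
    have : Measurable fun p : (κ → ℂ) × (ι → ℂ) => p.2 - A *ᵥ p.1 := by
      have h1 : Measurable fun h : κ → ℂ => A *ᵥ h := by fun_prop
      exact measurable_snd.sub (h1.comp measurable_fst)
    fun_prop
  rw [lintegral_const_mul _ hjoint.lintegral_prod_right',
    lintegral_lintegral_swap hjoint.aemeasurable]
  -- Integrating out `h` first leaves the density of a Gaussian vector with covariance `1 + A Aᴴ = B
  -- Bᴴ`, expressed through `B⁻¹ y`; the substitution `y = B z` finishes.
  have hin2 : ∀ y : ι → ℂ,
      ∫⁻ h, ENNReal.ofReal (Real.exp (-sqn (y - A *ᵥ h))) * f y ∂(gaussianVec κ 1)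
      = ENNReal.ofReal ((‖B.det‖ ^ 2)⁻¹)
        * (ENNReal.ofReal (Real.exp (-sqn (B⁻¹ *ᵥ y))) * f (B *ᵥ (B⁻¹ *ᵥ y))) := by
    intro y
    have hdet : (1 + A * Aᴴ).det.re = ‖B.det‖ ^ 2 := by
      rw [← hB, Matrix.det_mul_comm, det_conjTranspose_mul_self, Complex.ofReal_re]
    have hq : (star y ⬝ᵥ ((1 + A * Aᴴ)⁻¹ *ᵥ y)).re = sqn (B⁻¹ *ᵥ y) := by
      rw [sqn_mulVec, ← hB, Matrix.mul_inv_rev, Matrix.conjTranspose_nonsing_inv]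
    rw [lintegral_mul_const _ (by fun_prop), lintegral_gaussianVec_exp_neg_sqn_sub, hdet, hq,
      ENNReal.ofReal_mul (by positivity), mul_assoc, Matrix.mulVec_mulVec,
      Matrix.mul_nonsing_inv _ hBu, Matrix.one_mulVec]
  simp_rw [hin2]
  have hBi : (B⁻¹).det ≠ 0 := by
    rw [Matrix.det_nonsing_inv, Ring.inverse_eq_inv']
    exact inv_ne_zero hBdet
  rw [lintegral_const_mul _ (by fun_prop),
    lintegral_comp_mulVec hBi (f := fun x => ENNReal.ofReal (Real.exp (-sqn x)) * f (B *ᵥ x))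
      (by fun_prop), lintegral_gaussianVec_one (f := fun z => f (B *ᵥ z)) (by fun_prop),
    Matrix.det_nonsing_inv, Ring.inverse_eq_inv', norm_inv]
  congr 1
  rw [← mul_assoc, ← ENNReal.ofReal_mul (by positivity)]
  have : 0 < ‖B.det‖ := norm_pos_iff.2 hBdet
  rw [show (‖B.det‖ ^ 2)⁻¹ * ((‖B.det‖⁻¹ ^ 2)⁻¹) = 1 by field_simp, ENNReal.ofReal_one, one_mul]

theorem map_gaussianVec_add_mulVec [DecidableEq ι] [DecidableEq κ] (A : Matrix ι κ ℂ)
    {B : Matrix ι ι ℂ} (hB : B * Bᴴ = 1 + A * Aᴴ) :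
    ((gaussianVec κ 1).prod (gaussianVec ι 1)).map (fun p => p.2 + A *ᵥ p.1)
      = (gaussianVec ι 1).map fun z => B *ᵥ z := by
  have hm : Measurable fun p : (κ → ℂ) × (ι → ℂ) => p.2 + A *ᵥ p.1 := by
    have h1 : Measurable fun h : κ → ℂ => A *ᵥ h := by fun_prop
    exact measurable_snd.add (h1.comp measurable_fst)
  ext s hs
  have h := lintegral_gaussianVec_add_mulVec A hB
    (f := s.indicator 1) (measurable_one.indicator hs)
  have hm2 : Measurable fun p : (κ → ℂ) × (ι → ℂ) =>
      s.indicator (1 : (ι → ℂ) → ℝ≥0∞) (p.2 + A *ᵥ p.1) :=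
    (measurable_one.indicator hs).comp hm
  rw [← lintegral_indicator_one hs, ← lintegral_indicator_one hs,
    lintegral_map (measurable_one.indicator hs) hm,
    lintegral_map (measurable_one.indicator hs) (by fun_prop), ← h,
    lintegral_prod _ hm2.aemeasurable]

theorem measurePreserving_gaussianMatrix_prod_columns :
    MeasurePreserving
      (fun (p : (κ → μ → ℂ) × (ι → μ → ℂ)) (l : μ) => ((fun k => p.1 k l), (fun i => p.2 i l)))
      ((gaussianMatrix κ μ 1).prod (gaussianMatrix ι μ 1))
      (Measure.pi fun _ : μ => (gaussianVec κ 1).prod (gaussianVec ι 1)) := by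
  have h1 := (measurePreserving_gaussianMatrix_swap (ι := κ) (κ := μ) 1).prod
    (measurePreserving_gaussianMatrix_swap (ι := ι) (κ := μ) 1)
  have h2 := (measurePreserving_arrowProdEquivProdArrow (κ → ℂ) (ι → ℂ) μ
    (fun _ => gaussianVec κ 1) (fun _ => gaussianVec ι 1)).symm
  exact h2.comp h1

/-- Both matrices have independent columns with the same law, so after transposition their laws
agree as product measures. -/
theorem measure_frob_add_mulCols [DecidableEq ι] [DecidableEq κ] (A : Matrix ι κ ℂ)
    {B : Matrix ι ι ℂ} (hB : B * Bᴴ = 1 + A * Aᴴ) (b : ℝ) :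
    ((gaussianMatrix κ μ 1).prod (gaussianMatrix ι μ 1)) {p | frob (p.2 + mulCols A p.1) ≤ b}
      = gaussianMatrix ι μ 1 {y | frob (mulCols B y) ≤ b} := by
  have hm : Measurable fun p : (κ → ℂ) × (ι → ℂ) => p.2 + A *ᵥ p.1 := by
    have h1 : Measurable fun h : κ → ℂ => A *ᵥ h := by fun_prop
    exact measurable_snd.add (h1.comp measurable_fst)
  have hP : IsProbabilityMeasure ((gaussianVec ι 1).map fun z => B *ᵥ z) :=
    Measure.isProbabilityMeasure_map (by fun_prop)
  have hL : MeasurePreserving (fun p : (κ → ℂ) × (ι → ℂ) => p.2 + A *ᵥ p.1)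
      ((gaussianVec κ 1).prod (gaussianVec ι 1)) ((gaussianVec ι 1).map fun z => B *ᵥ z) :=
    ⟨hm, map_gaussianVec_add_mulVec A hB⟩
  have hR : MeasurePreserving (fun z : ι → ℂ => B *ᵥ z) (gaussianVec ι 1)
      ((gaussianVec ι 1).map fun z => B *ᵥ z) := ⟨by fun_prop, rfl⟩
  have h1 := (measurePreserving_pi (ι := μ) _ _ fun _ => hL).comp
    measurePreserving_gaussianMatrix_prod_columns
  have h2 := (measurePreserving_pi (ι := μ) _ _ fun _ => hR).comp
    (measurePreserving_gaussianMatrix_swap (ι := ι) (κ := μ) 1)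
  have hs : MeasurableSet {y : μ → ι → ℂ | frob y ≤ b} :=
    measurableSet_le measurable_frob measurable_const
  have e1 := h1.measure_preimage hs.nullMeasurableSet
  have e2 := h2.measure_preimage hs.nullMeasurableSet
  rw [← e2] at e1
  convert e1 using 2
  · ext p
    simp only [Set.mem_ofPred_eq, Set.mem_preimage, frob_add_mulCols]
    rfl
  · ext y
    simp only [Set.mem_ofPred_eq, Set.mem_preimage]
    rw [frob_eq_sum_columns]
    rfl

theorem measure_frob_add_mulCols_le [Nonempty ι] [Nonempty μ] [DecidableEq ι]
    (A : Matrix ι κ ℂ) (b : ℝ) :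
    ((gaussianMatrix κ μ 1).prod (gaussianMatrix ι μ 1)) {p | frob (p.2 + mulCols A p.1) ≤ b}
      ≤ ENNReal.ofReal (gammaRatio (Fintype.card ι * Fintype.card μ)
        (b / (1 + A * Aᴴ).det.re ^ (1 / (Fintype.card ι : ℝ)))) := by
  classical
  obtain ⟨B, hB, hdet⟩ :=
    exists_eq_conjTranspose_mul_self_of_posDef (posDef_one_add_mul_conjTranspose A)
  -- The factorisation of a positive definite matrix is `Bᴴ B`, while a covariance square root is
  -- needed on the left, hence the adjoint.
  have hB' : Bᴴ * Bᴴᴴ = 1 + A * Aᴴ := by rw [Matrix.conjTranspose_conjTranspose, hB]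
  have hd : Bᴴ.det ≠ 0 := by
    rw [Matrix.det_conjTranspose]
    exact star_ne_zero.2 hdet
  rw [measure_frob_add_mulCols A hB' b]
  refine (gaussianMatrix_frob_mulCols_le hd b).trans (le_of_eq ?_)
  rw [hB, det_conjTranspose_mul_self, Complex.ofReal_re, Matrix.det_conjTranspose, norm_star]

/-- Unitary invariance of the standard complex Gaussian law. -/
theorem measurePreserving_mulVec_of_unitary [DecidableEq ι] {U : Matrix ι ι ℂ} (hU : Uᴴ * U = 1) :
    MeasurePreserving (fun x => U *ᵥ x) (gaussianVec ι 1) (gaussianVec ι 1) := by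
  have hdet : ‖U.det‖ ^ 2 = 1 := by
    have := congrArg Matrix.det hU
    rw [det_conjTranspose_mul_self, Matrix.det_one] at this
    exact_mod_cast this
  have hd : U.det ≠ 0 := by
    intro h
    simp [h] at hdet
  have hsq : ∀ x, sqn (U *ᵥ x) = sqn x := by
    intro x
    rw [sqn_mulVec, hU, Matrix.one_mulVec, re_star_dotProduct_self]
  refine ⟨by fun_prop, ?_⟩
  ext s hs
  rw [← lintegral_indicator_one hs, ← lintegral_indicator_one hs,
    lintegral_map (measurable_one.indicator hs) (by fun_prop),
    lintegral_gaussianVec_one (f := fun x => s.indicator 1 (U *ᵥ x))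
      ((measurable_one.indicator hs).comp (by fun_prop)),
    lintegral_gaussianVec_one (measurable_one.indicator hs)]
  congr 1
  have h := lintegral_comp_mulVec hd
    (f := fun x => ENNReal.ofReal (Real.exp (-sqn x)) * s.indicator 1 x)
    (((by fun_prop : Measurable fun x : ι → ℂ => ENNReal.ofReal (Real.exp (-sqn x)))).mul
      (measurable_one.indicator hs))
  simp_rw [hsq] at h
  rw [h, hdet, inv_one, ENNReal.ofReal_one, one_mul]

theorem measurePreserving_mulCols_of_unitary [DecidableEq ι] {U : Matrix ι ι ℂ} (hU : Uᴴ * U = 1) :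
    MeasurePreserving (fun H : ι → μ → ℂ => mulCols U H) (gaussianMatrix ι μ 1)
      (gaussianMatrix ι μ 1) :=
  (measurePreserving_gaussianMatrix_swap (ι := μ) (κ := ι) 1).comp
    ((measurePreserving_pi (ι := μ) _ _ fun _ => measurePreserving_mulVec_of_unitary hU).comp
      (measurePreserving_gaussianMatrix_swap (ι := ι) (κ := μ) 1))

/-- A unit combination of two independent standard complex Gaussian variables. -/
theorem measurePreserving_unit_combination {α β : ℝ} (h : α ^ 2 + β ^ 2 = 1) :
    MeasurePreserving (fun p : ℂ × ℂ => (α : ℂ) * p.1 + β * p.2)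
      ((complexGaussian 1).prod (complexGaussian 1)) (complexGaussian 1) := by
  -- The unit row `(α, β)` is completed to a unitary matrix, and the combination is the first
  -- coordinate of a rotated pair.
  let U : Matrix (Fin 2) (Fin 2) ℂ := !![(α : ℂ), β; -β, α]
  have hc : (α : ℂ) * α + β * β = 1 := by
    have := congrArg (fun x : ℝ => (x : ℂ)) h
    push_cast at this
    linear_combination this
  have hU : Uᴴ * U = 1 := by
    ext i j
    fin_cases i <;> fin_cases j <;>
      simp [U, Matrix.mul_apply, Fin.sum_univ_two] <;>
      first | linear_combination hc | ring
  have h1 := (measurePreserving_piFinTwo fun _ : Fin 2 => complexGaussian 1).symm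
  have h2 := measurePreserving_eval (fun _ : Fin 2 => complexGaussian 1) 0
  have h3 := (h2.comp (measurePreserving_mulVec_of_unitary hU)).comp h1
  convert h3 using 1
  ext p
  simp [U, MeasurableEquiv.piFinTwo]

/-- The map may vary with the row, because each singular direction will need its own coefficients.
-/
theorem measurePreserving_gaussianMatrix_map₂ (f : ι → ℂ × ℂ → ℂ)
    (hf : ∀ i, MeasurePreserving (f i) ((complexGaussian 1).prod (complexGaussian 1))
      (complexGaussian 1)) :
    MeasurePreserving (fun (p : (ι → μ → ℂ) × (ι → μ → ℂ)) i l => f i (p.1 i l, p.2 i l))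
      ((gaussianMatrix ι μ 1).prod (gaussianMatrix ι μ 1)) (gaussianMatrix ι μ 1) := by
  have h1 := (measurePreserving_arrowProdEquivProdArrow (μ → ℂ) (μ → ℂ) ι
    (fun _ => gaussianVec μ 1) (fun _ => gaussianVec μ 1)).symm
  have h2 := (measurePreserving_arrowProdEquivProdArrow ℂ ℂ μ
    (fun _ => complexGaussian 1) (fun _ => complexGaussian 1)).symm
  have h3 : ∀ i : ι, MeasurePreserving
      (fun (q : (μ → ℂ) × (μ → ℂ)) l => f i (q.1 l, q.2 l))
      ((gaussianVec μ 1).prod (gaussianVec μ 1)) (gaussianVec μ 1) := fun i =>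
    (measurePreserving_pi (ι := μ) _ _ fun _ => hf i).comp h2
  exact (measurePreserving_pi (ι := ι) _ _ h3).comp h1

/-- The real part of the inner product with a fixed vector is a real Gaussian variable. -/
theorem map_re_star_dotProduct (x : ι → ℂ) :
    (gaussianVec ι 1).map (fun z => (star z ⬝ᵥ x).re)
      = gaussianReal 0 (sqn x / 2).toNNReal := by
  have hm : Measurable fun z : ι → ℂ => (star z ⬝ᵥ x).re := by
    unfold dotProduct
    fun_prop
  have hP : IsProbabilityMeasure ((gaussianVec ι 1).map fun z => (star z ⬝ᵥ x).re) :=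
    Measure.isProbabilityMeasure_map hm.aemeasurable
  refine Measure.ext_of_charFun ?_
  ext t
  rw [charFun_apply_real, charFun_gaussianReal, integral_map hm.aemeasurable (by fun_prop)]
  -- One coordinate contributes a real Gaussian of variance `‖w‖² / 2`, whose real and imaginary
  -- parts factor in the characteristic function.
  have hone : ∀ w : ℂ, ∫ z, Complex.exp (t * ((star z * w).re : ℝ) * Complex.I) ∂(complexGaussian 1)
      = Complex.exp (-((‖w‖ ^ 2 : ℝ) / 4 * t ^ 2)) := by
    intro w
    have hmap : Measurable (fun p : ℝ × ℝ => (⟨p.1, p.2⟩ : ℂ)) :=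
      Complex.measurableEquivRealProd.symm.measurable
    rw [complexGaussian, integral_map hmap.aemeasurable (by fun_prop)]
    have hsplit : ∀ p : ℝ × ℝ, Complex.exp (t * ((star (⟨p.1, p.2⟩ : ℂ) * w).re : ℝ) * Complex.I)
        = Complex.exp ((t * w.re : ℝ) * p.1 * Complex.I)
          * Complex.exp ((t * w.im : ℝ) * p.2 * Complex.I) := by
      intro p
      rw [← Complex.exp_add]
      congr 1
      simp
      ring
    simp_rw [hsplit]
    rw [integral_prod_mul (fun x : ℝ => Complex.exp ((t * w.re : ℝ) * x * Complex.I))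
      (fun x : ℝ => Complex.exp ((t * w.im : ℝ) * x * Complex.I)), ← charFun_apply_real,
      ← charFun_apply_real, charFun_gaussianReal, charFun_gaussianReal, ← Complex.exp_add]
    congr 1
    have hc : (((1 : ℝ) / 2).toNNReal : ℝ) = 1 / 2 := Real.coe_toNNReal _ (by norm_num)
    have hw : (‖w‖ ^ 2 : ℝ) = w.re ^ 2 + w.im ^ 2 := by
      rw [Complex.sq_norm, Complex.normSq_apply]
      ring
    rw [hw, hc]
    push_cast
    ring
  have hprod : ∀ z : ι → ℂ, Complex.exp (t * ((star z ⬝ᵥ x).re : ℝ) * Complex.I)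
      = ∏ i, Complex.exp (t * ((star (z i) * x i).re : ℝ) * Complex.I) := by
    intro z
    rw [← Complex.exp_sum]
    congr 1
    simp only [dotProduct, Complex.re_sum, Pi.star_apply]
    rw [Complex.ofReal_sum, Finset.mul_sum, Finset.sum_mul]
  simp_rw [hprod]
  rw [gaussianVec, integral_fintype_prod_eq_prod
    (fun (i : ι) (z : ℂ) => Complex.exp (t * ((star z * x i).re : ℝ) * Complex.I))]
  simp_rw [hone]
  rw [← Complex.exp_sum, Real.coe_toNNReal _ (div_nonneg (sqn_nonneg x) two_pos.le)]
  congr 1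
  rw [sqn]
  push_cast
  rw [Finset.sum_neg_distrib, ← Finset.sum_mul, ← Finset.sum_div]
  ring

end LinearImage

/-! ## Noise energy against the energy of the correct hypothesis -/

section NoiseEnergy

variable {ι κ μ : Type} [Fintype ι] [Fintype κ] [Fintype μ]

/-- The real inner product of two complex matrices. -/
noncomputable def reInner (Z X : ι → μ → ℂ) : ℝ := ∑ i, (star (Z i) ⬝ᵥ X i).re

theorem frob_add (Z X : ι → μ → ℂ) : frob (Z + X) = frob Z + frob X + 2 * reInner Z X := by
  simp only [frob, reInner, Pi.add_apply, sqn_add, Finset.sum_add_distrib, Finset.mul_sum]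

theorem continuous_reInner : Continuous fun p : (ι → μ → ℂ) × (ι → μ → ℂ) => reInner p.1 p.2 := by
  unfold reInner dotProduct
  fun_prop

theorem map_reInner (X : ι → μ → ℂ) :
    (gaussianMatrix ι μ 1).map (fun Z => reInner Z X) = gaussianReal 0 (frob X / 2).toNNReal := by
  have hm : Measurable fun z : ι × μ → ℂ =>
      (star z ⬝ᵥ (MeasurableEquiv.curry ι μ ℂ).symm X).re := by
    unfold dotProduct
    fun_prop
  rw [← sqn_curry_symm, ← map_re_star_dotProduct,
    ← (measurePreserving_gaussianMatrix_uncurry 1).map_eq,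
    Measure.map_map hm (measurePreserving_gaussianMatrix_uncurry 1).measurable]
  congr 1
  ext Z
  simp only [reInner, dotProduct, Function.comp_apply, Fintype.sum_prod_type, Complex.re_sum]
  rfl

theorem measurable_reInner_mulCols (A : Matrix ι κ ℂ) :
    Measurable fun p : (κ → μ → ℂ) × (ι → μ → ℂ) => reInner p.2 (mulCols A p.1) := by
  unfold reInner dotProduct mulCols Matrix.mulVec dotProduct
  fun_prop

theorem measurableSet_signal_le (A : Matrix ι κ ℂ) (c τ : ℝ) :
    MeasurableSet {p : (κ → μ → ℂ) × (ι → μ → ℂ) |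
      c * frob (mulCols A p.1) + 2 * c * reInner p.2 (mulCols A p.1) < τ} := by
  have h1 := measurable_reInner_mulCols (μ := μ) A
  have h2 : Measurable fun p : (κ → μ → ℂ) × (ι → μ → ℂ) => frob (mulCols A p.1) :=
    measurable_frob.comp ((measurable_mulCols A).comp measurable_fst)
  exact measurableSet_lt ((h2.const_mul c).add (h1.const_mul (2 * c))) measurable_const

/-- Conditionally on the fading, only the energy of the received codewords matters. -/
theorem measure_signal_lt_of_frob_eq {ι' : Type} [Fintype ι'] (A : Matrix ι κ ℂ)
    (D : Matrix ι' κ ℂ) {g : (κ → μ → ℂ) → (κ → μ → ℂ)}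
    (hg : MeasurePreserving g (gaussianMatrix κ μ 1) (gaussianMatrix κ μ 1))
    (h : ∀ H, frob (mulCols A H) = frob (mulCols D (g H))) (c τ : ℝ) :
    ((gaussianMatrix κ μ 1).prod (gaussianMatrix ι μ 1)) {p |
        c * frob (mulCols A p.1) + 2 * c * reInner p.2 (mulCols A p.1) < τ}
      = ((gaussianMatrix κ μ 1).prod (gaussianMatrix ι' μ 1)) {p |
        c * frob (mulCols D p.1) + 2 * c * reInner p.2 (mulCols D p.1) < τ} := by
  -- Given the fading, the inner product with the noise is a centred real Gaussian of variance `frob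
  -- X / 2`. Only `frob X` matters, so even the number of rows may be changed.
  have key : ∀ {ι₀ : Type} [Fintype ι₀] (X : ι₀ → μ → ℂ),
      gaussianMatrix ι₀ μ 1 {Z | c * frob X + 2 * c * reInner Z X < τ}
        = gaussianReal 0 (frob X / 2).toNNReal {y | c * frob X + 2 * c * y < τ} := by
    intro ι₀ _ X
    rw [← map_reInner, Measure.map_apply]
    · rfl
    · exact (continuous_reInner.comp (continuous_id.prodMk continuous_const)).measurable
    · exact measurableSet_lt (by fun_prop) measurable_const
  rw [Measure.prod_apply (measurableSet_signal_le A c τ),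
    Measure.prod_apply (measurableSet_signal_le D c τ),
    ← hg.lintegral_comp (measurable_measure_prodMk_left (measurableSet_signal_le D c τ))]
  refine lintegral_congr fun H => ?_
  change gaussianMatrix ι μ 1 {Z | c * frob (mulCols A H) + 2 * c * reInner Z (mulCols A H) < τ}
    = gaussianMatrix ι' μ 1
      {Z | c * frob (mulCols D (g H)) + 2 * c * reInner Z (mulCols D (g H)) < τ}
  rw [key, key, h]

/-- A singular value decomposition, up to left multiplication by a unitary. -/
theorem exists_unitary_conjTranspose_mul_self [DecidableEq κ] (A : Matrix ι κ ℂ) :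
    ∃ (U : Matrix κ κ ℂ) (d : κ → ℝ), Uᴴ * U = 1 ∧ (∀ k, 0 ≤ d k) ∧
      Aᴴ * A = Uᴴ * (Matrix.diagonal fun k => (d k : ℂ)) * U := by
  have hps := Matrix.posSemidef_conjTranspose_mul_self A
  have hA := hps.isHermitian
  refine ⟨star (hA.eigenvectorUnitary : Matrix κ κ ℂ), hA.eigenvalues, ?_,
    hps.eigenvalues_nonneg, ?_⟩
  · rw [← Matrix.star_eq_conjTranspose, star_star]
    exact Unitary.mul_star_self_of_mem hA.eigenvectorUnitary.2
  · conv_lhs => rw [hA.spectral_theorem, Unitary.conjStarAlgAut_apply]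
    rw [← Matrix.star_eq_conjTranspose, star_star]
    rfl

theorem det_one_add_smul_conjTranspose_mul_self [DecidableEq κ] {A : Matrix ι κ ℂ}
    {U : Matrix κ κ ℂ} {d : κ → ℝ} (hU : Uᴴ * U = 1)
    (hA : Aᴴ * A = Uᴴ * (Matrix.diagonal fun k => (d k : ℂ)) * U) (c : ℝ) :
    (1 + c • (Aᴴ * A)).det = ((∏ k, (1 + c * d k) : ℝ) : ℂ) := by
  have h : 1 + c • (Aᴴ * A) = Uᴴ * (Matrix.diagonal fun k => ((1 + c * d k : ℝ) : ℂ)) * U := by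
    have : (Matrix.diagonal fun k => ((1 + c * d k : ℝ) : ℂ))
        = 1 + c • Matrix.diagonal fun k => (d k : ℂ) := by
      ext i j
      by_cases hij : i = j
      · subst hij; simp
      · simp [hij]
    rw [this, Matrix.mul_add, Matrix.add_mul, Matrix.mul_one, hU, hA, Matrix.mul_smul,
      Matrix.smul_mul]
  rw [h, Matrix.det_mul_comm, ← Matrix.mul_assoc, mul_eq_one_comm.1 hU, Matrix.one_mul,
    Matrix.det_diagonal]
  push_cast
  rfl

/-- With `x = ω d` and `θ = √ω`, these are the coefficient equations for `ω d |g|² + 2 ω √d Re (ḡ z)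
+ |α g + β z|² = |p g + q z|²`. They exhibit an indefinite form as a difference of two squares of
Gaussian variables with controlled variances. -/
theorem exists_unit_combination {x θ : ℝ} (hx : 0 ≤ x) (h0 : 0 ≤ θ) (h1 : θ ≤ 1) :
    ∃ α β p q : ℝ, α ^ 2 + β ^ 2 = 1 ∧ p ^ 2 + q ^ 2 = 1 + x ∧ x + α ^ 2 = p ^ 2 ∧
      β ^ 2 = q ^ 2 ∧ θ * √x + α * β = p * q := by
  have hc : ContinuousOn (fun β : ℝ => β * (√(x + 1 - β ^ 2) - √(1 - β ^ 2))) (Set.Icc 0 1) := by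
    fun_prop
  -- With `q = β`, `p = √(x + 1 - β²)` and `α = √(1 - β²)` only `β (p - α) = θ √x` remains. The left
  -- side runs from `0` to `√x` on `[0, 1]`, so `θ ≤ 1` gives a solution.
  obtain ⟨β, ⟨hβ0, hβ1⟩, hβ⟩ := intermediate_value_Icc zero_le_one hc
    (show θ * √x ∈ Set.Icc _ _ by
      constructor
      · simp only [zero_mul]; positivity
      · norm_num
        exact mul_le_of_le_one_left (Real.sqrt_nonneg x) h1)
  have hb : 0 ≤ 1 - β ^ 2 := by nlinarith
  have e1 := Real.sq_sqrt hb
  have e2 := Real.sq_sqrt (show 0 ≤ x + 1 - β ^ 2 by linarith)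
  refine ⟨√(1 - β ^ 2), β, √(x + 1 - β ^ 2), β, ?_, ?_, ?_, rfl, ?_⟩
  · rw [e1]; ring
  · rw [e2]; ring
  · rw [e1, e2]; ring
  · simp only at hβ
    rw [← hβ]; ring

theorem frob_eq_sum_normSq (X : ι → μ → ℂ) : frob X = ∑ i, ∑ l, ‖X i l‖ ^ 2 := rfl

/-- The diagonal case. -/
theorem measure_signal_diagonal_le [DecidableEq κ] [Nonempty κ] [Nonempty μ] {d : κ → ℝ}
    (hd : ∀ k, 0 ≤ d k) {ω : ℝ} (h0 : 0 ≤ ω) (h1 : ω ≤ 1) (c τ : ℝ) :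
    ((gaussianMatrix κ μ 1).prod (gaussianMatrix κ μ 1)) {p |
        ω * frob (mulCols (Matrix.diagonal fun k => ((√(d k) : ℝ) : ℂ)) p.1)
          + 2 * ω * reInner p.2 (mulCols (Matrix.diagonal fun k => ((√(d k) : ℝ) : ℂ)) p.1) < -τ}
      ≤ gaussianMatrix κ μ 1 {a | c < frob a}
        + ENNReal.ofReal (gammaRatio (Fintype.card κ * Fintype.card μ)
          ((c - τ) / (∏ k, (1 + ω * d k)) ^ (1 / (Fintype.card κ : ℝ)))) := by
  have hx : ∀ k, 0 ≤ ω * d k := fun k => mul_nonneg h0 (hd k)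
  choose α β p q hαβ hpq hp hq hc using fun k =>
    exists_unit_combination (hx k) (Real.sqrt_nonneg ω) (Real.sqrt_le_one.2 h1)
  let a : (κ → μ → ℂ) × (κ → μ → ℂ) → κ → μ → ℂ := fun y k l =>
    (α k : ℂ) * y.1 k l + β k * y.2 k l
  have hs : ∀ k, 0 < √(1 + ω * d k) := fun k => Real.sqrt_pos.2 (by linarith [hx k])
  have hs2 : ∀ k, √(1 + ω * d k) ^ 2 = 1 + ω * d k := fun k => Real.sq_sqrt (by linarith [hx k])
  let b : (κ → μ → ℂ) × (κ → μ → ℂ) → κ → μ → ℂ := fun y k l =>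
    ((p k / √(1 + ω * d k) : ℝ) : ℂ) * y.1 k l + ((q k / √(1 + ω * d k) : ℝ) : ℂ) * y.2 k l
  have ha : MeasurePreserving a ((gaussianMatrix κ μ 1).prod (gaussianMatrix κ μ 1))
      (gaussianMatrix κ μ 1) := measurePreserving_gaussianMatrix_map₂
        (fun k y => (α k : ℂ) * y.1 + β k * y.2) fun k => measurePreserving_unit_combination (hαβ k)
  have hb : MeasurePreserving b ((gaussianMatrix κ μ 1).prod (gaussianMatrix κ μ 1))
      (gaussianMatrix κ μ 1) := measurePreserving_gaussianMatrix_map₂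
        (fun k y => ((p k / √(1 + ω * d k) : ℝ) : ℂ) * y.1 + ((q k / √(1 + ω * d k) : ℝ) : ℂ) * y.2)
        fun k => measurePreserving_unit_combination (by
          rw [div_pow, div_pow, ← add_div, hpq, hs2, div_self (by linarith [hx k])])
  let B : Matrix κ κ ℂ := Matrix.diagonal fun k => ((√(1 + ω * d k) : ℝ) : ℂ)
  let D : Matrix κ κ ℂ := Matrix.diagonal fun k => ((√(d k) : ℝ) : ℂ)
  have hdiag : ∀ (v : κ → ℂ) (X : κ → μ → ℂ) k l, mulCols (Matrix.diagonal v) X k l = v k * X k l :=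
    fun v X k l => Matrix.mulVec_diagonal _ _ _
  -- The scalar identity summed over entries: signal plus cross term plus `frob a` is the energy of
  -- `B b`, where `a` and `b` are each standard Gaussian.
  have hid : ∀ y : (κ → μ → ℂ) × (κ → μ → ℂ), ω * frob (mulCols D y.1)
      + 2 * ω * reInner y.2 (mulCols D y.1) + frob (a y) = frob (mulCols B (b y)) := by
    intro y
    simp only [frob_eq_sum_normSq, reInner, dotProduct, Complex.re_sum, Finset.mul_sum,
      ← Finset.sum_add_distrib]
    refine Finset.sum_congr rfl fun k _ => Finset.sum_congr rfl fun l _ => ?_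
    simp only [D, B, hdiag, a, b, Pi.star_apply]
    have e1 := Real.sq_sqrt (hd k)
    have e2 : √ω * √(ω * d k) = ω * √(d k) := by
      rw [Real.sqrt_mul h0, ← mul_assoc, Real.mul_self_sqrt h0]
    have e3 := hc k
    rw [e2] at e3
    have e4 : ((√(1 + ω * d k) : ℝ) : ℂ) * (((p k / √(1 + ω * d k) : ℝ) : ℂ) * y.1 k l
        + ((q k / √(1 + ω * d k) : ℝ) : ℂ) * y.2 k l) = (p k : ℂ) * y.1 k l + q k * y.2 k l := by
      have : ((√(1 + ω * d k) : ℝ) : ℂ) ≠ 0 := by exact_mod_cast (hs k).ne'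
      push_cast
      field_simp
    rw [e4]
    simp only [Complex.sq_norm, Complex.normSq_apply, Complex.add_re, Complex.add_im,
      Complex.mul_re, Complex.mul_im, Complex.star_def, Complex.conj_re, Complex.conj_im,
      Complex.ofReal_re, Complex.ofReal_im, zero_mul, sub_zero, add_zero]
    generalize y.1 k l = g
    generalize y.2 k l = z
    linear_combination (ω * (g.re ^ 2 + g.im ^ 2)) * e1 + (g.re ^ 2 + g.im ^ 2) * hp k
      + (z.re ^ 2 + z.im ^ 2) * hq k + 2 * (g.re * z.re + g.im * z.im) * e3
  have hB : B.det ≠ 0 := by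
    rw [Matrix.det_diagonal, Finset.prod_ne_zero_iff]
    intro k _
    exact_mod_cast (hs k).ne'
  have hBd : ‖B.det‖ ^ 2 = ∏ k, (1 + ω * d k) := by
    rw [Matrix.det_diagonal, norm_prod, ← Finset.prod_pow]
    refine Finset.prod_congr rfl fun k _ => ?_
    rw [Complex.norm_real, Real.norm_eq_abs, sq_abs, hs2]
  -- The matrices `a` and `b` are dependent, but after this inclusion a union bound uses only their
  -- marginal laws.
  have hsub : {y : (κ → μ → ℂ) × (κ → μ → ℂ) |
      ω * frob (mulCols D y.1) + 2 * ω * reInner y.2 (mulCols D y.1) < -τ}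
      ⊆ a ⁻¹' {x | c < frob x} ∪ b ⁻¹' {x | frob (mulCols B x) ≤ c - τ} := by
    intro y hy
    have hy' : ω * frob (mulCols D y.1) + 2 * ω * reInner y.2 (mulCols D y.1) < -τ := hy
    by_cases h : c < frob (a y)
    · exact Or.inl h
    · refine Or.inr ?_
      change frob (mulCols B (b y)) ≤ c - τ
      rw [← hid]
      linarith
  refine (measure_mono hsub).trans ((measure_union_le _ _).trans (add_le_add ?_ ?_))
  · rw [ha.measure_preimage (measurableSet_lt measurable_const measurable_frob).nullMeasurableSet]
  · have hset : MeasurableSet {x : κ → μ → ℂ | frob (mulCols B x) ≤ c - τ} :=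
      measurableSet_le (measurable_frob.comp (measurable_mulCols B)) measurable_const
    rw [hb.measure_preimage hset.nullMeasurableSet, ← hBd]
    exact gaussianMatrix_frob_mulCols_le hB _

/-- The probability depends on `A` only through `Aᴴ A`. Rotating the fading by a unitary
diagonalises it, and the noise is traded for one with as many rows as there are columns in `A`. -/
theorem measure_signal_le [Nonempty κ] [Nonempty μ] [DecidableEq κ] (A : Matrix ι κ ℂ)
    {ω : ℝ} (h0 : 0 ≤ ω) (h1 : ω ≤ 1) (c τ : ℝ) :
    ((gaussianMatrix κ μ 1).prod (gaussianMatrix ι μ 1)) {p |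
        ω * frob (mulCols A p.1) + 2 * ω * reInner p.2 (mulCols A p.1) < -τ}
      ≤ gaussianMatrix κ μ 1 {a | c < frob a}
        + ENNReal.ofReal (gammaRatio (Fintype.card κ * Fintype.card μ)
          ((c - τ) / (1 + ω • (Aᴴ * A)).det.re ^ (1 / (Fintype.card κ : ℝ)))) := by
  obtain ⟨U, d, hU, hd, hA⟩ := exists_unitary_conjTranspose_mul_self A
  rw [det_one_add_smul_conjTranspose_mul_self hU hA, Complex.ofReal_re,
    measure_signal_lt_of_frob_eq A (Matrix.diagonal fun k => ((√(d k) : ℝ) : ℂ))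
      (measurePreserving_mulCols_of_unitary hU)]
  · exact measure_signal_diagonal_le hd h0 h1 c τ
  · intro H
    rw [frob_eq_sum_columns, frob_eq_sum_columns (mulCols (Matrix.diagonal _) _)]
    refine Finset.sum_congr rfl fun l _ => ?_
    change sqn (A *ᵥ fun k => H k l)
      = sqn ((Matrix.diagonal fun k => ((√(d k) : ℝ) : ℂ)) *ᵥ (U *ᵥ fun k => H k l))
    rw [Matrix.mulVec_mulVec, sqn_mulVec, sqn_mulVec, hA]
    have hD : (Matrix.diagonal fun k => (d k : ℂ))
        = (Matrix.diagonal fun k => ((√(d k) : ℝ) : ℂ))ᴴ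
          * Matrix.diagonal fun k => ((√(d k) : ℝ) : ℂ) := by
      rw [Matrix.diagonal_conjTranspose, Matrix.diagonal_mul_diagonal]
      congr 1
      ext k
      simp only [Pi.star_apply, Complex.star_def, Complex.conj_ofReal]
      rw [← Complex.ofReal_mul, Real.mul_self_sqrt (hd k)]
    rw [Matrix.conjTranspose_mul, hD]
    simp only [Matrix.mul_assoc]

/-- The noise is unlikely to carry much more energy than `ω` times the residual of a hypothesis that
misses the users in `κ`. -/
theorem measure_noise_gt_le [Nonempty κ] [Nonempty μ] [DecidableEq κ] (A : Matrix ι κ ℂ)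
    {ω : ℝ} (h0 : 0 ≤ ω) (h1 : ω ≤ 1) (b c₁ c₂ : ℝ) :
    ((gaussianMatrix κ μ 1).prod (gaussianMatrix ι μ 1)) {p |
        ω * frob (p.2 + mulCols A p.1) + b < frob p.2}
      ≤ gaussianMatrix ι μ 1 {z | c₁ < frob z} + (gaussianMatrix κ μ 1 {a | c₂ < frob a}
        + ENNReal.ofReal (gammaRatio (Fintype.card κ * Fintype.card μ)
          ((c₂ - b + (1 - ω) * c₁) / (1 + ω • (Aᴴ * A)).det.re ^ (1 / (Fintype.card κ : ℝ))))) := by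
  -- Expanding the residual leaves `(1 - ω) frob Z` on the right, which is at most `(1 - ω) c₁`
  -- unless the noise is exceptionally large.
  have hsub : {p : (κ → μ → ℂ) × (ι → μ → ℂ) | ω * frob (p.2 + mulCols A p.1) + b < frob p.2}
      ⊆ Prod.snd ⁻¹' {z | c₁ < frob z} ∪ {p | ω * frob (mulCols A p.1)
        + 2 * ω * reInner p.2 (mulCols A p.1) < -(b - (1 - ω) * c₁)} := by
    intro p hp
    have hp' : ω * frob (p.2 + mulCols A p.1) + b < frob p.2 := hp
    by_cases h : c₁ < frob p.2
    · exact Or.inl h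
    · refine Or.inr ?_
      rw [frob_add] at hp'
      change _ < -(b - (1 - ω) * c₁)
      have := mul_le_mul_of_nonneg_left (not_lt.1 h) (sub_nonneg.2 h1)
      nlinarith
  refine (measure_mono hsub).trans ((measure_union_le _ _).trans (add_le_add ?_ ?_))
  · rw [measurePreserving_snd.measure_preimage
      (measurableSet_lt measurable_const measurable_frob).nullMeasurableSet]
  · refine (measure_signal_le A h0 h1 c₂ _).trans (le_of_eq ?_)
    congr 4
    ring

end NoiseEnergy

/-! ## Random codebooks: symmetry and the two region bounds -/

section Selection

variable {n M K : ℕ}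

/-- The matrix of the codewords sent by the users of `S`, with zero columns for the others. -/
abbrev active (c : Fin n → Fin K × Fin M → ℂ) (S : Finset (Fin K)) (w : Fin K → Fin M) :
    Matrix (Fin n) (Fin K) ℂ := Matrix.of c * selection S w

theorem active_apply (c : Fin n → Fin K × Fin M → ℂ) (S : Finset (Fin K)) (w : Fin K → Fin M)
    (i : Fin n) (k : Fin K) : active c S w i k = if k ∈ S then c i (k, w k) else 0 := by
  simp only [active, Matrix.mul_apply, selection, Matrix.of_apply, mul_ite, mul_one, mul_zero]
  split_ifs with h
  · rw [Finset.sum_eq_single (k, w k)]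
    · simp [h]
    · rintro ⟨k', m⟩ - hne
      rw [if_neg]
      rintro ⟨h1, -, h2⟩
      exact hne (Prod.ext h1 h2)
    · simp
  · exact Finset.sum_eq_zero fun p _ => if_neg fun hp => h hp.2.1

theorem continuous_active (S : Finset (Fin K)) (w : Fin K → Fin M) :
    Continuous fun c : Fin n → Fin K × Fin M → ℂ => active c S w := by
  refine continuous_matrix fun i k => ?_
  simp_rw [active_apply]
  split_ifs <;> fun_prop

theorem exists_perm_map_pair {α : Type*} [Finite α] {a a' b b' : α} (ha : a ≠ a') (hb : b ≠ b') :
    ∃ σ : Equiv.Perm α, σ a = b ∧ σ a' = b' := by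
  obtain ⟨σ, hσ⟩ := Equiv.Perm.exists_extending_pair ![a, a'] ![b, b']
    (by intro i j; fin_cases i <;> fin_cases j <;> simp [ha, ha.symm])
    (by intro i j; fin_cases i <;> fin_cases j <;> simp [hb, hb.symm])
  exact ⟨σ, by simpa using hσ 0, by simpa using hσ 1⟩

theorem exists_perm_mem_iff {S S' : Finset (Fin K)} (h : S.card = S'.card) :
    ∃ τ : Equiv.Perm (Fin K), ∀ k, τ k ∈ S' ↔ k ∈ S := by
  let e : {x // x ∈ S} ≃ {x // x ∈ S'} := Finset.equivOfCardEq h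
  refine ⟨e.extendSubtype, fun k => ?_⟩
  by_cases hk : k ∈ S
  · exact iff_of_true (e.extendSubtype_mem k hk) hk
  · exact iff_of_false (e.extendSubtype_not_mem k hk) hk

/-- The law of the two selected matrices is, up to a relabelling of the users, the same for all
sets of users and all pairs of messages that differ on them. -/
theorem lintegral_active_symmetric (P' : ℝ) {S S' : Finset (Fin K)} (hS : S.card = S'.card)
    {w w' W W' : Fin K → Fin M} (hw : ∀ k, w' k ≠ w k) (hW : ∀ k ∈ S', W' k ≠ W k)
    {F : Matrix (Fin n) (Fin K) ℂ → Matrix (Fin n) (Fin K) ℂ → ℝ≥0∞}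
    (hF : ∀ (A₁ A₂ : Matrix (Fin n) (Fin K) ℂ) (τ : Equiv.Perm (Fin K)),
      F (A₁.submatrix id τ) (A₂.submatrix id τ) = F A₁ A₂)
    (hm : Measurable fun c : Fin n → Fin K × Fin M → ℂ => F (active c S w) (active c S w')) :
    ∫⁻ c, F (active c S' W) (active c S' W') ∂(gaussianMatrix (Fin n) (Fin K × Fin M) P')
      = ∫⁻ c, F (active c S w) (active c S w') ∂(gaussianMatrix (Fin n) (Fin K × Fin M) P') := by
  obtain ⟨τ, hτ⟩ := exists_perm_mem_iff hS
  have hσ : ∀ k, ∃ σ : Equiv.Perm (Fin M),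
      k ∈ S → σ (w k) = W (τ k) ∧ σ (w' k) = W' (τ k) := by
    intro k
    by_cases hk : k ∈ S
    · obtain ⟨σ, h1, h2⟩ := exists_perm_map_pair (hw k).symm (hW (τ k) ((hτ k).2 hk)).symm
      exact ⟨σ, fun _ => ⟨h1, h2⟩⟩
    · exact ⟨1, fun h => absurd h hk⟩
  choose σ hσ using hσ
  -- Users are permuted by `τ` and the messages of each user by its own `σ k`. Reindexing an i.i.d.
  -- codebook by an injection does not change its law.
  let e : Fin K × Fin M → Fin K × Fin M := fun p => (τ p.1, σ p.1 p.2)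
  have he : Function.Injective e := by
    rintro ⟨k, m⟩ ⟨k', m'⟩ h
    obtain ⟨h1, h2⟩ := Prod.mk.inj h
    obtain rfl : k = k' := τ.injective h1
    exact Prod.ext rfl ((σ k).injective h2)
  have hmp : MeasurePreserving (fun (c : Fin n → Fin K × Fin M → ℂ) i p => c i (e p))
      (gaussianMatrix (Fin n) (Fin K × Fin M) P') (gaussianMatrix (Fin n) (Fin K × Fin M) P') :=
    measurePreserving_pi _ _ fun _ =>
      measurePreserving_comp_injective (fun _ => complexGaussian P') e he
  rw [← hmp.lintegral_comp hm]
  refine lintegral_congr fun c => ?_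
  have h1 : active (fun i p => c i (e p)) S w = (active c S' W).submatrix id τ := by
    ext i k
    rw [Matrix.submatrix_apply, active_apply, active_apply]
    simp only [hτ, id]
    split_ifs with hk
    · rw [← (hσ k hk).1]
    · rfl
  have h2 : active (fun i p => c i (e p)) S w' = (active c S' W').submatrix id τ := by
    ext i k
    rw [Matrix.submatrix_apply, active_apply, active_apply]
    simp only [hτ, id]
    split_ifs with hk
    · rw [← (hσ k hk).2]
    · rfl
  rw [h1, h2, hF]

theorem lintegral_active_symmetric_left (P' : ℝ) {S S' : Finset (Fin K)} (hS : S.card = S'.card)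
    {w w' : Fin K → Fin M} (hw : ∀ k, w' k ≠ w k) (W : Fin K → Fin M)
    {F : Matrix (Fin n) (Fin K) ℂ → ℝ≥0∞}
    (hF : ∀ (A : Matrix (Fin n) (Fin K) ℂ) (τ : Equiv.Perm (Fin K)), F (A.submatrix id τ) = F A)
    (hm : Measurable fun c : Fin n → Fin K × Fin M → ℂ => F (active c S w)) :
    ∫⁻ c, F (active c S' W) ∂(gaussianMatrix (Fin n) (Fin K × Fin M) P')
      = ∫⁻ c, F (active c S w) ∂(gaussianMatrix (Fin n) (Fin K × Fin M) P') := by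
  -- A second message vector has to be supplied although `F` ignores it; swapping `w k` with `W k`
  -- in `w'` gives one that differs from `W` everywhere.
  refine lintegral_active_symmetric P' hS hw
    (W' := fun k => Equiv.swap (w k) (W k) (w' k)) (fun k _ h => hw k ?_)
    (F := fun A _ => F A) (fun A _ τ => hF A τ) hm
  exact (Equiv.swap (w k) (W k)).injective (h.trans (Equiv.swap_apply_left _ _).symm)

theorem gramDet_submatrix (c : ℝ) (A : Matrix (Fin n) (Fin K) ℂ) (τ : Equiv.Perm (Fin K)) :
    gramDet c (A.submatrix id τ) = gramDet c A := by
  unfold gramDet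
  rw [Matrix.conjTranspose_submatrix, Matrix.submatrix_mul_equiv, Matrix.submatrix_id_id]

theorem one_add_Btilde_submatrix (A₁ A₂ : Matrix (Fin n) (Fin K) ℂ) (τ : Equiv.Perm (Fin K))
    (ω u r : ℝ) : Btilde (A₁.submatrix id τ) (A₂.submatrix id τ) ω u r
      = (Btilde A₁ A₂ ω u r).submatrix τ τ := by
  ext i j
  simp [Btilde, Matrix.mul_apply]

/-- Relabelling users conjugates `B̃` by a permutation, which preserves both the eigenvalue
constraint and the determinant. -/
theorem chernoffMin_submatrix (L : ℕ) (A₁ A₂ : Matrix (Fin n) (Fin K) ℂ) (τ : Equiv.Perm (Fin K))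
    (ω ν : ℝ) : chernoffMin L (A₁.submatrix id τ) (A₂.submatrix id τ) ω ν
      = chernoffMin L A₁ A₂ ω ν := by
  have hsub : ∀ u r, 1 + (Btilde A₁ A₂ ω u r).submatrix τ τ
      = (1 + Btilde A₁ A₂ ω u r).submatrix τ τ := by
    intro u r
    rw [Matrix.submatrix_add, Pi.add_apply, Pi.add_apply, Matrix.submatrix_one_equiv]
  unfold chernoffMin
  congr 1
  ext x
  refine exists_congr fun u => exists_congr fun r => and_congr_right fun _ =>
    and_congr_right fun _ => and_congr_right fun _ => and_congr ?_ ?_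
  · rw [← posDef_one_add_iff_spectrum (isHermitian_Btilde _ _ _ _ _),
      ← posDef_one_add_iff_spectrum (isHermitian_Btilde _ _ _ _ _), one_add_Btilde_submatrix, hsub]
    exact ⟨fun h => by simpa using h.submatrix τ.symm.injective, fun h => h.submatrix τ.injective⟩
  · rw [one_add_Btilde_submatrix, hsub, Matrix.det_submatrix_equiv_self]

theorem lintegral_ofReal_of_mem_Icc {X : Type*} [MeasurableSpace X] {μ : Measure X}
    [IsProbabilityMeasure μ] {f : X → ℝ} (hf : Measurable f) (h0 : ∀ x, 0 ≤ f x)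
    (h1 : ∀ x, f x ≤ 1) : ∫⁻ x, ENNReal.ofReal (f x) ∂μ = ENNReal.ofReal (∫ x, f x ∂μ) := by
  rw [ofReal_integral_eq_lintegral_ofReal _ (Filter.Eventually.of_forall h0)]
  refine Integrable.of_bound hf.aestronglyMeasurable 1 (Filter.Eventually.of_forall fun x => ?_)
  rw [Real.norm_eq_abs, abs_of_nonneg (h0 x)]
  exact h1 x

/-- The joint law of the fading and the noise. -/
noncomputable abbrev fadingNoise (n K L : ℕ) : Measure ((Fin K → Fin L → ℂ) × (Fin n → Fin L → ℂ)) :=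
  (gaussianMatrix (Fin K) (Fin L) 1).prod (gaussianMatrix (Fin n) (Fin L) 1)

/-- The messages that differ from `W` exactly for the users in `S`. -/
def rivals (S : Finset (Fin K)) (W : Fin K → Fin M) : Finset (Fin K → Fin M) :=
  Fintype.piFinset fun k => if k ∈ S then Finset.univ.erase (W k) else {W k}

theorem card_rivals (S : Finset (Fin K)) (W : Fin K → Fin M) :
    (rivals S W).card = (M - 1) ^ S.card := by
  rw [rivals, Fintype.card_piFinset]
  have : ∀ k, (if k ∈ S then Finset.univ.erase (W k) else {W k}).card
      = if k ∈ S then M - 1 else 1 := by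
    intro k
    split_ifs <;> simp [Finset.card_erase_of_mem]
  simp_rw [this]
  rw [Finset.prod_ite_mem, Finset.univ_inter, Finset.prod_const]

theorem mem_rivals {S : Finset (Fin K)} {W W' : Fin K → Fin M} :
    W' ∈ rivals S W ↔ (∀ k ∈ S, W' k ≠ W k) ∧ ∀ k ∉ S, W' k = W k := by
  simp only [rivals, Fintype.mem_piFinset]
  constructor
  · intro h
    refine ⟨fun k hk => ?_, fun k hk => ?_⟩ <;> simpa [hk] using h k
  · rintro ⟨h1, h2⟩ k
    by_cases hk : k ∈ S
    · simpa [hk] using h1 k hk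
    · simpa [hk] using h2 k hk

/-- Union bound over the `K.choose t` error sets and the `(M - 1) ^ t` rivals of each; by symmetry
of the codebook all terms have the same mean, which may be evaluated at the reference data `S, w,
w'`. -/
theorem lintegral_goodErrorEvent_le (L : ℕ) {t : ℕ} {P' ω : ℝ} (ν : ℝ) (hω : ω ≤ 1)
    {S : Finset (Fin K)} (hS : S.card = t) {w w' : Fin K → Fin M} (hw : ∀ k, w' k ≠ w k)
    (hM : 0 < M) (W : Fin K → Fin M) :
    ∫⁻ c, fadingNoise n K L (⋃ S' ∈ Finset.powersetCard t Finset.univ, ⋃ W' ∈ rivals S' W,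
        goodErrorEvent L (active c S' W) (active c S' W') ω ν)
        ∂(gaussianMatrix (Fin n) (Fin K × Fin M) P')
      ≤ ENNReal.ofReal (q1 n L t P' S w w' ω ν) := by
  have hmeas : ∀ (S : Finset (Fin K)) (w w' : Fin K → Fin M),
      Measurable fun c : Fin n → Fin K × Fin M → ℂ =>
        chernoffMin L (active c S w) (active c S w') ω ν := fun S w w' =>
    measurable_chernoffMin L (continuous_active S w) (continuous_active S w') ω ν
  calc _ ≤ ∫⁻ c, ∑ S' ∈ Finset.powersetCard t Finset.univ, ∑ W' ∈ rivals S' W,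
        ENNReal.ofReal (chernoffMin L (active c S' W) (active c S' W') ω ν)
        ∂(gaussianMatrix (Fin n) (Fin K × Fin M) P') := by
        refine lintegral_mono fun c => ?_
        refine (measure_biUnion_finset_le _ _).trans (Finset.sum_le_sum fun S' _ => ?_)
        refine (measure_biUnion_finset_le _ _).trans (Finset.sum_le_sum fun W' _ => ?_)
        exact measure_goodErrorEvent_le_chernoffMin L _ _ ν hω
    _ = ∑ S' ∈ Finset.powersetCard t (Finset.univ : Finset (Fin K)), ∑ W' ∈ rivals S' W,
        ENNReal.ofReal (∫ c, chernoffMin L (active c S w) (active c S w') ω ν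
          ∂(gaussianMatrix (Fin n) (Fin K × Fin M) P')) := by
        rw [lintegral_finsetSum _ fun S' _ => Finset.measurable_sum _ fun W' _ =>
          (hmeas S' W W').ennreal_ofReal]
        refine Finset.sum_congr rfl fun S' hS' => ?_
        rw [lintegral_finsetSum _ fun W' _ => (hmeas S' W W').ennreal_ofReal]
        refine Finset.sum_congr rfl fun W' hW' => ?_
        rw [← lintegral_ofReal_of_mem_Icc (hmeas S w w') (fun _ => chernoffMin_nonneg _ _ _ _ _)
          fun _ => chernoffMin_le_one _ _ _ _ _]
        exact lintegral_active_symmetric P' (hS.trans (Finset.mem_powersetCard.1 hS').2.symm) hw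
          (mem_rivals.1 hW').1 (F := fun A₁ A₂ => ENNReal.ofReal (chernoffMin L A₁ A₂ ω ν))
          (fun A₁ A₂ τ => by rw [chernoffMin_submatrix]) (hmeas S w w').ennreal_ofReal
    _ = _ := by
        have : ∀ S' ∈ Finset.powersetCard t (Finset.univ : Finset (Fin K)),
            ∑ W' ∈ rivals S' W, ENNReal.ofReal
              (∫ c, chernoffMin L (active c S w) (active c S w') ω ν
                ∂(gaussianMatrix (Fin n) (Fin K × Fin M) P'))
            = ENNReal.ofReal (((M : ℝ) - 1) ^ t *
              ∫ c, chernoffMin L (active c S w) (active c S w') ω ν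
                ∂(gaussianMatrix (Fin n) (Fin K × Fin M) P')) := by
          intro S' hS'
          rw [Finset.sum_const, card_rivals, (Finset.mem_powersetCard.1 hS').2, nsmul_eq_mul,
            ENNReal.ofReal_mul (pow_nonneg (sub_nonneg.2 (by exact_mod_cast hM)) _),
            ← Nat.cast_pred hM, ← Nat.cast_pow, ENNReal.ofReal_natCast]
        rw [Finset.sum_congr rfl this, Finset.sum_const, Finset.card_powersetCard,
          Finset.card_univ, Fintype.card_fin, nsmul_eq_mul, q1, mul_assoc,
          ENNReal.ofReal_mul (Nat.cast_nonneg _), ENNReal.ofReal_natCast]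

end Selection

/-! ### Excess noise energy, averaged over the codebook -/

section NoiseRegion

theorem gaussianMatrix_lt_frob {ι κ : Type} [Fintype ι] [Fintype κ] [Nonempty ι] [Nonempty κ]
    (c : ℝ) : gaussianMatrix ι κ 1 {z | c < frob z}
      = ENNReal.ofReal (1 - gammaRatio (Fintype.card ι * Fintype.card κ) c) := by
  have hs : MeasurableSet {z : ι → κ → ℂ | frob z ≤ c} :=
    measurableSet_le measurable_frob measurable_const
  have : {z : ι → κ → ℂ | c < frob z} = {z | frob z ≤ c}ᶜ := by
    ext z
    simp
  rw [← gaussianMatrix_real_frob_le, this, ← probReal_compl_eq_one_sub hs, ofReal_measureReal]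

/-- Discarding the zero columns reduces the fading to `t` users; it is this dimension that becomes
the order `t L` of the gamma ratio. -/
theorem mulCols_eq_of_support {ι κ μ : Type*} [Fintype κ] {A : Matrix ι κ ℂ}
    {S : Finset κ} (hA : ∀ i, ∀ k ∉ S, A i k = 0) (H : κ → μ → ℂ) :
    mulCols A H = mulCols (A.submatrix id ((↑) : S → κ)) fun k => H k := by
  ext i l
  simp only [mulCols, Matrix.mulVec, dotProduct, Matrix.submatrix_apply, id]
  rw [Finset.sum_coe_sort S fun k => A i k * H k l]
  exact (Finset.sum_subset (Finset.subset_univ _) fun k _ hk => by rw [hA i k hk, zero_mul]).symm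

theorem mul_conjTranspose_eq_of_support {ι κ : Type*} [Fintype κ] {A : Matrix ι κ ℂ}
    {S : Finset κ} (hA : ∀ i, ∀ k ∉ S, A i k = 0) :
    A * Aᴴ = A.submatrix id ((↑) : S → κ) * (A.submatrix id ((↑) : S → κ))ᴴ := by
  ext i j
  simp only [Matrix.mul_apply, Matrix.submatrix_apply, id, Matrix.conjTranspose_apply]
  rw [Finset.sum_coe_sort S fun k => A i k * star (A j k)]
  exact (Finset.sum_subset (Finset.subset_univ _) fun k _ hk => by rw [hA i k hk, zero_mul]).symm

theorem measurePreserving_restrict_fading (n K L : ℕ) (S : Finset (Fin K)) :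
    MeasurePreserving (fun p : (Fin K → Fin L → ℂ) × (Fin n → Fin L → ℂ) =>
        ((fun k : S => p.1 k), p.2)) (fadingNoise n K L)
      ((gaussianMatrix S (Fin L) 1).prod (gaussianMatrix (Fin n) (Fin L) 1)) := by
  have h : MeasurePreserving (fun (H : Fin K → Fin L → ℂ) (k : S) => H k)
      (gaussianMatrix (Fin K) (Fin L) 1) (gaussianMatrix S (Fin L) 1) :=
    measurePreserving_comp_injective (fun _ => gaussianVec (Fin L) 1) ((↑) : S → Fin K)
      Subtype.val_injective
  exact h.prod (MeasurePreserving.id _)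

variable {n M K L : ℕ}

/-- The event that the noise carries too much energy, compared with the residual of a hypothesis. -/
def noiseEvent (L : ℕ) (A : Matrix (Fin n) (Fin K) ℂ) (ω ν : ℝ) :
    Set ((Fin K → Fin L → ℂ) × (Fin n → Fin L → ℂ)) :=
  {p | ω * frob (p.2 + mulCols A p.1) + n * L * ν < frob p.2}

theorem measure_noiseEvent_le_of_support (hn : 0 < n) (hL : 0 < L) {t : ℕ} (ht : 0 < t)
    {A : Matrix (Fin n) (Fin K) ℂ} {S : Finset (Fin K)} (hS : S.card = t)
    (hA : ∀ i, ∀ k ∉ S, A i k = 0) {ω : ℝ} (h0 : 0 ≤ ω) (h1 : ω ≤ 1) (ν η δ : ℝ) :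
    fadingNoise n K L (noiseEvent L A ω ν)
      ≤ ENNReal.ofReal (gammaRatio (t * L) (L * ((t * (1 + η) - n * ν + n * (1 + δ) * (1 - ω)) *
          gramDet ω A ^ (-(1 / t : ℝ)))))
        + ENNReal.ofReal (2 - gammaRatio (t * L) (t * L * (1 + η))
            - gammaRatio (n * L) (n * L * (1 + δ))) := by
  have : Nonempty (Fin n) := ⟨⟨0, hn⟩⟩
  have : Nonempty (Fin L) := ⟨⟨0, hL⟩⟩
  have : Nonempty S := (Finset.card_pos.1 (hS ▸ ht)).to_subtype
  have hle : ∀ {N : ℕ}, 0 < N → ∀ a, 0 ≤ 1 - gammaRatio N a := fun hN a =>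
    sub_nonneg.2 (gammaRatio_le_one hN a)
  have hn1 := hle (Nat.mul_pos hn hL) (n * L * (1 + δ))
  have ht1 := hle (Nat.mul_pos ht hL) (t * L * (1 + η))
  rw [Nat.cast_mul] at hn1 ht1
  set A' := A.submatrix id ((↑) : S → Fin K)
  have hs : MeasurableSet {p : (S → Fin L → ℂ) × (Fin n → Fin L → ℂ) |
      ω * frob (p.2 + mulCols A' p.1) + n * L * ν < frob p.2} :=
    measurableSet_lt (((measurable_frob_add_mulCols _).const_mul ω).add_const _)
      (measurable_frob.comp measurable_snd)
  have hpre := (measurePreserving_restrict_fading n K L S).measure_preimage hs.nullMeasurableSet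
  have hset : noiseEvent L A ω ν = (fun p : (Fin K → Fin L → ℂ) × (Fin n → Fin L → ℂ) =>
        ((fun k : S => p.1 k), p.2)) ⁻¹' {p : (S → Fin L → ℂ) × (Fin n → Fin L → ℂ) |
      ω * frob (p.2 + mulCols A' p.1) + n * L * ν < frob p.2} := by
    ext p
    simp only [noiseEvent, Set.mem_ofPred_eq, Set.mem_preimage, mulCols_eq_of_support hA, A']
  have hgram : gramDet ω A = (1 + ω • (A'ᴴ * A')).det.re := by
    have := det_one_add_smul_mul_comm ω A'
    rw [gramDet, mul_conjTranspose_eq_of_support hA]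
    rw [this]
  have hpos : 0 < gramDet ω A := det_re_pos_of_posDef (posDef_one_add_smul_mul_conjTranspose h0 A)
  rw [hset, hpre]
  -- The thresholds are the mean energies `n L` of the noise and `t L` of a `t × L` Gaussian matrix,
  -- inflated by `1 + δ` and `1 + η`.
  refine (measure_noise_gt_le A' h0 h1 (n * L * ν) (n * L * (1 + δ)) (t * L * (1 + η))).trans ?_
  rw [gaussianMatrix_lt_frob, gaussianMatrix_lt_frob, Fintype.card_coe, hS, Fintype.card_fin,
    Fintype.card_fin, ← hgram, ← add_assoc, ← ENNReal.ofReal_add hn1 ht1, add_comm]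
  refine le_of_eq (congrArg₂ _ (congrArg ENNReal.ofReal (congrArg _ ?_))
    (congrArg ENNReal.ofReal (by ring)))
  rw [Real.rpow_neg hpos.le, div_eq_mul_inv]
  ring

theorem measure_frob_active_le (hn : 0 < n) (hL : 0 < L) (A : Matrix (Fin n) (Fin K) ℂ) {ω : ℝ}
    (h0 : 0 < ω) (ν η : ℝ) :
    fadingNoise n K L {p | ω * frob (p.2 + mulCols A p.1) ≤ n * L * (1 + η - ν)}
      ≤ ENNReal.ofReal (gammaRatio (n * L)
        (n * L * (1 + η - ν) / (ω * gramDet 1 A ^ (1 / n : ℝ)))) := by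
  have : Nonempty (Fin n) := ⟨⟨0, hn⟩⟩
  have : Nonempty (Fin L) := ⟨⟨0, hL⟩⟩
  have hset : {p : (Fin K → Fin L → ℂ) × (Fin n → Fin L → ℂ) |
      ω * frob (p.2 + mulCols A p.1) ≤ n * L * (1 + η - ν)}
      = {p | frob (p.2 + mulCols A p.1) ≤ n * L * (1 + η - ν) / ω} := by
    ext p
    simp only [Set.mem_ofPred_eq]
    rw [le_div_iff₀' h0]
  rw [hset]
  refine (measure_frob_add_mulCols_le A _).trans (le_of_eq ?_)
  rw [Fintype.card_fin, Fintype.card_fin, gramDet, one_smul, div_div]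

theorem measurable_gammaRatio_comp {X : Type*} [MeasurableSpace X] {N : ℕ} (hN : 0 < N) {f : X → ℝ}
    (hf : Measurable f) : Measurable fun x => gammaRatio N (f x) :=
  (gammaRatio_mono hN).measurable.comp hf

theorem measurable_gramDet_active (c : ℝ) (S : Finset (Fin K)) (w : Fin K → Fin M) :
    Measurable fun A : Fin n → Fin K × Fin M → ℂ => gramDet c (active A S w) := by
  have h := continuous_active (n := n) S w
  have h2 : Continuous fun A : Fin n → Fin K × Fin M → ℂ =>
      1 + c • (active A S w * (active A S w)ᴴ) :=
    continuous_const.add ((h.matrix_mul h.matrix_conjTranspose).const_smul c)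
  exact (Complex.continuous_re.comp h2.matrix_det).measurable

theorem sum_lintegral_active (P' : ℝ) {t : ℕ} {S : Finset (Fin K)} (hS : S.card = t)
    {w w' : Fin K → Fin M} (hw : ∀ k, w' k ≠ w k) (W : Fin K → Fin M)
    {F : Matrix (Fin n) (Fin K) ℂ → ℝ≥0∞}
    (hF : ∀ (A : Matrix (Fin n) (Fin K) ℂ) (τ : Equiv.Perm (Fin K)), F (A.submatrix id τ) = F A)
    (hm : ∀ S w, Measurable fun c : Fin n → Fin K × Fin M → ℂ => F (active c S w)) :
    ∫⁻ c, ∑ S' ∈ Finset.powersetCard t Finset.univ, F (active c S' W)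
        ∂(gaussianMatrix (Fin n) (Fin K × Fin M) P')
      = K.choose t * ∫⁻ c, F (active c S w) ∂(gaussianMatrix (Fin n) (Fin K × Fin M) P') := by
  rw [lintegral_finsetSum _ fun S' _ => hm S' W, Finset.sum_congr rfl fun S' hS' =>
    lintegral_active_symmetric_left P' (hS.trans (Finset.mem_powersetCard.1 hS').2.symm) hw W hF
      (hm S w), Finset.sum_const, Finset.card_powersetCard, Finset.card_univ, Fintype.card_fin,
    nsmul_eq_mul]

/-- For `ω = 0` the event is a pure noise tail. For `t < n` the error sets are treated one by one
through the coupling; for `t ≥ n` large noise is split off and the residual itself must be small. -/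
theorem lintegral_noiseEvent_le (hn : 0 < n) (hL : 0 < L) {t : ℕ} (ht : 0 < t) {P' ω ν : ℝ}
    (h0 : 0 ≤ ω) (h1 : ω ≤ 1) {S : Finset (Fin K)} (hS : S.card = t) {w w' : Fin K → Fin M}
    (hw : ∀ k, w' k ≠ w k) (W : Fin K → Fin M) :
    ∫⁻ c, fadingNoise n K L (⋃ S' ∈ Finset.powersetCard t Finset.univ,
        noiseEvent L (active c S' W) ω ν) ∂(gaussianMatrix (Fin n) (Fin K × Fin M) P')
      ≤ ENNReal.ofReal (q2 n L t P' S w ω ν) := by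
  have : Nonempty (Fin n) := ⟨⟨0, hn⟩⟩
  have : Nonempty (Fin L) := ⟨⟨0, hL⟩⟩
  have hnL := Nat.mul_pos hn hL
  have htL := Nat.mul_pos ht hL
  have hfin : ∫⁻ c, fadingNoise n K L (⋃ S' ∈ Finset.powersetCard t Finset.univ,
        noiseEvent L (active c S' W) ω ν) ∂(gaussianMatrix (Fin n) (Fin K × Fin M) P') ≠ ∞ := by
    refine ne_top_of_le_ne_top ENNReal.one_ne_top ?_
    calc _ ≤ ∫⁻ _, 1 ∂(gaussianMatrix (Fin n) (Fin K × Fin M) P') :=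
        lintegral_mono fun _ => prob_le_one
      _ = 1 := by simp
  have hr0 : ∀ {N : ℕ}, 0 < N → ∀ a, 0 ≤ gammaRatio N a := fun hN a =>
    gammaRatio_nonneg (by exact_mod_cast hN) a
  unfold q2
  split_ifs with hω htn
  · subst hω
    have hle : ∀ c : Fin n → Fin K × Fin M → ℂ,
        fadingNoise n K L (⋃ S' ∈ Finset.powersetCard t Finset.univ,
          noiseEvent L (active c S' W) 0 ν)
        ≤ ENNReal.ofReal (1 - gammaRatio (n * L) (n * L * ν)) := by
      intro c
      have h := gaussianMatrix_lt_frob (ι := Fin n) (κ := Fin L) (n * L * ν)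
      rw [Fintype.card_fin, Fintype.card_fin] at h
      rw [← h, ← (measurePreserving_snd (μ := gaussianMatrix (Fin K) (Fin L) 1)).measure_preimage
        (measurableSet_lt measurable_const measurable_frob).nullMeasurableSet]
      -- At `ω = 0` the event does not depend on `S'`, so the union costs nothing.
      refine measure_mono (Set.iUnion₂_subset fun S' _ p hp => ?_)
      have hp' : 0 * frob (p.2 + mulCols (active c S' W) p.1) + n * L * ν < frob p.2 := hp
      rwa [zero_mul, zero_add] at hp'
    calc _ ≤ ∫⁻ _, ENNReal.ofReal (1 - gammaRatio (n * L) (n * L * ν))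
          ∂(gaussianMatrix (Fin n) (Fin K × Fin M) P') := lintegral_mono hle
      _ = _ := by simp
  · rw [← ENNReal.ofReal_toReal hfin]
    refine ENNReal.ofReal_le_ofReal (le_csInf ⟨_, 0, 0, le_rfl, le_rfl, rfl⟩ ?_)
    rintro x ⟨η, δ, hη, hδ, rfl⟩
    have hn1 := gammaRatio_le_one hnL (n * L * (1 + δ))
    have ht1 := gammaRatio_le_one htL (t * L * (1 + η))
    push_cast at hn1 ht1
    set f : Matrix (Fin n) (Fin K) ℂ → ℝ := fun A => gammaRatio (t * L)
      (L * ((t * (1 + η) - n * ν + n * (1 + δ) * (1 - ω)) * gramDet ω A ^ (-(1 / t : ℝ)))) with hf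
    set b : ℝ := 2 - gammaRatio (t * L) (t * L * (1 + η)) - gammaRatio (n * L) (n * L * (1 + δ))
      with hb
    have hf0 : ∀ A, 0 ≤ f A := fun A => by
      have := hr0 htL (L * ((t * (1 + η) - n * ν + n * (1 + δ) * (1 - ω))
        * gramDet ω A ^ (-(1 / t : ℝ))))
      rwa [Nat.cast_mul] at this
    have hf1 : ∀ A, f A ≤ 1 := fun A => by
      have := gammaRatio_le_one htL (L * ((t * (1 + η) - n * ν + n * (1 + δ) * (1 - ω))
        * gramDet ω A ^ (-(1 / t : ℝ))))
      rwa [Nat.cast_mul] at this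
    have hfm : ∀ S w, Measurable fun c : Fin n → Fin K × Fin M → ℂ => f (active c S w) := by
      intro S w
      have := measurable_gammaRatio_comp htL (f := fun c : Fin n → Fin K × Fin M → ℂ =>
        L * ((t * (1 + η) - n * ν + n * (1 + δ) * (1 - ω))
          * gramDet ω (active c S w) ^ (-(1 / t : ℝ))))
        ((((measurable_gramDet_active ω S w).pow_const _).const_mul _).const_mul _)
      simpa only [Nat.cast_mul] using this
    have hI : 0 ≤ ∫ c, f (active c S w) ∂(gaussianMatrix (Fin n) (Fin K × Fin M) P') :=
      integral_nonneg fun _ => hf0 _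
    have hb0 : 0 ≤ b := by linarith
    refine ENNReal.toReal_le_of_le_ofReal (by positivity) ?_
    calc _ ≤ ∫⁻ c, ∑ S' ∈ Finset.powersetCard t Finset.univ,
          (ENNReal.ofReal (f (active c S' W)) + ENNReal.ofReal b)
          ∂(gaussianMatrix (Fin n) (Fin K × Fin M) P') := by
          refine lintegral_mono fun c => (measure_biUnion_finset_le _ _).trans
            (Finset.sum_le_sum fun S' hS' => ?_)
          refine measure_noiseEvent_le_of_support hn hL ht (Finset.mem_powersetCard.1 hS').2
            (fun i k hk => ?_) h0 h1 ν η δ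
          rw [active_apply, if_neg hk]
      _ = K.choose t * ∫⁻ c, (ENNReal.ofReal (f (active c S w)) + ENNReal.ofReal b)
          ∂(gaussianMatrix (Fin n) (Fin K × Fin M) P') :=
          sum_lintegral_active P' hS hw W (F := fun A => ENNReal.ofReal (f A) + ENNReal.ofReal b)
            (fun A τ => by simp only [hf, gramDet_submatrix])
            fun S w => (hfm S w).ennreal_ofReal.add_const _
      _ = _ := by
          rw [lintegral_add_right _ measurable_const, lintegral_const, measure_univ, mul_one,
            lintegral_ofReal_of_mem_Icc (hfm S w) (fun _ => hf0 _) fun _ => hf1 _,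
            ← ENNReal.ofReal_add hI hb0, ← ENNReal.ofReal_natCast,
            ← ENNReal.ofReal_mul (Nat.cast_nonneg _), mul_add]
  · rw [← ENNReal.ofReal_toReal hfin]
    refine ENNReal.ofReal_le_ofReal (le_csInf ⟨_, 0, le_rfl, rfl⟩ ?_)
    rintro x ⟨η, hη, rfl⟩
    have hn1 := gammaRatio_le_one hnL (n * L * (1 + η))
    push_cast at hn1
    set f : Matrix (Fin n) (Fin K) ℂ → ℝ := fun A => gammaRatio (n * L)
      (n * L * (1 + η - ν) / (ω * gramDet 1 A ^ (1 / n : ℝ))) with hf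
    have hf0 : ∀ A, 0 ≤ f A := fun A => by
      have := hr0 hnL (n * L * (1 + η - ν) / (ω * gramDet 1 A ^ (1 / n : ℝ)))
      rwa [Nat.cast_mul] at this
    have hf1 : ∀ A, f A ≤ 1 := fun A => by
      have := gammaRatio_le_one hnL (n * L * (1 + η - ν) / (ω * gramDet 1 A ^ (1 / n : ℝ)))
      rwa [Nat.cast_mul] at this
    have hfm : ∀ S w, Measurable fun c : Fin n → Fin K × Fin M → ℂ => f (active c S w) := by
      intro S w
      have := measurable_gammaRatio_comp hnL (f := fun c : Fin n → Fin K × Fin M → ℂ =>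
        n * L * (1 + η - ν) / (ω * gramDet 1 (active c S w) ^ (1 / n : ℝ)))
        ((((measurable_gramDet_active 1 S w).pow_const _).const_mul _).const_div _)
      simpa only [Nat.cast_mul] using this
    have hI : 0 ≤ ∫ c, f (active c S w) ∂(gaussianMatrix (Fin n) (Fin K × Fin M) P') :=
      integral_nonneg fun _ => hf0 _
    have hωp : 0 < ω := lt_of_le_of_ne h0 (Ne.symm hω)
    rw [add_sub_assoc]
    have hb0 : 0 ≤ 1 - gammaRatio (n * L) (n * L * (1 + η)) := sub_nonneg.2 hn1
    refine ENNReal.toReal_le_of_le_ofReal (add_nonneg (by positivity) hb0) ?_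
    calc _ ≤ ∫⁻ c, (∑ S' ∈ Finset.powersetCard t Finset.univ,
          ENNReal.ofReal (f (active c S' W)))
            + ENNReal.ofReal (1 - gammaRatio (n * L) (n * L * (1 + η)))
          ∂(gaussianMatrix (Fin n) (Fin K × Fin M) P') := by
          refine lintegral_mono fun c => ?_
          -- The event of large noise does not depend on `S'`. Splitting it off before the union
          -- bound is why its probability carries no binomial coefficient.
          have hsub : (⋃ S' ∈ Finset.powersetCard t Finset.univ,
              noiseEvent L (active c S' W) ω ν)
              ⊆ (⋃ S' ∈ Finset.powersetCard t Finset.univ,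
                {p | ω * frob (p.2 + mulCols (active c S' W) p.1) ≤ n * L * (1 + η - ν)})
                ∪ Prod.snd ⁻¹' {z | n * L * (1 + η) < frob z} := by
            refine Set.iUnion₂_subset fun S' hS' p hp => ?_
            by_cases h : n * L * (1 + η) < frob p.2
            · exact Or.inr h
            · refine Or.inl (Set.mem_iUnion₂.2 ⟨S', hS', ?_⟩)
              have hp' : ω * frob (p.2 + mulCols (active c S' W) p.1) + n * L * ν < frob p.2 := hp
              change ω * frob (p.2 + mulCols (active c S' W) p.1) ≤ n * L * (1 + η - ν)
              linarith
          refine (measure_mono hsub).trans ((measure_union_le _ _).trans (add_le_add ?_ ?_))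
          · refine (measure_biUnion_finset_le _ _).trans (Finset.sum_le_sum fun S' hS' => ?_)
            exact measure_frob_active_le hn hL _ hωp ν η
          · have h := gaussianMatrix_lt_frob (ι := Fin n) (κ := Fin L) (n * L * (1 + η))
            rw [Fintype.card_fin, Fintype.card_fin] at h
            rw [← h, measurePreserving_snd.measure_preimage
              (measurableSet_lt measurable_const measurable_frob).nullMeasurableSet]
      _ = K.choose t * (∫⁻ c, ENNReal.ofReal (f (active c S w))
            ∂(gaussianMatrix (Fin n) (Fin K × Fin M) P'))
            + ENNReal.ofReal (1 - gammaRatio (n * L) (n * L * (1 + η))) := by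
          rw [lintegral_add_right _ measurable_const, lintegral_const, measure_univ, mul_one,
            sum_lintegral_active P' hS hw W (F := fun A => ENNReal.ofReal (f A))
            (fun A τ => by simp only [hf, gramDet_submatrix])
            fun S w => (hfm S w).ennreal_ofReal]
      _ = _ := by
          rw [lintegral_ofReal_of_mem_Icc (hfm S w) (fun _ => hf0 _) fun _ => hf1 _,
            ← ENNReal.ofReal_natCast, ← ENNReal.ofReal_mul (Nat.cast_nonneg _),
            ← ENNReal.ofReal_add (by positivity) hb0]

end NoiseRegion

/-! ## The random coding bound with an optimised exponent -/

section Gallager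

/-- A union bound, conditionally on the sent part of a random codebook. -/
theorem pi_exists_le {E κ α J : Type*} [MeasurableSpace E] [Fintype κ] [Fintype α] (ν : Measure E)
    [IsProbabilityMeasure ν] {f : α → κ} (hf : Function.Injective f) (s : Finset J) (F : J → α → κ)
    (hF : ∀ j ∈ s, Function.Injective (F j)) (hd : ∀ j ∈ s, ∀ a b, F j a ≠ f b)
    {Q : Set ((α → E) × (α → E))} (hQ : MeasurableSet Q) :
    Measure.pi (fun _ : κ => ν) {C | ∃ j ∈ s, ((fun a => C (f a)), fun a => C (F j a)) ∈ Q}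
      ≤ ∫⁻ x, min 1 (s.card * Measure.pi (fun _ : α => ν) (Prod.mk x ⁻¹' Q))
        ∂(Measure.pi fun _ : α => ν) := by
  classical
  -- Coordinates are separated into the sent codewords and the rest. All rival codewords lie in the
  -- rest by `hd`, hence are independent of the sent ones.
  obtain ⟨p, hp⟩ : ∃ p : κ → Prop, ∀ k, p k ↔ k ∈ Set.range f := ⟨_, fun _ => Iff.rfl⟩
  let f' : α → Subtype p := fun a => ⟨f a, (hp _).2 ⟨a, rfl⟩⟩
  let F' : s → α → {k // ¬ p k} := fun j a => ⟨F j a, fun h => by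
    obtain ⟨b, hb⟩ := (hp _).1 h
    exact hd j j.2 a b hb.symm⟩
  have hf' : Function.Injective f' := fun a b h => hf (congrArg Subtype.val h)
  have hF' : ∀ j, Function.Injective (F' j) := fun j a b h => hF j j.2 (congrArg Subtype.val h)
  let T : Set ((Subtype p → E) × ({k // ¬ p k} → E)) :=
    ⋃ j : s, {q | ((fun a => q.1 (f' a)), fun a => q.2 (F' j a)) ∈ Q}
  have hT : MeasurableSet T := MeasurableSet.iUnion fun j =>
    (by fun_prop : Measurable fun q : (Subtype p → E) × ({k // ¬ p k} → E) =>
      ((fun a => q.1 (f' a)), fun a => q.2 (F' j a))) hQ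
  have he := measurePreserving_piEquivPiSubtypeProd (fun _ : κ => ν) p
  have hset : {C : κ → E | ∃ j ∈ s, ((fun a => C (f a)), fun a => C (F j a)) ∈ Q}
      = MeasurableEquiv.piEquivPiSubtypeProd (fun _ => E) p ⁻¹' T := by
    ext C
    simp only [Set.mem_ofPred_eq, Set.mem_preimage, T, Set.mem_iUnion]
    exact ⟨fun ⟨j, hj, h⟩ => ⟨⟨j, hj⟩, h⟩, fun ⟨j, h⟩ => ⟨j, j.2, h⟩⟩
  have hmp := measurePreserving_comp_injective (fun _ : Subtype p => ν) f' hf'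
  have hm : Measurable fun x : α → E => min 1 ((s.card : ℝ≥0∞) *
      Measure.pi (fun _ : α => ν) (Prod.mk x ⁻¹' Q)) :=
    measurable_const.min ((measurable_measure_prodMk_left hQ).const_mul _)
  rw [hset, he.measure_preimage hT.nullMeasurableSet, Measure.prod_apply hT,
    ← hmp.lintegral_comp hm]
  refine lintegral_mono fun a => ?_
  -- The cap at one is applied conditionally on the sent part, before averaging; this is what
  -- Gallager's exponent exploits.
  refine le_min prob_le_one ?_
  have hpre : Prod.mk a ⁻¹' T = ⋃ j ∈ (Finset.univ : Finset s),
      (fun (b : {k // ¬ p k} → E) i => b (F' j i)) ⁻¹' (Prod.mk (fun i => a (f' i)) ⁻¹' Q) := by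
    ext b
    simp [T]
  rw [hpre]
  refine (measure_biUnion_finset_le _ _).trans (le_of_eq ?_)
  rw [Finset.sum_congr rfl fun j _ =>
    (measurePreserving_comp_injective (fun _ : {k // ¬ p k} => ν) (F' j)
      (hF' j)).measure_preimage (measurable_prodMk_left hQ).nullMeasurableSet]
  simp

/-- Gallager's device: an exponent in `[0, 1]` interpolates between the trivial bound and the union
bound. -/
theorem min_one_le_rpow {y : ℝ≥0∞} {ρ : ℝ} (h0 : 0 ≤ ρ) (h1 : ρ ≤ 1) : min 1 y ≤ y ^ ρ := by
  rcases le_total 1 y with h | h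
  · rw [min_eq_left h]
    simpa using ENNReal.rpow_le_rpow h h0
  · rw [min_eq_right h]
    calc y = y ^ (1 : ℝ) := (ENNReal.rpow_one y).symm
      _ ≤ y ^ ρ := ENNReal.rpow_le_rpow_of_exponent_ge h h1

variable {κ σ : Type} [Fintype κ] [Fintype σ] [DecidableEq κ]

theorem lintegral_gaussianVec_exp_neg_smul_sqn_sub [DecidableEq σ] (B : Matrix κ σ ℂ) {s v : ℝ}
    (hs : 0 ≤ s) (hv : 0 ≤ v) (y : κ → ℂ) :
    ∫⁻ x, ENNReal.ofReal (Real.exp (-(s * sqn (y - B *ᵥ x)))) ∂(gaussianVec σ v)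
      = ENNReal.ofReal (((1 + (s * v) • (B * Bᴴ)).det.re)⁻¹
        * Real.exp (-(s * (star y ⬝ᵥ ((1 + (s * v) • (B * Bᴴ))⁻¹ *ᵥ y)).re))) := by
  rw [← (measurePreserving_gaussianVec_smul (ι := σ) hv).lintegral_comp (by fun_prop)]
  have h := lintegral_gaussianVec_exp_neg_sqn_sub (√(s * v) • B) (√s • y)
  rw [sqrt_smul_mul_conjTranspose (mul_nonneg hs hv)] at h
  have hq : (star (√s • y) ⬝ᵥ ((1 + (s * v) • (B * Bᴴ))⁻¹ *ᵥ (√s • y))).re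
      = s * (star y ⬝ᵥ ((1 + (s * v) • (B * Bᴴ))⁻¹ *ᵥ y)).re := by
    rw [star_smul, Matrix.mulVec_smul, smul_dotProduct, dotProduct_smul, smul_smul, star_trivial,
      Real.mul_self_sqrt hs, Complex.smul_re, smul_eq_mul]
  rw [hq] at h
  rw [← h]
  refine lintegral_congr fun x => ?_
  congr 3
  have : √s • y - (√(s * v) • B) *ᵥ x = √s • (y - B *ᵥ fun i => (√v : ℂ) * x i) := by
    have e : (fun i => (√v : ℂ) * x i) = √v • x := by
      ext i
      simp
    rw [e, Matrix.mulVec_smul, Matrix.smul_mulVec, smul_sub, smul_smul, Real.sqrt_mul hs]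
  rw [this, sqn_smul, Real.sq_sqrt hs]

/-- The contribution of one channel use. -/
theorem lintegral_row [DecidableEq σ] (B : Matrix κ σ ℂ) {ρ v : ℝ} (hρ : 0 ≤ ρ) (hv : 0 ≤ v) :
    ∫⁻ z, ∫⁻ x, (∫⁻ x', ENNReal.ofReal (Real.exp ((1 + ρ)⁻¹ *
        (sqn z - sqn (z + B *ᵥ x - B *ᵥ x')))) ∂(gaussianVec σ v)) ^ ρ
        ∂(gaussianVec σ v) ∂(gaussianVec κ 1)
      = ENNReal.ofReal ((1 + (v / (1 + ρ)) • (B * Bᴴ)).det.re ^ (-ρ)) := by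
  have h1 : 0 < 1 + ρ := by linarith
  have hcomm : v / (1 + ρ) = (1 + ρ)⁻¹ * v := by rw [div_eq_inv_mul]
  rw [hcomm]
  set s := (1 + ρ)⁻¹ with hs
  have hs0 : 0 < s := inv_pos.2 h1
  set C := 1 + (s * v) • (B * Bᴴ) with hCdef
  have hC : C.PosDef := posDef_one_add_smul_mul_conjTranspose (mul_nonneg hs0.le hv) B
  have hD := det_re_pos_of_posDef hC
  set D := C.det.re with hDdef
  have hq : Continuous fun y : κ → ℂ => (star y ⬝ᵥ (C⁻¹ *ᵥ y)).re := by
    unfold Matrix.mulVec dotProduct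
    fun_prop
  set q : (κ → ℂ) → ℝ := fun y => (star y ⬝ᵥ (C⁻¹ *ᵥ y)).re with hqdef
  have hqm : Measurable q := hq.measurable
  let φ : (κ → ℂ) → ℝ≥0∞ := fun y => ENNReal.ofReal (D⁻¹ * Real.exp (-(s * q y)))
  have hφ : ∀ y, ∫⁻ x, ENNReal.ofReal (Real.exp (-(s * sqn (y - B *ᵥ x)))) ∂(gaussianVec σ v)
      = φ y := lintegral_gaussianVec_exp_neg_smul_sqn_sub B hs0.le hv
  have hφm : Measurable φ := by fun_prop
  have hin : ∀ z x, (∫⁻ x', ENNReal.ofReal (Real.exp (s *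
        (sqn z - sqn (z + B *ᵥ x - B *ᵥ x')))) ∂(gaussianVec σ v)) ^ ρ
      = ENNReal.ofReal (Real.exp (s * ρ * sqn z)) * φ (z + B *ᵥ x) ^ ρ := by
    intro z x
    simp_rw [mul_sub, sub_eq_add_neg (s * sqn z), Real.exp_add,
      ENNReal.ofReal_mul (Real.exp_pos _).le]
    rw [lintegral_const_mul _ (by fun_prop), hφ, ENNReal.mul_rpow_of_nonneg _ _ hρ,
      ENNReal.ofReal_rpow_of_pos (Real.exp_pos _), ← Real.exp_mul,
      mul_right_comm s (sqn z) ρ]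
  simp_rw [hin]
  have hj : Measurable fun p : (κ → ℂ) × (σ → ℂ) => p.1 + B *ᵥ p.2 := by
    have : Measurable fun x : σ → ℂ => B *ᵥ x := by fun_prop
    exact measurable_fst.add (this.comp measurable_snd)
  have hj1 : Measurable fun p : (κ → ℂ) × (σ → ℂ) =>
      ENNReal.ofReal (Real.exp (s * ρ * sqn p.1)) * φ (p.1 + B *ᵥ p.2) ^ ρ :=
    (by fun_prop : Measurable fun p : (κ → ℂ) × (σ → ℂ) =>
      ENNReal.ofReal (Real.exp (s * ρ * sqn p.1))).mul ((hφm.comp hj).pow_const ρ)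
  rw [lintegral_gaussianVec_one hj1.lintegral_prod_right']
  -- The tilt `s = 1 / (1 + ρ)` satisfies `1 - s ρ = s`, so the noise density takes the same
  -- exponential form as the factor for the rival.
  have hz : ∀ z : κ → ℂ, ENNReal.ofReal (Real.exp (-sqn z)) *
      ∫⁻ x, ENNReal.ofReal (Real.exp (s * ρ * sqn z)) * φ (z + B *ᵥ x) ^ ρ ∂(gaussianVec σ v)
      = ∫⁻ x, ENNReal.ofReal (Real.exp (-(s * sqn z))) * φ (z + B *ᵥ x) ^ ρ
        ∂(gaussianVec σ v) := by
    intro z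
    have hmz : Measurable fun x : σ → ℂ => φ (z + B *ᵥ x) ^ ρ :=
      (hφm.comp (hj.comp measurable_prodMk_left)).pow_const ρ
    rw [lintegral_const_mul _ hmz, lintegral_const_mul _ hmz, ← mul_assoc,
      ← ENNReal.ofReal_mul (Real.exp_pos _).le, ← Real.exp_add]
    congr 3
    have : s * (1 + ρ) = 1 := inv_mul_cancel₀ h1.ne'
    linear_combination (sqn z) * this
  simp_rw [hz]
  have hj2 : Measurable fun p : (κ → ℂ) × (σ → ℂ) =>
      ENNReal.ofReal (Real.exp (-(s * sqn p.1))) * φ (p.1 + B *ᵥ p.2) ^ ρ :=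
    (by fun_prop : Measurable fun p : (κ → ℂ) × (σ → ℂ) =>
      ENNReal.ofReal (Real.exp (-(s * sqn p.1)))).mul ((hφm.comp hj).pow_const ρ)
  rw [lintegral_lintegral_swap hj2.aemeasurable]
  have hshift : ∀ x : σ → ℂ, ∫⁻ z : κ → ℂ,
      ENNReal.ofReal (Real.exp (-(s * sqn z))) * φ (z + B *ᵥ x) ^ ρ
      = ∫⁻ y : κ → ℂ, ENNReal.ofReal (Real.exp (-(s * sqn (y - B *ᵥ x)))) * φ y ^ ρ := by
    intro x
    rw [← lintegral_add_right_eq_self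
      (fun y => ENNReal.ofReal (Real.exp (-(s * sqn (y - B *ᵥ x)))) * φ y ^ ρ) (B *ᵥ x)]
    simp_rw [add_sub_cancel_right]
  simp_rw [hshift]
  have hj3 : Measurable fun p : (σ → ℂ) × (κ → ℂ) =>
      ENNReal.ofReal (Real.exp (-(s * sqn (p.2 - B *ᵥ p.1)))) * φ p.2 ^ ρ := by
    have h1 : Measurable fun p : (σ → ℂ) × (κ → ℂ) => p.2 - B *ᵥ p.1 := by
      have : Measurable fun x : σ → ℂ => B *ᵥ x := by fun_prop
      exact measurable_snd.sub (this.comp measurable_fst)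
    have h2 : Measurable fun p : (σ → ℂ) × (κ → ℂ) => sqn (p.2 - B *ᵥ p.1) :=
      measurable_sqn.comp h1
    fun_prop
  rw [lintegral_lintegral_swap hj3.aemeasurable]
  -- In terms of the output `y`, averaging over the sent vector gives `φ y` again, for sent and
  -- rival have the same law. The result is `φ y ^ (1 + ρ)`, a Gaussian in `y` with form `C⁻¹`.
  have hy : ∀ y : κ → ℂ, ∫⁻ x, ENNReal.ofReal (Real.exp (-(s * sqn (y - B *ᵥ x)))) * φ y ^ ρ
      ∂(gaussianVec σ v) = ENNReal.ofReal (D⁻¹ ^ (1 + ρ)) * ENNReal.ofReal (Real.exp (-q y)) := by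
    intro y
    have hpos : 0 < D⁻¹ * Real.exp (-(s * q y)) := by positivity
    rw [lintegral_mul_const _ (by fun_prop), hφ]
    simp only [φ]
    rw [ENNReal.ofReal_rpow_of_pos hpos, ← ENNReal.ofReal_mul hpos.le,
      ← ENNReal.ofReal_mul (by positivity)]
    congr 1
    nth_rewrite 1 [← Real.rpow_one (D⁻¹ * Real.exp (-(s * q y)))]
    rw [← Real.rpow_add hpos, Real.mul_rpow (by positivity) (Real.exp_pos _).le, ← Real.exp_mul]
    congr 2
    have : s * (1 + ρ) = 1 := inv_mul_cancel₀ h1.ne'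
    linear_combination (-q y) * this
  simp_rw [hy]
  rw [lintegral_const_mul _ (by fun_prop), hqdef, lintegral_exp_neg_quadForm hC.inv,
    ← ENNReal.ofReal_mul (by positivity), ← ENNReal.ofReal_mul (by positivity)]
  congr 1
  -- The integral over `y` returns a factor `D`, turning `D ^ (-(1 + ρ))` into `D ^ (-ρ)`.
  have hdet : C⁻¹.det.re = D⁻¹ := by
    rw [Matrix.det_nonsing_inv, Ring.inverse_eq_inv', det_eq_re_of_posDef hC, ← Complex.ofReal_inv,
      Complex.ofReal_re]
  rw [hdet, Real.inv_rpow hD.le, Real.rpow_neg hD.le, Real.rpow_add hD, Real.rpow_one]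
  have := Real.rpow_pos_of_pos hD ρ
  field_simp

end Gallager

/-! ### Gallager's bound for a fixed set of users in error -/

section Rivals

section General

variable {ι κ σ : Type} [Fintype ι] [Fintype κ] [Fintype σ]

/-- The exponential bound on the likelihood comparison of two hypotheses. -/
noncomputable def tiltedWeight (s : ℝ) (Z : ι → κ → ℂ) (H : σ → κ → ℂ) (X X' : ι → σ → ℂ) : ℝ≥0∞ :=
  ENNReal.ofReal (Real.exp (s * (frob Z - frob (Z + mulCols X H - mulCols X' H))))

omit [Fintype ι] in
theorem measurable_mulCols_prod {μ : Type*} {X : Type*} [MeasurableSpace X] {A : X → ι → σ → ℂ}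
    {H : X → σ → μ → ℂ} (hA : Measurable A) (hH : Measurable H) :
    Measurable fun x => mulCols (A x) (H x) := by
  unfold mulCols Matrix.mulVec dotProduct
  fun_prop

theorem measurable_tiltedWeight (s : ℝ) :
    Measurable fun q : (((σ → κ → ℂ) × (ι → κ → ℂ)) × (ι → σ → ℂ)) × (ι → σ → ℂ) =>
      tiltedWeight s q.1.1.2 q.1.1.1 q.1.2 q.2 := by
  have h1 : Measurable fun q : (((σ → κ → ℂ) × (ι → κ → ℂ)) × (ι → σ → ℂ)) × (ι → σ → ℂ) =>
      mulCols q.1.2 q.1.1.1 := measurable_mulCols_prod (by fun_prop) (by fun_prop)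
  have h2 : Measurable fun q : (((σ → κ → ℂ) × (ι → κ → ℂ)) × (ι → σ → ℂ)) × (ι → σ → ℂ) =>
      mulCols q.2 q.1.1.1 := measurable_mulCols_prod (by fun_prop) (by fun_prop)
  have h3 : Measurable fun q : (((σ → κ → ℂ) × (ι → κ → ℂ)) × (ι → σ → ℂ)) × (ι → σ → ℂ) =>
      frob (q.1.1.2 + mulCols q.1.2 q.1.1.1 - mulCols q.2 q.1.1.1) :=
    measurable_frob.comp (((by fun_prop : Measurable fun q :
      (((σ → κ → ℂ) × (ι → κ → ℂ)) × (ι → σ → ℂ)) × (ι → σ → ℂ) => q.1.1.2).add h1).sub h2)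
  unfold tiltedWeight
  fun_prop

theorem measurable_tiltedWeight_right (s : ℝ) (Z : ι → κ → ℂ) (H : σ → κ → ℂ) (X : ι → σ → ℂ) :
    Measurable fun X' => tiltedWeight s Z H X X' := by
  have h : Measurable fun X' : ι → σ → ℂ => (((H, Z), X), X') := by fun_prop
  have h2 := (measurable_tiltedWeight (ι := ι) (κ := κ) (σ := σ) s).comp h
  exact h2

theorem measurable_lintegral_tiltedWeight_prod (s ρ v : ℝ) :
    Measurable fun q : ((σ → κ → ℂ) × (ι → κ → ℂ)) × (ι → σ → ℂ) =>
      (∫⁻ X', tiltedWeight s q.1.2 q.1.1 q.2 X' ∂(gaussianMatrix ι σ v)) ^ ρ :=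
  (measurable_tiltedWeight (ι := ι) (κ := κ) (σ := σ) s).lintegral_prod_right'.pow_const ρ

theorem measurable_lintegral_tiltedWeight (s ρ v : ℝ) (Z : ι → κ → ℂ) (H : σ → κ → ℂ) :
    Measurable fun X =>
      (∫⁻ X', tiltedWeight s Z H X X' ∂(gaussianMatrix ι σ v)) ^ ρ := by
  have h : Measurable fun X : ι → σ → ℂ => ((H, Z), X) := by fun_prop
  have h2 :=
    (measurable_lintegral_tiltedWeight_prod (ι := ι) (κ := κ) (σ := σ) s ρ v).comp h
  exact h2

theorem tiltedWeight_eq_prod (s : ℝ) (Z : ι → κ → ℂ) (H : σ → κ → ℂ) (X X' : ι → σ → ℂ) :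
    tiltedWeight s Z H X X' = ∏ i, ENNReal.ofReal (Real.exp (s * (sqn (Z i)
      - sqn (Z i + (Matrix.of H)ᵀ *ᵥ X i - (Matrix.of H)ᵀ *ᵥ X' i)))) := by
  have hrow : ∀ (X : ι → σ → ℂ) (i : ι), mulCols X H i = (Matrix.of H)ᵀ *ᵥ X i := by
    intro X i
    ext l
    simp [mulCols, Matrix.mulVec, dotProduct, mul_comm]
  rw [← ENNReal.ofReal_prod_of_nonneg fun _ _ => (Real.exp_pos _).le, ← Real.exp_sum,
    ← Finset.mul_sum, Finset.sum_sub_distrib, tiltedWeight]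
  simp only [frob, Pi.add_apply, Pi.sub_apply, hrow]

omit [Fintype κ] [Fintype σ] in
/-- Integrating a product over independent rows, with an exponent inside. -/
theorem lintegral_lintegral_rpow_pi {E F : Type*} [MeasurableSpace E] [MeasurableSpace F]
    (μ : Measure E) (ν : Measure F) [IsProbabilityMeasure μ] [IsProbabilityMeasure ν]
    {g : (E × F) × F → ℝ≥0∞} (hg : Measurable g) {ρ : ℝ} (hρ : 0 ≤ ρ) :
    ∫⁻ Z : ι → E, ∫⁻ X : ι → F, (∫⁻ X' : ι → F, ∏ i, g ((Z i, X i), X' i)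
        ∂(Measure.pi fun _ => ν)) ^ ρ ∂(Measure.pi fun _ => ν) ∂(Measure.pi fun _ => μ)
      = (∫⁻ z, ∫⁻ x, (∫⁻ x', g ((z, x), x') ∂ν) ^ ρ ∂ν ∂μ) ^ Fintype.card ι := by
  have hR : Measurable fun q : E × F => (∫⁻ x', g (q, x') ∂ν) ^ ρ :=
    hg.lintegral_prod_right'.pow_const ρ
  have h1 : ∀ z x, Measurable fun x' => g ((z, x), x') := fun z x =>
    hg.comp measurable_prodMk_left
  have h2 : ∀ z, Measurable fun x => (∫⁻ x', g ((z, x), x') ∂ν) ^ ρ := fun z =>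
    hR.comp measurable_prodMk_left
  have h3 : Measurable fun z => ∫⁻ x, (∫⁻ x', g ((z, x), x') ∂ν) ^ ρ ∂ν :=
    hR.lintegral_prod_right'
  simp_rw [fun (Z : ι → E) (X : ι → F) => lintegral_pi_prod (fun _ : ι => ν)
    (fun i x' => g ((Z i, X i), x')) fun i => h1 _ _, ← ENNReal.prod_rpow_of_nonneg hρ,
    fun (Z : ι → E) => lintegral_pi_prod (fun _ : ι => ν)
      (fun i x => (∫⁻ x', g ((Z i, x), x') ∂ν) ^ ρ) fun i => h2 _]
  rw [lintegral_pi_prod (fun _ : ι => μ) _ fun _ => h3]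
  simp

/-- Averaging the tilted weights, row by row. -/
theorem lintegral_tiltedWeight [DecidableEq κ] [DecidableEq σ] (H : σ → κ → ℂ) {ρ v : ℝ}
    (hρ : 0 ≤ ρ) (hv : 0 ≤ v) :
    ∫⁻ Z, ∫⁻ X, (∫⁻ X', tiltedWeight (1 + ρ)⁻¹ Z H X X' ∂(gaussianMatrix ι σ v)) ^ ρ
        ∂(gaussianMatrix ι σ v) ∂(gaussianMatrix ι κ 1)
      = ENNReal.ofReal ((1 + (v / (1 + ρ)) •
        ((Matrix.of H)ᵀ * ((Matrix.of H)ᵀ)ᴴ)).det.re ^ (-ρ)) ^ Fintype.card ι := by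
  set B := (Matrix.of H)ᵀ with hB
  have hr : Measurable fun q : ((κ → ℂ) × (σ → ℂ)) × (σ → ℂ) => ENNReal.ofReal
      (Real.exp ((1 + ρ)⁻¹ * (sqn q.1.1 - sqn (q.1.1 + B *ᵥ q.1.2 - B *ᵥ q.2)))) := by
    have hBm : Measurable fun x : σ → ℂ => B *ᵥ x := by fun_prop
    have h1 : Measurable fun q : ((κ → ℂ) × (σ → ℂ)) × (σ → ℂ) =>
        q.1.1 + B *ᵥ q.1.2 - B *ᵥ q.2 :=
      ((measurable_fst.comp measurable_fst).add
        (hBm.comp (measurable_snd.comp measurable_fst))).sub (hBm.comp measurable_snd)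
    have h2 := measurable_sqn.comp h1
    fun_prop
  rw [← lintegral_row B hρ hv]
  simp_rw [tiltedWeight_eq_prod]
  exact lintegral_lintegral_rpow_pi (ι := ι) (gaussianVec κ 1) (gaussianVec σ v) hr hρ

end General

variable {n M K : ℕ}

/-- Only the users in `S` contribute, so the event involves `n × t` codeword matrices indexed by the
increasing enumeration of `S`. -/
theorem mulCols_active_sub (c : Fin n → Fin K × Fin M → ℂ) {t L : ℕ} {S : Finset (Fin K)}
    (hS : S.card = t) (W W' : Fin K → Fin M) (H : Fin K → Fin L → ℂ) :
    mulCols (active c S W - active c S W') H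
      = mulCols (fun i a => c i (S.orderEmbOfFin hS a, W (S.orderEmbOfFin hS a)))
          (fun a => H (S.orderEmbOfFin hS a))
        - mulCols (fun i a => c i (S.orderEmbOfFin hS a, W' (S.orderEmbOfFin hS a)))
          (fun a => H (S.orderEmbOfFin hS a)) := by
  ext i l
  simp only [mulCols, Matrix.mulVec, dotProduct, Pi.sub_apply, Matrix.sub_apply, active_apply,
    ← Finset.sum_sub_distrib]
  rw [← Finset.sum_subset (Finset.subset_univ S) fun k _ hk => by simp [hk]]
  conv_lhs => rw [← Finset.map_orderEmbOfFin_univ S hS, Finset.sum_map]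
  refine Finset.sum_congr rfl fun a _ => ?_
  simp [sub_mul]

/-- The random coding average produces a moment of order `m` in the `t × L` fading; duality turns it
into the moment of order `L` of a `t × m` matrix used to define `p2`. -/
theorem lintegral_det_transpose_eq (t m L : ℕ) {c : ℝ} (hc : 0 ≤ c) :
    ∫⁻ H : Fin t → Fin L → ℂ, ENNReal.ofReal (((1 + c • ((Matrix.of H)ᵀ *
        ((Matrix.of H)ᵀ)ᴴ)).det.re ^ m)⁻¹) ∂(gaussianMatrix (Fin t) (Fin L) 1)
      = ENNReal.ofReal (detMoment t m L c) := by
  have h1 := (measurePreserving_gaussianMatrix_swap (ι := Fin t) (κ := Fin L) 1).lintegral_comp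
    (f := fun G : Fin L → Fin t → ℂ => ENNReal.ofReal
      (((1 + c • (Matrix.of G * (Matrix.of G)ᴴ)).det.re ^ m)⁻¹)) (by fun_prop)
  have h2 := lintegral_det_swap (ι := Fin t) (κ := Fin L) (κ' := Fin m) hc
  rw [Fintype.card_fin, Fintype.card_fin] at h2
  refine h1.trans ?_
  rw [← ofReal_detMoment L t m hc, detMoment_comm L t m, ofReal_detMoment t L m hc, h2,
    ofReal_detMoment t m L hc]

/-- The event that some set of wrong messages for the users of `S` beats the transmitted one. -/
def rivalEvent (L : ℕ) (c : Fin n → Fin K × Fin M → ℂ) (S : Finset (Fin K)) (W : Fin K → Fin M) :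
    Set ((Fin K → Fin L → ℂ) × (Fin n → Fin L → ℂ)) :=
  {p | ∃ W' ∈ rivals S W, frob (p.2 + mulCols (active c S W - active c S W') p.1) ≤ frob p.2}

theorem measurableSet_rivalEvent_prod (L : ℕ) (S : Finset (Fin K)) (W : Fin K → Fin M) :
    MeasurableSet {q : (Fin n → Fin K × Fin M → ℂ) × ((Fin K → Fin L → ℂ) × (Fin n → Fin L → ℂ)) |
      q.2 ∈ rivalEvent L q.1 S W} := by
  have hset : {q : (Fin n → Fin K × Fin M → ℂ) × ((Fin K → Fin L → ℂ) × (Fin n → Fin L → ℂ)) |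
      q.2 ∈ rivalEvent L q.1 S W} = ⋃ W' ∈ rivals S W, {q |
        frob (q.2.2 + mulCols (active q.1 S W - active q.1 S W') q.2.1) ≤ frob q.2.2} := by
    ext q
    simp [rivalEvent]
  rw [hset]
  refine Finset.measurableSet_biUnion _ fun W' _ => ?_
  simp_rw [mulCols_active_sub _ rfl]
  have h1 : ∀ W : Fin K → Fin M, Measurable fun q : (Fin n → Fin K × Fin M → ℂ) ×
      ((Fin K → Fin L → ℂ) × (Fin n → Fin L → ℂ)) =>
      mulCols (fun i a => q.1 i (S.orderEmbOfFin rfl a, W (S.orderEmbOfFin rfl a)))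
        (fun a => q.2.1 (S.orderEmbOfFin rfl a)) := fun W =>
    measurable_mulCols_prod (by fun_prop) (by fun_prop)
  have h2 : Measurable fun q : (Fin n → Fin K × Fin M → ℂ) ×
      ((Fin K → Fin L → ℂ) × (Fin n → Fin L → ℂ)) => q.2.2 := by fun_prop
  have h3 := measurable_frob.comp (h2.add ((h1 W).sub (h1 W')))
  exact measurableSet_le h3 (measurable_frob.comp h2)

/-- The codebook is averaged first, for fixed fading and noise, with the `ρ`-th power of the union
bound over rivals; then the noise, row by row, and finally the fading. -/
theorem lintegral_rivalEvent_le {L t m : ℕ} {P' ρ : ℝ} (hP' : 0 ≤ P') (h0 : 0 ≤ ρ) (h1 : ρ ≤ 1)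
    (hm : ρ * n = m) {S : Finset (Fin K)} (hS : S.card = t) (W : Fin K → Fin M) :
    ∫⁻ c, fadingNoise n K L (rivalEvent L c S W) ∂(gaussianMatrix (Fin n) (Fin K × Fin M) P')
      ≤ ENNReal.ofReal ((M : ℝ) ^ (ρ * t) * detMoment t m L (P' / (1 + ρ))) := by
  set f : Fin t → Fin K := fun a => S.orderEmbOfFin hS a with hf
  have hfi : Function.Injective f := (S.orderEmbOfFin hS).injective
  have hfS : ∀ a, f a ∈ S := fun a => S.orderEmbOfFin_mem hS a
  set s := (1 + ρ)⁻¹ with hs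
  have hs0 : 0 < s := inv_pos.2 (by linarith)
  let N : ℝ≥0∞ := (((M - 1) ^ t : ℕ) : ℝ≥0∞)
  have hU := measurableSet_rivalEvent_prod (n := n) L S W
  -- the integrated tilted weights
  let R : (Fin t → Fin L → ℂ) × (Fin n → Fin L → ℂ) → ℝ≥0∞ := fun p =>
    ∫⁻ X, (∫⁻ X', tiltedWeight s p.2 p.1 X X' ∂(gaussianMatrix (Fin n) (Fin t) P')) ^ ρ
      ∂(gaussianMatrix (Fin n) (Fin t) P')
  have hR : Measurable R :=
    (measurable_lintegral_tiltedWeight_prod s ρ P').lintegral_prod_right'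
  have key : ∀ p : (Fin K → Fin L → ℂ) × (Fin n → Fin L → ℂ),
      gaussianMatrix (Fin n) (Fin K × Fin M) P' {c | p ∈ rivalEvent L c S W}
        ≤ N ^ ρ * R ((fun a => p.1 (f a)), p.2) := by
    intro p
    set H' : Fin t → Fin L → ℂ := fun a => p.1 (f a)
    let Q : Set ((Fin t → Fin n → ℂ) × (Fin t → Fin n → ℂ)) := {q |
      frob (p.2 + mulCols (fun i a => q.1 a i) H' - mulCols (fun i a => q.2 a i) H') ≤ frob p.2}
    have hQ : MeasurableSet Q := by
      have e1 : Measurable fun q : (Fin t → Fin n → ℂ) × (Fin t → Fin n → ℂ) =>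
          mulCols (fun i a => q.1 a i) H' := measurable_mulCols_prod (by fun_prop) (by fun_prop)
      have e2 : Measurable fun q : (Fin t → Fin n → ℂ) × (Fin t → Fin n → ℂ) =>
          mulCols (fun i a => q.2 a i) H' := measurable_mulCols_prod (by fun_prop) (by fun_prop)
      exact measurableSet_le (measurable_frob.comp ((e1.const_add p.2).sub e2)) measurable_const
    have hset : {c | p ∈ rivalEvent L c S W}
        = (fun (c : Fin n → Fin K × Fin M → ℂ) k i => c i k) ⁻¹' {C | ∃ W' ∈ rivals S W,
          ((fun a => C (f a, W (f a))), fun a => C (f a, W' (f a))) ∈ Q} := by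
      ext c
      simp only [rivalEvent, Set.mem_ofPred_eq, Set.mem_preimage, mulCols_active_sub c hS, Q,
        ← add_sub_assoc]
      rfl
    have hCm : MeasurableSet {C : Fin K × Fin M → Fin n → ℂ | ∃ W' ∈ rivals S W,
          ((fun a => C (f a, W (f a))), fun a => C (f a, W' (f a))) ∈ Q} := by
      have : {C : Fin K × Fin M → Fin n → ℂ | ∃ W' ∈ rivals S W,
          ((fun a => C (f a, W (f a))), fun a => C (f a, W' (f a))) ∈ Q}
          = ⋃ W' ∈ rivals S W, (fun C : Fin K × Fin M → Fin n → ℂ =>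
            ((fun a => C (f a, W (f a))), fun a => C (f a, W' (f a)))) ⁻¹' Q := by
        ext C
        simp
      rw [this]
      exact Finset.measurableSet_biUnion _ fun W' _ =>
        (by fun_prop : Measurable fun C : Fin K × Fin M → Fin n → ℂ =>
          ((fun a => C (f a, W (f a))), fun a => C (f a, W' (f a)))) hQ
    rw [hset, (measurePreserving_gaussianMatrix_swap P').measure_preimage hCm.nullMeasurableSet,
      gaussianMatrix_eq]
    refine (pi_exists_le (gaussianVec (Fin n) P') (f := fun a => (f a, W (f a)))
      (fun a b h => hfi (Prod.mk.inj h).1) (rivals S W) (fun W' a => (f a, W' (f a)))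
      (fun W' _ a b h => hfi (Prod.mk.inj h).1) (fun W' hW' a b h => ?_) hQ).trans ?_
    · obtain ⟨e1, e2⟩ := Prod.mk.inj h
      obtain rfl := hfi e1
      exact (mem_rivals.1 hW').1 _ (hfS _) e2
    have hG := measurable_lintegral_tiltedWeight (ι := Fin n) s ρ P' p.2 H'
    have hT := measurable_tiltedWeight_right s p.2 H'
    have hsw := measurePreserving_gaussianMatrix_swap (ι := Fin t) (κ := Fin n) P'
    calc _ ≤ ∫⁻ x : Fin t → Fin n → ℂ, N ^ ρ *
          (∫⁻ X', tiltedWeight s p.2 H' (fun i a => x a i) X'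
            ∂(gaussianMatrix (Fin n) (Fin t) P')) ^ ρ ∂(gaussianMatrix (Fin t) (Fin n) P') := by
          refine lintegral_mono fun x => (min_one_le_rpow h0 h1).trans ?_
          rw [card_rivals, hS, ← ENNReal.mul_rpow_of_nonneg _ _ h0]
          refine ENNReal.rpow_le_rpow ?_ h0
          gcongr
          -- Markov's inequality in exponential form: the tilted weight is at least one whenever the
          -- rival is no farther than the truth.
          rw [← hsw.lintegral_comp (hT _), ← lintegral_indicator_one (measurable_prodMk_left hQ)]
          refine lintegral_mono fun x' => ?_
          refine Set.indicator_apply_le' (fun hx' => ?_) fun _ => zero_le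
          have hx'' : frob (p.2 + mulCols (fun i a => x a i) H' - mulCols (fun i a => x' a i) H')
            ≤ frob p.2 := hx'
          rw [Pi.one_apply, tiltedWeight, ENNReal.one_le_ofReal]
          exact Real.one_le_exp (mul_nonneg hs0.le (sub_nonneg.2 hx''))
      _ = _ := by
          have hGs := hsw.lintegral_comp hG
          have hGm := hG.comp hsw.measurable
          simp only [Function.comp_def] at hGm
          rw [lintegral_const_mul _ hGm, hGs]
  have hfad : MeasurePreserving (fun p : (Fin K → Fin L → ℂ) × (Fin n → Fin L → ℂ) =>
      ((fun a => p.1 (f a)), p.2)) (fadingNoise n K L)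
      ((gaussianMatrix (Fin t) (Fin L) 1).prod (gaussianMatrix (Fin n) (Fin L) 1)) :=
    (measurePreserving_comp_injective (fun _ => gaussianVec (Fin L) 1) f hfi).prod
      (MeasurePreserving.id _)
  have hc : 0 ≤ P' / (1 + ρ) := div_nonneg hP' (by linarith)
  calc _ = ((gaussianMatrix (Fin n) (Fin K × Fin M) P').prod (fadingNoise n K L))
        {q | q.2 ∈ rivalEvent L q.1 S W} := (Measure.prod_apply hU).symm
    _ = ∫⁻ p, gaussianMatrix (Fin n) (Fin K × Fin M) P' {c | p ∈ rivalEvent L c S W}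
        ∂(fadingNoise n K L) := Measure.prod_apply_symm hU
    _ ≤ ∫⁻ p, N ^ ρ * R ((fun a => p.1 (f a)), p.2) ∂(fadingNoise n K L) := lintegral_mono key
    _ = N ^ ρ * ∫⁻ p, R p ∂((gaussianMatrix (Fin t) (Fin L) 1).prod
          (gaussianMatrix (Fin n) (Fin L) 1)) := by
        have hRm := hR.comp hfad.measurable
        simp only [Function.comp_def] at hRm
        rw [lintegral_const_mul _ hRm, hfad.lintegral_comp hR]
    _ = N ^ ρ * ENNReal.ofReal (detMoment t m L (P' / (1 + ρ))) := by
        rw [lintegral_prod _ hR.aemeasurable, ← lintegral_det_transpose_eq t m L hc]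
        congr 1
        refine lintegral_congr fun H => ?_
        rw [lintegral_tiltedWeight H h0 hP', Fintype.card_fin]
        have hd := det_re_pos_of_posDef
          (posDef_one_add_smul_mul_conjTranspose hc (Matrix.of H)ᵀ)
        -- The `n` rows raise `det ^ (-ρ)` to the power `n`; integrality of `ρ n` makes this a
        -- natural exponent, to which the duality applies.
        rw [← ENNReal.ofReal_pow (Real.rpow_nonneg hd.le _), ← Real.rpow_mul_natCast hd.le, neg_mul,
          hm, Real.rpow_neg hd.le, Real.rpow_natCast]
    _ ≤ _ := by
        rw [ENNReal.ofReal_mul (by positivity)]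
        gcongr
        -- The exact number `(M - 1) ^ t` of rivals is relaxed to `M ^ t`, the form appearing in
        -- `p2`.
        have : N ≤ ENNReal.ofReal ((M : ℝ) ^ t) := by
          rw [← Nat.cast_pow, ENNReal.ofReal_natCast]
          exact Nat.cast_le.2 (Nat.pow_le_pow_left (Nat.sub_le _ _) _)
        refine (ENNReal.rpow_le_rpow this h0).trans (le_of_eq ?_)
        rw [ENNReal.ofReal_rpow_of_nonneg (by positivity) h0, ← Real.rpow_natCast,
          ← Real.rpow_mul (Nat.cast_nonneg _), mul_comm]

end Rivals

/-! ## Existence of optimal codes -/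

section Bayes

/-- A measurable choice of a maximiser among finitely many measurable functions. -/
theorem exists_measurable_argmax {X α : Type*} [MeasurableSpace X] [Finite α] [Nonempty α]
    [MeasurableSpace α] (f : α → X → ℝ) (hf : ∀ a, Measurable (f a)) :
    ∃ g : X → α, Measurable g ∧ ∀ x a, f a x ≤ f (g x) x := by
  classical
  obtain ⟨N, ⟨e⟩⟩ := Finite.exists_equiv_fin α
  have hN : 0 < N := Fin.pos_iff_nonempty.2 (e.symm.nonempty)
  -- Candidates are listed along `ℕ`, arbitrarily past the end, so that the first maximiser can be
  -- selected measurably by `Nat.find`.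
  let h : ℕ → α := fun i => if hi : i < N then e.symm ⟨i, hi⟩ else Classical.arbitrary α
  have hp : ∀ x, ∃ i, ∀ a, f a x ≤ f (h i) x := by
    intro x
    obtain ⟨a, ha⟩ := Finite.exists_max fun a => f a x
    refine ⟨e a, fun b => ?_⟩
    have : h (e a) = a := by simp [h]
    rw [this]
    exact ha b
  have hm : ∀ i, MeasurableSet {x | ∀ a, f a x ≤ f (h i) x} := fun i => by
    rw [Set.ofPred_forall]
    exact MeasurableSet.iInter fun a => measurableSet_le (hf a) (hf _)
  have hmeas : Measurable h := measurable_from_nat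
  have hh : Measurable fun x => h (Nat.find (hp x)) := hmeas.comp (measurable_find hp hm)
  exact ⟨fun x => h (Nat.find (hp x)), hh,
    fun x => Nat.find_spec (hp x)⟩

variable {ι κ : Type} [Fintype ι] [Fintype κ]

/-- The density of a matrix with i.i.d. `CN(0,1)` entries. -/
noncomputable def gaussDensity (Y : ι → κ → ℂ) : ℝ :=
  (Real.pi ^ (Fintype.card ι * Fintype.card κ))⁻¹ * Real.exp (-frob Y)

theorem gaussDensity_nonneg (Y : ι → κ → ℂ) : 0 ≤ gaussDensity Y := by
  unfold gaussDensity
  positivity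

@[fun_prop]
theorem continuous_gaussDensity : Continuous (gaussDensity : (ι → κ → ℂ) → ℝ) := by
  unfold gaussDensity
  fun_prop

@[fun_prop]
theorem measurable_gaussDensity : Measurable (gaussDensity : (ι → κ → ℂ) → ℝ) := by
  unfold gaussDensity
  fun_prop

/-- Gives a Gaussian majorant of the shifted density that is uniform for bounded shifts, as
dominated convergence requires. -/
theorem frob_sub_ge (Y v : ι → κ → ℂ) : frob Y / 2 - frob v ≤ frob (Y - v) := by
  simp only [frob_eq_sum_normSq, Finset.sum_div, ← Finset.sum_sub_distrib, Pi.sub_apply]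
  refine Finset.sum_le_sum fun i _ => Finset.sum_le_sum fun l _ => ?_
  have h := norm_le_norm_sub_add (Y i l) (v i l)
  have h0 := norm_nonneg (Y i l)
  nlinarith [sq_nonneg (‖Y i l - v i l‖ - ‖v i l‖), norm_nonneg (v i l),
    norm_nonneg (Y i l - v i l)]

theorem gaussDensity_sub_le (Y v : ι → κ → ℂ) {R : ℝ} (hR : frob v ≤ R) :
    gaussDensity (Y - v) ≤ (Real.pi ^ (Fintype.card ι * Fintype.card κ))⁻¹ * Real.exp R
      * Real.exp (-(2⁻¹ * frob Y)) := by
  rw [gaussDensity, mul_assoc, ← Real.exp_add]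
  have := frob_sub_ge Y v
  gcongr
  linarith

theorem integrable_exp_neg_frob :
    Integrable fun Y : ι → κ → ℂ => Real.exp (-(2⁻¹ * frob Y)) := by
  refine ⟨by fun_prop, ?_⟩
  rw [hasFiniteIntegral_iff_ofReal (Filter.Eventually.of_forall fun _ => (Real.exp_pos _).le)]
  have h : ∀ Y : ι → κ → ℂ, ENNReal.ofReal (Real.exp (-(2⁻¹ * frob Y)))
      = ∏ i, ENNReal.ofReal (Real.exp (-(2⁻¹ * sqn (Y i)))) := by
    intro Y
    rw [← ENNReal.ofReal_prod_of_nonneg fun _ _ => (Real.exp_pos _).le, ← Real.exp_sum, frob,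
      Finset.mul_sum, Finset.sum_neg_distrib]
  simp_rw [h]
  rw [volume_pi, lintegral_pi_prod _ (fun _ x => ENNReal.ofReal (Real.exp (-(2⁻¹ * sqn x))))
    fun _ => by fun_prop]
  refine ENNReal.prod_lt_top fun _ _ => ?_
  rw [lintegral_exp_neg_mul_sqn (by norm_num)]
  exact ENNReal.ofReal_lt_top

theorem lintegral_gaussDensity_sub (v : ι → κ → ℂ) {g : (ι → κ → ℂ) → ℝ≥0∞} (hg : Measurable g) :
    ∫⁻ Y, ENNReal.ofReal (gaussDensity (Y - v)) * g Y
      = ∫⁻ Z, g (Z + v) ∂(gaussianMatrix ι κ 1) := by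
  have hinv : (volume : Measure (ι → κ → ℂ)).IsAddRightInvariant :=
    Measure.pi.isAddRightInvariant _
  rw [← lintegral_add_right_eq_self (fun Y => ENNReal.ofReal (gaussDensity (Y - v)) * g Y) v]
  simp_rw [add_sub_cancel_right]
  rw [gaussianMatrix_one, lintegral_withDensity_eq_lintegral_mul _ (by fun_prop) (by fun_prop)]
  rfl

variable {α β : Type*} [Fintype α] [Fintype β] [DecidableEq β]

/-- The joint density of the observation and the label `b`, up to normalisation. -/
noncomputable def score (v : α → ι → κ → ℂ) (f : α → β) (b : β) (Y : ι → κ → ℂ) : ℝ :=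
  ∑ a, if f a = b then gaussDensity (Y - v a) else 0

omit [Fintype β] in
theorem score_nonneg (v : α → ι → κ → ℂ) (f : α → β) (b : β) (Y : ι → κ → ℂ) :
    0 ≤ score v f b Y :=
  Finset.sum_nonneg fun a _ => by
    split_ifs
    · exact gaussDensity_nonneg _
    · exact le_rfl

omit [Fintype β] in
theorem score_le (v : α → ι → κ → ℂ) (f : α → β) (b : β) (Y : ι → κ → ℂ) :
    score v f b Y ≤ ∑ a, gaussDensity (Y - v a) :=
  Finset.sum_le_sum fun a _ => by
    split_ifs
    · exact le_rfl
    · exact gaussDensity_nonneg _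

omit [Fintype β] in
theorem continuous_score (f : α → β) (b : β) :
    Continuous fun p : (α → ι → κ → ℂ) × (ι → κ → ℂ) => score p.1 f b p.2 := by
  unfold score
  refine continuous_finsetSum _ fun a _ => ?_
  split_ifs <;> fun_prop

variable [Nonempty β]

/-- The largest score. -/
noncomputable def bestScore (v : α → ι → κ → ℂ) (f : α → β) (Y : ι → κ → ℂ) : ℝ :=
  Finset.univ.sup' Finset.univ_nonempty fun b => score v f b Y

theorem continuous_bestScore (f : α → β) :
    Continuous fun p : (α → ι → κ → ℂ) × (ι → κ → ℂ) => bestScore p.1 f p.2 :=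
  Continuous.finset_sup'_apply _ fun b _ => continuous_score f b

theorem score_le_bestScore (v : α → ι → κ → ℂ) (f : α → β) (b : β) (Y : ι → κ → ℂ) :
    score v f b Y ≤ bestScore v f Y :=
  Finset.le_sup' (fun b => score v f b Y) (Finset.mem_univ b)

theorem bestScore_nonneg (v : α → ι → κ → ℂ) (f : α → β) (Y : ι → κ → ℂ) : 0 ≤ bestScore v f Y :=
  (score_nonneg v f (Classical.arbitrary β) Y).trans (score_le_bestScore v f _ Y)

theorem bestScore_le (v : α → ι → κ → ℂ) (f : α → β) (Y : ι → κ → ℂ) :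
    bestScore v f Y ≤ ∑ a, gaussDensity (Y - v a) :=
  Finset.sup'_le _ _ fun b _ => score_le v f b Y

theorem integrable_gaussDensity_sub (v : ι → κ → ℂ) :
    Integrable fun Y : ι → κ → ℂ => gaussDensity (Y - v) :=
  (integrable_exp_neg_frob.const_mul _).mono' (by fun_prop) (Filter.Eventually.of_forall fun Y => by
    rw [Real.norm_eq_abs, abs_of_nonneg (gaussDensity_nonneg _)]
    exact gaussDensity_sub_le Y v le_rfl)

theorem measurable_bestScore (v : α → ι → κ → ℂ) (f : α → β) : Measurable (bestScore v f) := by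
  have h : ∀ b ∈ Finset.univ, Measurable fun Y : ι → κ → ℂ => score v f b Y := fun b _ => by
    unfold score
    refine Finset.measurable_sum _ fun a _ => ?_
    split_ifs <;> fun_prop
  have h2 := Finset.measurable_sup' (Finset.univ_nonempty (α := β)) h
  convert h2 using 1
  ext Y
  rw [bestScore, Finset.sup'_apply]

theorem integrable_bestScore (v : α → ι → κ → ℂ) (f : α → β) : Integrable (bestScore v f) :=
  (integrable_finsetSum _ fun a _ => integrable_gaussDensity_sub (v a)).mono'
    (measurable_bestScore v f).aestronglyMeasurable (Filter.Eventually.of_forall fun Y => by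
      rw [Real.norm_eq_abs, abs_of_nonneg (bestScore_nonneg v f Y)]
      exact bestScore_le v f Y)

/-- The integrand is continuous in the shifts as a maximum of finitely many continuous scores, and
near a given point the shifts are bounded, so one Gaussian dominates. -/
theorem continuous_integral_bestScore (f : α → β) :
    Continuous fun v : α → ι → κ → ℂ => ∫ Y, bestScore v f Y := by
  refine continuous_iff_continuousAt.2 fun v₀ => ?_
  refine continuousAt_of_dominated (bound := fun Y => ∑ a,
    (Real.pi ^ (Fintype.card ι * Fintype.card κ))⁻¹ * Real.exp (frob (v₀ a) + 1)
      * Real.exp (-(2⁻¹ * frob Y)))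
    (Filter.Eventually.of_forall fun v => (measurable_bestScore v f).aestronglyMeasurable) ?_
    (integrable_finsetSum _ fun a _ => integrable_exp_neg_frob.const_mul _)
    (Filter.Eventually.of_forall fun Y =>
      ((continuous_bestScore f).comp (Continuous.prodMk_left Y)).continuousAt)
  have hnear : ∀ a, ∀ᶠ v : α → ι → κ → ℂ in nhds v₀, frob (v a) < frob (v₀ a) + 1 := fun a =>
    (by fun_prop : Continuous fun v : α → ι → κ → ℂ => frob (v a)).continuousAt.eventually_lt
      continuousAt_const (by simp)
  filter_upwards [Filter.eventually_all.2 hnear] with v hv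
  refine Filter.Eventually.of_forall fun Y => ?_
  rw [Real.norm_eq_abs, abs_of_nonneg (bestScore_nonneg v f Y)]
  exact (bestScore_le v f Y).trans (Finset.sum_le_sum fun a _ =>
    gaussDensity_sub_le Y (v a) (hv a).le)

theorem integral_gaussDensity_sub (v : ι → κ → ℂ) :
    ∫ Y : ι → κ → ℂ, gaussDensity (Y - v) = 1 := by
  have h := lintegral_gaussDensity_sub v (g := fun _ => 1) measurable_const
  simp only [mul_one, lintegral_const, measure_univ] at h
  rw [integral_eq_lintegral_of_nonneg_ae (Filter.Eventually.of_forall fun _ =>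
    gaussDensity_nonneg _) (by fun_prop), h, ENNReal.toReal_one]

theorem integral_bestScore_nonneg (v : α → ι → κ → ℂ) (f : α → β) : 0 ≤ ∫ Y, bestScore v f Y :=
  integral_nonneg fun _ => bestScore_nonneg v f _

theorem integral_bestScore_le (v : α → ι → κ → ℂ) (f : α → β) :
    ∫ Y, bestScore v f Y ≤ Fintype.card α := by
  calc _ ≤ ∫ Y, ∑ a, gaussDensity (Y - v a) := integral_mono (integrable_bestScore v f)
        (integrable_finsetSum _ fun a _ => integrable_gaussDensity_sub (v a)) (bestScore_le v f)
    _ = _ := by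
      rw [integral_finsetSum _ fun a _ => integrable_gaussDensity_sub (v a)]
      simp [integral_gaussDensity_sub]

omit [Fintype β] [Nonempty β] in
-- Translating the noise by each signal turns the sum of success probabilities into one integral
-- over the output, where the decoder collects the score of the label it chooses. Pointwise
-- maximisation is therefore optimal.
theorem sum_measure_correct_eq [MeasurableSpace β] [MeasurableSingletonClass β]
    (v : α → ι → κ → ℂ) (f : α → β) {d : (ι → κ → ℂ) → β} (hd : Measurable d) :
    ∑ a, gaussianMatrix ι κ 1 {Z | f a = d (Z + v a)}
      = ∫⁻ Y, ENNReal.ofReal (score v f (d Y) Y) := by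
  have hs : ∀ a, MeasurableSet {Y | f a = d Y} := fun a => by
    have : {Y | f a = d Y} = d ⁻¹' {f a} := by
      ext Y
      simp [eq_comm]
    rw [this]
    exact hd (measurableSet_singleton _)
  have h1 : ∀ a, gaussianMatrix ι κ 1 {Z | f a = d (Z + v a)}
      = ∫⁻ Y, ENNReal.ofReal (gaussDensity (Y - v a)) * {Y | f a = d Y}.indicator 1 Y := by
    intro a
    have hpre : MeasurableSet {Z : ι → κ → ℂ | f a = d (Z + v a)} :=
      (by fun_prop : Measurable fun Z : ι → κ → ℂ => Z + v a) (hs a)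
    rw [lintegral_gaussDensity_sub _ (measurable_one.indicator (hs a)),
      ← lintegral_indicator_one hpre]
    rfl
  simp_rw [h1]
  have h2 : ∀ a ∈ Finset.univ, Measurable fun Y : ι → κ → ℂ =>
      ENNReal.ofReal (gaussDensity (Y - v a)) * {Y | f a = d Y}.indicator 1 Y := fun a _ =>
    (by fun_prop : Measurable fun Y : ι → κ → ℂ =>
      ENNReal.ofReal (gaussDensity (Y - v a))).mul (measurable_one.indicator (hs a))
  rw [← lintegral_finsetSum _ h2]
  refine lintegral_congr fun Y => ?_
  rw [score, ENNReal.ofReal_sum_of_nonneg]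
  · refine Finset.sum_congr rfl fun a _ => ?_
    by_cases h : f a = d Y
    · simp [h]
    · simp [h]
  · intro a _
    split_ifs
    · exact gaussDensity_nonneg _
    · exact le_rfl

theorem sum_measure_correct_le [MeasurableSpace β] [MeasurableSingletonClass β]
    (v : α → ι → κ → ℂ) (f : α → β) {d : (ι → κ → ℂ) → β} (hd : Measurable d) :
    ∑ a, gaussianMatrix ι κ 1 {Z | f a = d (Z + v a)}
      ≤ ENNReal.ofReal (∫ Y, bestScore v f Y) := by
  rw [sum_measure_correct_eq v f hd, ofReal_integral_eq_lintegral_ofReal (integrable_bestScore v f)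
    (Filter.Eventually.of_forall (bestScore_nonneg v f))]
  exact lintegral_mono fun Y => ENNReal.ofReal_le_ofReal (score_le_bestScore v f _ Y)

theorem sum_measure_correct_argmax [MeasurableSpace β] [MeasurableSingletonClass β]
    (v : α → ι → κ → ℂ) (f : α → β) {d : (ι → κ → ℂ) → β} (hd : Measurable d)
    (hmax : ∀ Y b, score v f b Y ≤ score v f (d Y) Y) :
    ∑ a, gaussianMatrix ι κ 1 {Z | f a = d (Z + v a)}
      = ENNReal.ofReal (∫ Y, bestScore v f Y) := by
  rw [sum_measure_correct_eq v f hd, ofReal_integral_eq_lintegral_ofReal (integrable_bestScore v f)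
    (Filter.Eventually.of_forall (bestScore_nonneg v f))]
  refine lintegral_congr fun Y => ?_
  rw [le_antisymm (score_le_bestScore v f _ Y) (Finset.sup'_le _ _ fun b _ => hmax Y b)]

end Bayes

/-! ### Optimal decoding and compactness of the set of codebooks -/

section OptimalCode

variable {n M K L : ℕ}

/-- The noiseless received signal. -/
noncomputable def signal (c : Fin K → Fin M → Fin n → ℂ) (H : Fin K → Fin L → ℂ)
    (W : Fin K → Fin M) : Fin n → Fin L → ℂ :=
  fun i l => ∑ k, H k l * c k (W k) i

theorem received_eq (c : Fin K → Fin M → Fin n → ℂ) (W : Fin K → Fin M) (H : Fin K → Fin L → ℂ)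
    (Z : Fin n → Fin L → ℂ) : received c W H Z = Z + signal c H W := by
  ext i l
  exact add_comm _ _

theorem lintegral_uniformOn_univ {α : Type*} [Fintype α] [Nonempty α] [MeasurableSpace α]
    [MeasurableSingletonClass α] (g : α → ℝ≥0∞) :
    ∫⁻ a, g a ∂(uniformOn (Set.univ : Set α)) = (Fintype.card α : ℝ≥0∞)⁻¹ * ∑ a, g a := by
  rw [lintegral_fintype, Finset.mul_sum]
  refine Finset.sum_congr rfl fun a _ => ?_
  rw [uniformOn_univ, Measure.count_singleton, mul_comm, one_div]

theorem channelLaw_apply [NeZero M]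
    {T : Set ((Fin K → Fin M) × (Fin K → Fin L → ℂ) × (Fin n → Fin L → ℂ))}
    (hT : MeasurableSet T) :
    channelLaw n M K L T = ((M : ℝ≥0∞) ^ K)⁻¹ * ∑ W, fadingNoise n K L (Prod.mk W ⁻¹' T) := by
  rw [channelLaw, Measure.prod_apply hT, lintegral_uniformOn_univ]
  simp

instance isProbabilityMeasure_channelLaw [NeZero M] :
    IsProbabilityMeasure (channelLaw n M K L) := by
  unfold channelLaw
  infer_instance

theorem measurable_received (c : Fin K → Fin M → Fin n → ℂ) :
    Measurable fun ω : (Fin K → Fin M) × (Fin K → Fin L → ℂ) × (Fin n → Fin L → ℂ) =>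
      received c ω.1 ω.2.1 ω.2.2 := by
  have h : ∀ k i, Measurable fun ω : (Fin K → Fin M) × (Fin K → Fin L → ℂ) × (Fin n → Fin L → ℂ) =>
      c k (ω.1 k) i := fun k i =>
    (Measurable.of_discrete (f := fun m => c k m i)).comp
      ((measurable_pi_apply k).comp measurable_fst)
  unfold received
  refine measurable_pi_lambda _ fun i => measurable_pi_lambda _ fun l => ?_
  refine Measurable.add (Finset.measurable_sum _ fun k _ => Measurable.mul ?_ (h k i)) ?_ <;>
    fun_prop

variable {dec : (Fin n → Fin L → ℂ) × (Fin K → Fin L → ℂ) → Fin K → Fin M}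

theorem measurable_decoded (c : Fin K → Fin M → Fin n → ℂ) (hdec : Measurable dec) :
    Measurable fun ω : (Fin K → Fin M) × (Fin K → Fin L → ℂ) × (Fin n → Fin L → ℂ) =>
      dec (received c ω.1 ω.2.1 ω.2.2, ω.2.1) :=
  hdec.comp ((measurable_received c).prodMk (measurable_fst.comp measurable_snd))

theorem measurableSet_correct (c : Fin K → Fin M → Fin n → ℂ) (hdec : Measurable dec) (k : Fin K) :
    MeasurableSet {ω : (Fin K → Fin M) × (Fin K → Fin L → ℂ) × (Fin n → Fin L → ℂ) |
      ω.1 k = dec (received c ω.1 ω.2.1 ω.2.2, ω.2.1) k} :=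
  measurableSet_eq_fun ((measurable_pi_apply k).comp measurable_fst)
    ((measurable_pi_apply k).comp (measurable_decoded c hdec))

theorem channelLaw_correct [NeZero M] (c : Fin K → Fin M → Fin n → ℂ) (hdec : Measurable dec)
    (k : Fin K) :
    channelLaw n M K L {ω | ω.1 k = dec (received c ω.1 ω.2.1 ω.2.2, ω.2.1) k}
      = ((M : ℝ≥0∞) ^ K)⁻¹ * ∫⁻ H, ∑ W : Fin K → Fin M,
        gaussianMatrix (Fin n) (Fin L) 1 {Z | W k = dec (Z + signal c H W, H) k}
          ∂(gaussianMatrix (Fin K) (Fin L) 1) := by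
  have hs := measurableSet_correct c hdec k
  have hW : ∀ W : Fin K → Fin M, MeasurableSet (Prod.mk W ⁻¹'
      {ω : (Fin K → Fin M) × (Fin K → Fin L → ℂ) × (Fin n → Fin L → ℂ) |
        ω.1 k = dec (received c ω.1 ω.2.1 ω.2.2, ω.2.1) k}) := fun W => measurable_prodMk_left hs
  have hsec : ∀ (W : Fin K → Fin M) (H : Fin K → Fin L → ℂ),
      gaussianMatrix (Fin n) (Fin L) 1 {Z | W k = dec (Z + signal c H W, H) k}
      = gaussianMatrix (Fin n) (Fin L) 1 (Prod.mk H ⁻¹' (Prod.mk W ⁻¹'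
      {ω : (Fin K → Fin M) × (Fin K → Fin L → ℂ) × (Fin n → Fin L → ℂ) |
        ω.1 k = dec (received c ω.1 ω.2.1 ω.2.2, ω.2.1) k})) := by
    intro W H
    simp_rw [← received_eq]
    rfl
  simp_rw [hsec]
  rw [channelLaw_apply hs, lintegral_finsetSum _ fun W _ => measurable_measure_prodMk_left (hW W)]
  congr 1
  exact Finset.sum_congr rfl fun W _ => Measure.prod_apply (hW W)

theorem pupe_eq [NeZero M] (hK : 0 < K) (c : Fin K → Fin M → Fin n → ℂ) (hdec : Measurable dec) :
    pupe c dec = 1 - 1 / K * ∑ k, (channelLaw n M K L).real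
      {ω | ω.1 k = dec (received c ω.1 ω.2.1 ω.2.2, ω.2.1) k} := by
  have h : ∀ k, (channelLaw n M K L).real
      {ω | ω.1 k ≠ dec (received c ω.1 ω.2.1 ω.2.2, ω.2.1) k}
      = 1 - (channelLaw n M K L).real
        {ω | ω.1 k = dec (received c ω.1 ω.2.1 ω.2.2, ω.2.1) k} := fun k => by
    rw [← probReal_compl_eq_one_sub (measurableSet_correct c hdec k)]
    rfl
  rw [pupe, Finset.sum_congr rfl fun k _ => h k, Finset.sum_sub_distrib]
  have : (K : ℝ) ≠ 0 := by exact_mod_cast hK.ne'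
  simp
  field_simp

/-- The success probability of the optimal decoder, up to normalisation. -/
noncomputable def codebookGain [NeZero M] (L : ℕ) (c : Fin K → Fin M → Fin n → ℂ) : ℝ :=
  ∑ k, ∫ H : Fin K → Fin L → ℂ, (∫ Y, bestScore (signal c H) (fun W => W k) Y)
    ∂(gaussianMatrix (Fin K) (Fin L) 1)

theorem continuous_signal : Continuous fun p : (Fin K → Fin M → Fin n → ℂ) × (Fin K → Fin L → ℂ) =>
    (signal p.1 p.2 : (Fin K → Fin M) → Fin n → Fin L → ℂ) := by
  unfold signal
  fun_prop

theorem continuous_conditionalGain [NeZero M] (k : Fin K) :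
    Continuous fun p : (Fin K → Fin M → Fin n → ℂ) × (Fin K → Fin L → ℂ) =>
      ∫ Y, bestScore (signal p.1 p.2) (fun W => W k) Y := by
  have h := (continuous_integral_bestScore (ι := Fin n) (κ := Fin L)
    (fun W : Fin K → Fin M => W k)).comp (continuous_signal (n := n) (L := L))
  exact h

theorem measurable_conditionalGain [NeZero M] (c : Fin K → Fin M → Fin n → ℂ) (k : Fin K) :
    Measurable fun H : Fin K → Fin L → ℂ =>
      ∫ Y, bestScore (signal c H) (fun W => W k) Y :=
  ((continuous_conditionalGain k).comp (Continuous.prodMk_right c)).measurable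

theorem norm_conditionalGain_le [NeZero M] (c : Fin K → Fin M → Fin n → ℂ) (k : Fin K)
    (H : Fin K → Fin L → ℂ) :
    ‖∫ Y, bestScore (signal c H) (fun W => W k) Y‖ ≤ Fintype.card (Fin K → Fin M) := by
  rw [Real.norm_eq_abs, abs_of_nonneg (integral_bestScore_nonneg _ _)]
  exact integral_bestScore_le _ _

/-- Continuity of the conditional gain passes through the average over the fading by dominated
convergence, since the gain never exceeds the number of message vectors. -/
theorem continuous_codebookGain [NeZero M] (L : ℕ) :
    Continuous (codebookGain L : (Fin K → Fin M → Fin n → ℂ) → ℝ) := by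
  unfold codebookGain
  refine continuous_finsetSum _ fun k _ => ?_
  have hc : ∀ H : Fin K → Fin L → ℂ, Continuous fun c : Fin K → Fin M → Fin n → ℂ =>
      ∫ Y, bestScore (signal c H) (fun W => W k) Y := fun H => by
    have h := (continuous_conditionalGain (n := n) (M := M) (L := L) k).comp
      (Continuous.prodMk_left H)
    exact h
  exact continuous_of_dominated
    (F := fun (c : Fin K → Fin M → Fin n → ℂ) (H : Fin K → Fin L → ℂ) =>
      ∫ Y, bestScore (signal c H) (fun W => W k) Y)
    (bound := fun _ => (Fintype.card (Fin K → Fin M) : ℝ))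
    (fun c => (measurable_conditionalGain c k).aestronglyMeasurable)
    (fun c => Filter.Eventually.of_forall fun H => norm_conditionalGain_le c k H)
    (integrable_const _) (Filter.Eventually.of_forall hc)

theorem integrable_conditionalGain [NeZero M] (c : Fin K → Fin M → Fin n → ℂ) (k : Fin K) :
    Integrable (fun H : Fin K → Fin L → ℂ => ∫ Y, bestScore (signal c H) (fun W => W k) Y)
      (gaussianMatrix (Fin K) (Fin L) 1) :=
  Integrable.of_bound (measurable_conditionalGain c k).aestronglyMeasurable _
    (Filter.Eventually.of_forall (norm_conditionalGain_le c k))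

theorem ofReal_integral_conditionalGain [NeZero M] (c : Fin K → Fin M → Fin n → ℂ) (k : Fin K) :
    ENNReal.ofReal (∫ H : Fin K → Fin L → ℂ, (∫ Y, bestScore (signal c H) (fun W => W k) Y)
        ∂(gaussianMatrix (Fin K) (Fin L) 1))
      = ∫⁻ H : Fin K → Fin L → ℂ, ENNReal.ofReal (∫ Y, bestScore (signal c H) (fun W => W k) Y)
        ∂(gaussianMatrix (Fin K) (Fin L) 1) :=
  ofReal_integral_eq_lintegral_ofReal (integrable_conditionalGain c k)
    (Filter.Eventually.of_forall fun _ => integral_bestScore_nonneg _ _)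

theorem toReal_inv_mul_ofReal {x : ℝ} (hx : 0 ≤ x) :
    (((M : ℝ≥0∞) ^ K)⁻¹ * ENNReal.ofReal x).toReal = ((M : ℝ) ^ K)⁻¹ * x := by
  rw [ENNReal.toReal_mul, ENNReal.toReal_ofReal hx, ENNReal.toReal_inv, ENNReal.toReal_pow,
    ENNReal.toReal_natCast]

theorem measurable_dec_section (hdec : Measurable dec) (H : Fin K → Fin L → ℂ) (k : Fin K) :
    Measurable fun Y => dec (Y, H) k :=
  (measurable_pi_apply k).comp (hdec.comp measurable_prodMk_right)

/-- The PUPE is additive over users, so it is bounded by treating each user as a separate Bayes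
problem given the fading. -/
theorem one_sub_gain_le_pupe [NeZero M] (hK : 0 < K) (c : Fin K → Fin M → Fin n → ℂ)
    (hdec : Measurable dec) :
    1 - 1 / K * (((M : ℝ) ^ K)⁻¹ * codebookGain L c) ≤ pupe c dec := by
  rw [pupe_eq hK c hdec, codebookGain, Finset.mul_sum _ _ (((M : ℝ) ^ K)⁻¹)]
  gcongr with k
  have h0 : 0 ≤ ∫ H : Fin K → Fin L → ℂ, (∫ Y, bestScore (signal c H) (fun W => W k) Y)
      ∂(gaussianMatrix (Fin K) (Fin L) 1) := integral_nonneg fun _ => integral_bestScore_nonneg _ _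
  rw [measureReal_def, ← toReal_inv_mul_ofReal h0]
  have hM : (M : ℝ≥0∞) ^ K ≠ 0 := pow_ne_zero _ (Nat.cast_ne_zero.2 (NeZero.ne M))
  refine ENNReal.toReal_mono (ENNReal.mul_ne_top (ENNReal.inv_ne_top.2 hM) ENNReal.ofReal_ne_top) ?_
  rw [channelLaw_correct c hdec k, ofReal_integral_conditionalGain]
  gcongr with H
  exact sum_measure_correct_le (signal c H) (fun W => W k) (measurable_dec_section hdec H k)

/-- Equality is reached by maximising the posterior of each user separately; the components of a
decoder can be chosen independently. -/
theorem exists_dec_pupe_eq [NeZero M] (hK : 0 < K) (c : Fin K → Fin M → Fin n → ℂ) :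
    ∃ dec : (Fin n → Fin L → ℂ) × (Fin K → Fin L → ℂ) → Fin K → Fin M, Measurable dec ∧
      pupe c dec = 1 - 1 / K * (((M : ℝ) ^ K)⁻¹ * codebookGain L c) := by
  have hmeas : ∀ (k : Fin K) (m : Fin M),
      Measurable fun q : (Fin n → Fin L → ℂ) × (Fin K → Fin L → ℂ) =>
        score (signal c q.2) (fun W => W k) m q.1 := by
    intro k m
    unfold score signal
    refine Finset.measurable_sum _ fun W _ => ?_
    split_ifs
    · exact measurable_gaussDensity.comp (by fun_prop)
    · fun_prop
  choose d hd hmax using fun k => exists_measurable_argmax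
    (fun (m : Fin M) (q : (Fin n → Fin L → ℂ) × (Fin K → Fin L → ℂ)) =>
      score (signal c q.2) (fun W => W k) m q.1) (hmeas k)
  have hdec : Measurable fun q k => d k q := measurable_pi_lambda _ hd
  refine ⟨fun q k => d k q, hdec, ?_⟩
  rw [pupe_eq hK c hdec, codebookGain, Finset.mul_sum _ _ (((M : ℝ) ^ K)⁻¹)]
  congr 2
  refine Finset.sum_congr rfl fun k _ => ?_
  have h0 : 0 ≤ ∫ H : Fin K → Fin L → ℂ, (∫ Y, bestScore (signal c H) (fun W => W k) Y)
      ∂(gaussianMatrix (Fin K) (Fin L) 1) := integral_nonneg fun _ => integral_bestScore_nonneg _ _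
  rw [measureReal_def, ← toReal_inv_mul_ofReal h0, channelLaw_correct c hdec k,
    ofReal_integral_conditionalGain]
  congr 2
  refine lintegral_congr fun H => ?_
  exact sum_measure_correct_argmax (signal c H) (fun W => W k) (measurable_dec_section hdec H k)
    fun Y m => hmax k (Y, H) m

theorem isCompact_codebooks (b : ℝ) :
    IsCompact {c : Fin K → Fin M → Fin n → ℂ | ∀ k m, ∑ i, ‖c k m i‖ ^ 2 ≤ b} := by
  refine Metric.isCompact_of_isClosed_isBounded ?_ ?_
  · simp only [Set.ofPred_forall]
    exact isClosed_iInter fun k => isClosed_iInter fun m =>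
      isClosed_le (by fun_prop) continuous_const
  · refine (Metric.isBounded_closedBall (x := 0) (r := √b)).subset fun c hc => ?_
    rw [mem_closedBall_zero_iff]
    refine (pi_norm_le_iff_of_nonneg (Real.sqrt_nonneg _)).2 fun k =>
      (pi_norm_le_iff_of_nonneg (Real.sqrt_nonneg _)).2 fun m =>
      (pi_norm_le_iff_of_nonneg (Real.sqrt_nonneg _)).2 fun i => Real.le_sqrt_of_sq_le ?_
    exact (Finset.single_le_sum (f := fun i => ‖c k m i‖ ^ 2) (fun _ _ => sq_nonneg _)
      (Finset.mem_univ i)).trans (hc k m)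

/-- The smallest error probability under a power constraint is attained. -/
theorem exists_optimal_code [NeZero M] (hK : 0 < K) {P : ℝ} (hP : 0 ≤ P) :
    ∃ (c : Fin K → Fin M → Fin n → ℂ)
      (dec : (Fin n → Fin L → ℂ) × (Fin K → Fin L → ℂ) → Fin K → Fin M),
      (∀ k m, ∑ i, ‖c k m i‖ ^ 2 ≤ n * P) ∧ Measurable dec ∧
      ∀ (c' : Fin K → Fin M → Fin n → ℂ)
        (dec' : (Fin n → Fin L → ℂ) × (Fin K → Fin L → ℂ) → Fin K → Fin M),
        (∀ k m, ∑ i, ‖c' k m i‖ ^ 2 ≤ n * P) → Measurable dec' → pupe c dec ≤ pupe c' dec' := by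
  -- A continuous gain on a compact set has a maximiser; the zero codebook shows that the set is
  -- nonempty.
  obtain ⟨c, hc, hmax⟩ := (isCompact_codebooks (n := n) (M := M) (K := K) (n * P)).exists_isMaxOn
    ⟨0, fun k m => by simp; positivity⟩ (continuous_codebookGain L).continuousOn
  obtain ⟨dec, hdec, heq⟩ := exists_dec_pupe_eq (L := L) hK c
  refine ⟨c, dec, hc, hdec, fun c' dec' hc' hdec' => ?_⟩
  rw [heq]
  refine le_trans ?_ (one_sub_gain_le_pupe hK c' hdec')
  have : codebookGain L c' ≤ codebookGain L c := hmax hc'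
  gcongr

end OptimalCode

/-! ## Random coding -/

section RandomCoding

variable {n M K L : ℕ}

theorem gaussianVec_lt_sqn (hn : 0 < n) {v : ℝ} (hv : 0 < v) (b : ℝ) :
    gaussianVec (Fin n) v {x | b < sqn x} = ENNReal.ofReal (1 - gammaRatio n (b / v)) := by
  have : Nonempty (Fin n) := ⟨⟨0, hn⟩⟩
  have hs : MeasurableSet {x : Fin n → ℂ | b < sqn x} :=
    measurableSet_lt measurable_const measurable_sqn
  -- Scaling by `√v` reduces the tail to the standard law, with threshold `b / v`.
  rw [← (measurePreserving_gaussianVec_smul (ι := Fin n) hv.le).measure_preimage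
    hs.nullMeasurableSet]
  have hset : (fun (x : Fin n → ℂ) i => (√v : ℂ) * x i) ⁻¹' {x | b < sqn x}
      = {x | sqn x ≤ b / v}ᶜ := by
    ext x
    have e : (fun i => (√v : ℂ) * x i) = √v • x := by
      ext i
      simp
    simp only [Set.mem_preimage, Set.mem_ofPred_eq, Set.mem_compl_iff, not_le]
    rw [e, sqn_smul, Real.sq_sqrt hv.le, div_lt_iff₀' hv]
  have h := gaussianVec_real_sqn_le (ι := Fin n) (b / v)
  rw [Fintype.card_fin] at h
  rw [hset, ← h, ← probReal_compl_eq_one_sub (measurableSet_sqn_le _), ofReal_measureReal]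

/-- The probability that some transmitted codeword violates the power constraint. -/
theorem gaussianMatrix_exists_lt_sqn_le (hn : 0 < n) {P' : ℝ} (hP' : 0 < P') (P : ℝ)
    (W : Fin K → Fin M) :
    gaussianMatrix (Fin n) (Fin K × Fin M) P' {c | ∃ k, n * P < sqn fun i => c i (k, W k)}
      ≤ ENNReal.ofReal (p0 n K P P') := by
  have hset : {c : Fin n → Fin K × Fin M → ℂ | ∃ k, n * P < sqn fun i => c i (k, W k)}
      = ⋃ k ∈ (Finset.univ : Finset (Fin K)), {c | n * P < sqn fun i => c i (k, W k)} := by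
    ext c
    simp
  have hk : ∀ k, gaussianMatrix (Fin n) (Fin K × Fin M) P'
      {c | n * P < sqn fun i => c i (k, W k)}
      = ENNReal.ofReal (1 - gammaRatio n (n * P / P')) := by
    intro k
    have h1 := measurePreserving_gaussianMatrix_swap (ι := Fin n) (κ := Fin K × Fin M) P'
    have h2 := measurePreserving_eval (fun _ : Fin K × Fin M => gaussianVec (Fin n) P') (k, W k)
    rw [← gaussianVec_lt_sqn hn hP', ← (h2.comp h1).measure_preimage
      (measurableSet_lt measurable_const measurable_sqn).nullMeasurableSet]
    rfl
  rw [hset]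
  refine (measure_biUnion_finset_le _ _).trans (le_of_eq ?_)
  rw [Finset.sum_congr rfl fun k _ => hk k, Finset.sum_const, Finset.card_univ, Fintype.card_fin,
    nsmul_eq_mul, p0, ENNReal.ofReal_mul (Nat.cast_nonneg _), ENNReal.ofReal_natCast]

theorem p0_nonneg (hn : 0 < n) (P P' : ℝ) : 0 ≤ p0 n K P P' :=
  mul_nonneg (Nat.cast_nonneg _) (sub_nonneg.2 (gammaRatio_le_one hn _))

theorem mulCols_sub {ι κ μ : Type*} [Fintype κ] (A B : Matrix ι κ ℂ) (H : κ → μ → ℂ) :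
    mulCols (A - B) H = mulCols A H - mulCols B H := by
  ext i l
  simp [mulCols, Matrix.sub_mulVec]

/-- Codewords of correctly decoded users cancel, so comparing two message vectors involves only the
set where they differ. -/
theorem active_univ_sub (c : Fin n → Fin K × Fin M → ℂ) (W W' : Fin K → Fin M) :
    active c Finset.univ W - active c Finset.univ W'
      = active c (Finset.univ.filter fun k => W k ≠ W' k) W
        - active c (Finset.univ.filter fun k => W k ≠ W' k) W' := by
  ext i k
  simp only [Matrix.sub_apply, active_apply, Finset.mem_univ, if_true, Finset.mem_filter, true_and]
  split_ifs with h
  · rfl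
  · rw [not_not.1 h, sub_self, sub_self]

/-- The event that messages with exactly `t` errors beat the transmitted ones. -/
def errorEvent (L : ℕ) (t : ℕ) (c : Fin n → Fin K × Fin M → ℂ) (W : Fin K → Fin M) :
    Set ((Fin K → Fin L → ℂ) × (Fin n → Fin L → ℂ)) :=
  ⋃ S' ∈ Finset.powersetCard t (Finset.univ : Finset (Fin K)), rivalEvent L c S' W

theorem measurableSet_errorEvent_prod (L t : ℕ) (W : Fin K → Fin M) :
    MeasurableSet {q : (Fin n → Fin K × Fin M → ℂ) × ((Fin K → Fin L → ℂ) × (Fin n → Fin L → ℂ)) |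
      q.2 ∈ errorEvent L t q.1 W} := by
  have : {q : (Fin n → Fin K × Fin M → ℂ) × ((Fin K → Fin L → ℂ) × (Fin n → Fin L → ℂ)) |
      q.2 ∈ errorEvent L t q.1 W}
      = ⋃ S' ∈ Finset.powersetCard t (Finset.univ : Finset (Fin K)),
        {q | q.2 ∈ rivalEvent L q.1 S' W} := by
    ext q
    simp [errorEvent]
  rw [this]
  exact Finset.measurableSet_biUnion _ fun S' _ => measurableSet_rivalEvent_prod L S' W

theorem measurable_fadingNoise_errorEvent (L t : ℕ) (W : Fin K → Fin M) :
    Measurable fun c : Fin n → Fin K × Fin M → ℂ => fadingNoise n K L (errorEvent L t c W) :=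
  measurable_measure_prodMk_left (measurableSet_errorEvent_prod L t W)

theorem measurable_fadingNoise_noiseEvent (L t : ℕ) (ω ν : ℝ) (W : Fin K → Fin M) :
    Measurable fun c : Fin n → Fin K × Fin M → ℂ =>
      fadingNoise n K L (⋃ S' ∈ Finset.powersetCard t (Finset.univ : Finset (Fin K)),
        noiseEvent L (active c S' W) ω ν) := by
  have hm : ∀ S' : Finset (Fin K), Measurable fun q : (Fin n → Fin K × Fin M → ℂ) ×
      ((Fin K → Fin L → ℂ) × (Fin n → Fin L → ℂ)) =>
      frob (q.2.2 + mulCols (active q.1 S' W) q.2.1) := by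
    intro S'
    have hA : Measurable fun q : (Fin n → Fin K × Fin M → ℂ) ×
        ((Fin K → Fin L → ℂ) × (Fin n → Fin L → ℂ)) => fun i k => active q.1 S' W i k := by
      simp_rw [active_apply]
      refine measurable_pi_lambda _ fun i => measurable_pi_lambda _ fun k => ?_
      split_ifs <;> fun_prop
    have h1 : Measurable fun q : (Fin n → Fin K × Fin M → ℂ) ×
        ((Fin K → Fin L → ℂ) × (Fin n → Fin L → ℂ)) =>
        mulCols (fun i k => active q.1 S' W i k) q.2.1 := measurable_mulCols_prod hA (by fun_prop)
    have h2 : Measurable fun q : (Fin n → Fin K × Fin M → ℂ) ×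
        ((Fin K → Fin L → ℂ) × (Fin n → Fin L → ℂ)) => q.2.2 := by fun_prop
    exact measurable_frob.comp (h2.add h1)
  have hs : MeasurableSet {q : (Fin n → Fin K × Fin M → ℂ) ×
      ((Fin K → Fin L → ℂ) × (Fin n → Fin L → ℂ)) |
      q.2 ∈ ⋃ S' ∈ Finset.powersetCard t (Finset.univ : Finset (Fin K)),
        noiseEvent L (active q.1 S' W) ω ν} := by
    have : {q : (Fin n → Fin K × Fin M → ℂ) × ((Fin K → Fin L → ℂ) × (Fin n → Fin L → ℂ)) |
        q.2 ∈ ⋃ S' ∈ Finset.powersetCard t (Finset.univ : Finset (Fin K)),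
          noiseEvent L (active q.1 S' W) ω ν}
        = ⋃ S' ∈ Finset.powersetCard t (Finset.univ : Finset (Fin K)),
          {q | ω * frob (q.2.2 + mulCols (active q.1 S' W) q.2.1) + n * L * ν < frob q.2.2} := by
      ext q
      simp [noiseEvent]
    rw [this]
    exact Finset.measurableSet_biUnion _ fun S' _ =>
      measurableSet_lt (((hm S').const_mul ω).add_const _) (by fun_prop)
  exact measurable_measure_prodMk_left hs

theorem q1_nonneg (hM : 0 < M) (L t : ℕ) (P' : ℝ) (S : Finset (Fin K)) (w w' : Fin K → Fin M)
    (ω ν : ℝ) : 0 ≤ q1 n L t P' S w w' ω ν := by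
  have h1 : (0 : ℝ) ≤ (M : ℝ) - 1 := sub_nonneg.2 (by exact_mod_cast hM)
  have h2 : 0 ≤ ∫ A, chernoffMin L (active A S w) (active A S w') ω ν
      ∂(gaussianMatrix (Fin n) (Fin K × Fin M) P') :=
    integral_nonneg fun _ => chernoffMin_nonneg _ _ _ _ _
  unfold q1
  positivity

theorem q2_nonneg (hn : 0 < n) (hL : 0 < L) {t : ℕ} (ht : 0 < t) (P' : ℝ) (S : Finset (Fin K))
    (w : Fin K → Fin M) (ω ν : ℝ) : 0 ≤ q2 n L t P' S w ω ν := by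
  have hnL := Nat.mul_pos hn hL
  have htL := Nat.mul_pos ht hL
  have h1 : ∀ a, gammaRatio (n * L) a ≤ 1 := fun a => by
    simpa only [Nat.cast_mul] using gammaRatio_le_one hnL a
  have h2 : ∀ a, gammaRatio (t * L) a ≤ 1 := fun a => by
    simpa only [Nat.cast_mul] using gammaRatio_le_one htL a
  have h3 : ∀ a, 0 ≤ gammaRatio (n * L) a := gammaRatio_nonneg (by positivity)
  have h4 : ∀ a, 0 ≤ gammaRatio (t * L) a := gammaRatio_nonneg (by positivity)
  unfold q2
  split_ifs
  · exact sub_nonneg.2 (h1 _)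
  · refine Real.sInf_nonneg ?_
    rintro x ⟨η, δ, -, -, rfl⟩
    refine add_nonneg (mul_nonneg (Nat.cast_nonneg _) (integral_nonneg fun _ => h4 _))
      (mul_nonneg (Nat.cast_nonneg _) ?_)
    linarith [h1 (n * L * (1 + δ)), h2 (t * L * (1 + η))]
  · refine Real.sInf_nonneg ?_
    rintro x ⟨η, -, rfl⟩
    rw [add_sub_assoc]
    exact add_nonneg (mul_nonneg (Nat.cast_nonneg _) (integral_nonneg fun _ => h3 _))
      (sub_nonneg.2 (h1 _))

/-- The split behind `p1`: the good region is tested with the very set `S'` on which the rival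
differs, so it may depend on the rival. -/
theorem errorEvent_subset (t : ℕ) (c : Fin n → Fin K × Fin M → ℂ) (W : Fin K → Fin M) (ω ν : ℝ) :
    errorEvent L t c W ⊆
      (⋃ S' ∈ Finset.powersetCard t Finset.univ, ⋃ W' ∈ rivals S' W,
        goodErrorEvent L (active c S' W) (active c S' W') ω ν)
      ∪ ⋃ S' ∈ Finset.powersetCard t Finset.univ, noiseEvent L (active c S' W) ω ν := by
  refine Set.iUnion₂_subset fun S' hS' p ⟨W', hW', hp⟩ => ?_
  by_cases h : frob p.2 ≤ ω * frob (p.2 + mulCols (active c S' W) p.1) + n * L * ν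
  · exact Or.inl (Set.mem_iUnion₂.2 ⟨S', hS', Set.mem_iUnion₂.2 ⟨W', hW', hp, h⟩⟩)
  · exact Or.inr (Set.mem_iUnion₂.2 ⟨S', hS', not_le.1 h⟩)

/-- The average probability that exactly `t` users are in error. -/
theorem lintegral_errorEvent_le (hn : 0 < n) (hL : 0 < L) (hM : 0 < M) {t : ℕ} (ht : 0 < t)
    {P' : ℝ} (hP' : 0 < P') {S : Finset (Fin K)} (hS : S.card = t) {w w' : Fin K → Fin M}
    (hw : ∀ k, w' k ≠ w k) (W : Fin K → Fin M) :
    (∫⁻ c, fadingNoise n K L (errorEvent L t c W)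
        ∂(gaussianMatrix (Fin n) (Fin K × Fin M) P')).toReal
      ≤ min 1 (min (p1 n L t P' S w w') (p2 n M K L t P')) := by
  refine le_min ?_ (le_min ?_ ?_)
  · refine ENNReal.toReal_le_of_le_ofReal zero_le_one ?_
    calc _ ≤ ∫⁻ _, 1 ∂(gaussianMatrix (Fin n) (Fin K × Fin M) P') :=
        lintegral_mono fun _ => prob_le_one
      _ = _ := by simp
  -- The estimate holds for every admissible `ω, ν` and so passes to the infimum; the zero witnesses
  -- only show that the set is nonempty.
  · refine le_csInf ⟨_, 0, 0, le_rfl, zero_le_one, le_rfl, rfl⟩ ?_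
    rintro x ⟨ω, ν, h0, h1, hν, rfl⟩
    have hq1 := q1_nonneg (n := n) hM L t P' S w w' ω ν
    have hq2 := q2_nonneg hn hL ht P' S w ω ν
    refine ENNReal.toReal_le_of_le_ofReal (add_nonneg hq1 hq2) ?_
    rw [ENNReal.ofReal_add hq1 hq2]
    refine le_trans ?_ (add_le_add (lintegral_goodErrorEvent_le L ν h1 hS hw hM W)
      (lintegral_noiseEvent_le hn hL ht h0 h1 hS hw W))
    rw [← lintegral_add_right _ (measurable_fadingNoise_noiseEvent L t ω ν W)]
    exact lintegral_mono fun c =>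
      (measure_mono (errorEvent_subset t c W ω ν)).trans (measure_union_le _ _)
  · refine le_csInf ⟨_, 0, 0, le_rfl, zero_le_one, by simp, rfl⟩ ?_
    rintro x ⟨ρ, m, h0, h1, hm, rfl⟩
    have hd : 0 ≤ detMoment t m L (P' / (1 + ρ)) :=
      detMoment_nonneg t m L (div_nonneg hP'.le (by linarith))
    refine ENNReal.toReal_le_of_le_ofReal (by positivity) ?_
    calc _ ≤ ∫⁻ c, ∑ S' ∈ Finset.powersetCard t (Finset.univ : Finset (Fin K)),
          fadingNoise n K L (rivalEvent L c S' W)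
          ∂(gaussianMatrix (Fin n) (Fin K × Fin M) P') :=
          lintegral_mono fun c => measure_biUnion_finset_le _ _
      _ = ∑ S' ∈ Finset.powersetCard t (Finset.univ : Finset (Fin K)),
          ∫⁻ c, fadingNoise n K L (rivalEvent L c S' W)
          ∂(gaussianMatrix (Fin n) (Fin K × Fin M) P') :=
          lintegral_finsetSum _ fun S' _ =>
            measurable_measure_prodMk_left (measurableSet_rivalEvent_prod L S' W)
      _ ≤ ∑ S' ∈ Finset.powersetCard t (Finset.univ : Finset (Fin K)),
          ENNReal.ofReal ((M : ℝ) ^ (ρ * t) * detMoment t m L (P' / (1 + ρ))) :=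
          Finset.sum_le_sum fun S' hS' =>
            lintegral_rivalEvent_le hP'.le h0 h1 hm (Finset.mem_powersetCard.1 hS').2 W
      _ = _ := by
          rw [Finset.sum_const, Finset.card_powersetCard, Finset.card_univ, Fintype.card_fin,
            nsmul_eq_mul, mul_assoc, ENNReal.ofReal_mul (Nat.cast_nonneg _), ENNReal.ofReal_natCast]

/-- Codewords that violate the power constraint are replaced by `0`. -/
noncomputable def truncate (b : ℝ) (c : Fin n → Fin K × Fin M → ℂ) :
    Fin K → Fin M → Fin n → ℂ :=
  fun k m => if (sqn fun i => c i (k, m)) ≤ b then fun i => c i (k, m) else 0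

theorem truncate_power_le {b : ℝ} (hb : 0 ≤ b) (c : Fin n → Fin K × Fin M → ℂ) (k : Fin K)
    (m : Fin M) : ∑ i, ‖truncate b c k m i‖ ^ 2 ≤ b := by
  unfold truncate
  split_ifs with h
  · exact h
  · simpa using hb

theorem received_truncate {b : ℝ} {c : Fin n → Fin K × Fin M → ℂ} {W : Fin K → Fin M}
    (h : ∀ k, (sqn fun i => c i (k, W k)) ≤ b) (H : Fin K → Fin L → ℂ) (Z : Fin n → Fin L → ℂ) :
    received (truncate b c) W H Z = Z + mulCols (active c Finset.univ W) H := by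
  ext i l
  simp only [received, truncate, h, if_true, Pi.add_apply, mulCols, Matrix.mulVec, dotProduct,
    active_apply, Finset.mem_univ]
  rw [add_comm]
  congr 1
  exact Finset.sum_congr rfl fun k _ => mul_comm _ _

/-- The number of errors of a decoder that prefers the most likely messages. -/
theorem sum_indicator_wrong_le {dec : (Fin n → Fin L → ℂ) × (Fin K → Fin L → ℂ) → Fin K → Fin M}
    {c : Fin n → Fin K × Fin M → ℂ}
    (hdec : ∀ (q : (Fin n → Fin L → ℂ) × (Fin K → Fin L → ℂ)) W,
      frob (q.1 - mulCols (active c Finset.univ (dec q)) q.2)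
        ≤ frob (q.1 - mulCols (active c Finset.univ W) q.2))
    {b : ℝ} {W : Fin K → Fin M} (h : ∀ k, (sqn fun i => c i (k, W k)) ≤ b)
    (p : (Fin K → Fin L → ℂ) × (Fin n → Fin L → ℂ)) :
    ∑ k, {p : (Fin K → Fin L → ℂ) × (Fin n → Fin L → ℂ) |
        W k ≠ dec (received (truncate b c) W p.1 p.2, p.1) k}.indicator (1 : (Fin K → Fin L → ℂ) × (Fin n → Fin L → ℂ) → ℝ≥0∞) p
      ≤ ∑ t ∈ Finset.Icc 1 K, (t : ℝ≥0∞) * (errorEvent L t c W).indicator 1 p := by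
  set W' := dec (received (truncate b c) W p.1 p.2, p.1) with hW'
  set D : Finset (Fin K) := Finset.univ.filter fun k => W k ≠ W' k with hD
  have hsum : ∑ k, {p : (Fin K → Fin L → ℂ) × (Fin n → Fin L → ℂ) |
        W k ≠ dec (received (truncate b c) W p.1 p.2, p.1) k}.indicator (1 : (Fin K → Fin L → ℂ) × (Fin n → Fin L → ℂ) → ℝ≥0∞) p
      = D.card := by
    simp only [Set.indicator_apply, Set.mem_ofPred_eq, Pi.one_apply, ← hW', Finset.sum_boole, hD]
  rw [hsum]
  rcases D.eq_empty_or_nonempty with h0 | h0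
  · rw [h0]
    simp
  -- The decoded vector is itself a rival differing exactly on `D`, and minimality of its distance
  -- puts the outcome in the event with `t = D.card`. This single term already pays for all `D.card`
  -- errors.
  · have hmem : p ∈ errorEvent L D.card c W := by
      refine Set.mem_iUnion₂.2 ⟨D, Finset.mem_powersetCard.2 ⟨Finset.subset_univ _, rfl⟩, W', ?_, ?_⟩
      · rw [mem_rivals]
        refine ⟨fun k hk => ?_, fun k hk => ?_⟩
        · exact ((Finset.mem_filter.1 hk).2).symm
        · by_contra hne
          exact hk (Finset.mem_filter.2 ⟨Finset.mem_univ _, Ne.symm hne⟩)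
      · have h1 := hdec (received (truncate b c) W p.1 p.2, p.1) W
        rw [← hW'] at h1
        simp only [received_truncate h, add_sub_cancel_right] at h1
        rwa [add_sub_assoc, ← mulCols_sub, active_univ_sub] at h1
    have hIcc : D.card ∈ Finset.Icc 1 K := Finset.mem_Icc.2
      ⟨Finset.card_pos.2 h0, by simpa using Finset.card_le_univ D⟩
    refine le_trans (le_of_eq ?_) (Finset.single_le_sum (fun _ _ => zero_le) hIcc)
    rw [Set.indicator_of_mem hmem, Pi.one_apply, mul_one]

/-- The error probability of the truncated codebook under the decoder for the original one. -/
theorem exists_dec_pupe_truncate_le [NeZero M] (hK : 0 < K) (b : ℝ)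
    (c : Fin n → Fin K × Fin M → ℂ) :
    ∃ dec : (Fin n → Fin L → ℂ) × (Fin K → Fin L → ℂ) → Fin K → Fin M, Measurable dec ∧
      ENNReal.ofReal (pupe (truncate b c) dec) ≤ ((M : ℝ≥0∞) ^ K)⁻¹ * ∑ W : Fin K → Fin M,
        ({c : Fin n → Fin K × Fin M → ℂ | ∃ k, b < sqn fun i => c i (k, W k)}.indicator 1 c
          + ∑ t ∈ Finset.Icc 1 K,
            ENNReal.ofReal (t / K) * fadingNoise n K L (errorEvent L t c W)) := by
  -- The decoder measures distances with the original codewords, which keeps the full Gaussian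
  -- symmetry of the analysis.
  obtain ⟨dec, hm, hmax⟩ := exists_measurable_argmax
    (fun (W : Fin K → Fin M) (q : (Fin n → Fin L → ℂ) × (Fin K → Fin L → ℂ)) =>
      -frob (q.1 - mulCols (active c Finset.univ W) q.2)) (fun W => by
        have h : Measurable fun q : (Fin n → Fin L → ℂ) × (Fin K → Fin L → ℂ) =>
            mulCols (active c Finset.univ W) q.2 :=
          (measurable_mulCols (active c Finset.univ W)).comp measurable_snd
        exact (measurable_frob.comp (measurable_fst.sub h)).neg)
  refine ⟨dec, hm, ?_⟩
  have hdec : ∀ (q : (Fin n → Fin L → ℂ) × (Fin K → Fin L → ℂ)) W,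
      frob (q.1 - mulCols (active c Finset.univ (dec q)) q.2)
        ≤ frob (q.1 - mulCols (active c Finset.univ W) q.2) := fun q W =>
    neg_le_neg_iff.1 (hmax q W)
  have hs : ∀ k, MeasurableSet
      {ω : (Fin K → Fin M) × (Fin K → Fin L → ℂ) × (Fin n → Fin L → ℂ) |
        ω.1 k ≠ dec (received (truncate b c) ω.1 ω.2.1 ω.2.2, ω.2.1) k} := fun k =>
    (measurableSet_correct (truncate b c) hm k).compl
  have hsW : ∀ (W : Fin K → Fin M) k, MeasurableSet {p : (Fin K → Fin L → ℂ) × (Fin n → Fin L → ℂ) |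
        W k ≠ dec (received (truncate b c) W p.1 p.2, p.1) k} := fun W k =>
    measurable_prodMk_left (hs k)
  have hpupe : ENNReal.ofReal (pupe (truncate b c) dec) = ((M : ℝ≥0∞) ^ K)⁻¹ *
      ∑ W : Fin K → Fin M, ENNReal.ofReal (1 / K) * ∑ k, fadingNoise n K L
        {p : (Fin K → Fin L → ℂ) × (Fin n → Fin L → ℂ) |
          W k ≠ dec (received (truncate b c) W p.1 p.2, p.1) k} := by
    rw [pupe, ENNReal.ofReal_mul (by positivity),
      ENNReal.ofReal_sum_of_nonneg fun _ _ => measureReal_nonneg,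
      Finset.sum_congr rfl fun k _ => (ofReal_measureReal (measure_ne_top _ _)).trans
        (channelLaw_apply (hs k)), ← Finset.mul_sum, ← Finset.mul_sum, Finset.sum_comm]
    rw [mul_left_comm]
    rfl
  rw [hpupe]
  gcongr with W
  -- If a sent codeword is too long the PUPE is bounded by one; otherwise truncation leaves all sent
  -- codewords unchanged. Unsent codewords play no role, so `p0` has the factor `K` and not `M K`.
  by_cases hbad : ∃ k, b < sqn fun i => c i (k, W k)
  · refine le_trans ?_ le_self_add
    rw [Set.indicator_of_mem (show c ∈ {c : Fin n → Fin K × Fin M → ℂ |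
      ∃ k, b < sqn fun i => c i (k, W k)} from hbad), Pi.one_apply]
    have hle : ∑ k, fadingNoise n K L {p : (Fin K → Fin L → ℂ) × (Fin n → Fin L → ℂ) |
          W k ≠ dec (received (truncate b c) W p.1 p.2, p.1) k} ≤ ENNReal.ofReal K := by
      refine (Finset.sum_le_sum fun k _ => prob_le_one).trans (le_of_eq ?_)
      simp
    refine (mul_le_mul_right hle _).trans (le_of_eq ?_)
    rw [← ENNReal.ofReal_mul (by positivity), one_div,
      inv_mul_cancel₀ (by exact_mod_cast hK.ne'), ENNReal.ofReal_one]
  · have hgood : ∀ k, (sqn fun i => c i (k, W k)) ≤ b := fun k =>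
      not_lt.1 fun h => hbad ⟨k, h⟩
    refine le_trans ?_ le_add_self
    have hE : ∀ t, MeasurableSet (errorEvent L t c W) := fun t =>
      measurable_prodMk_left (measurableSet_errorEvent_prod L t W)
    calc _ = ENNReal.ofReal (1 / K) * ∫⁻ p, ∑ k, {p : (Fin K → Fin L → ℂ) × (Fin n → Fin L → ℂ) |
          W k ≠ dec (received (truncate b c) W p.1 p.2, p.1) k}.indicator 1 p
            ∂(fadingNoise n K L) := by
          rw [lintegral_finsetSum _ fun k _ => measurable_one.indicator (hsW W k)]
          simp_rw [lintegral_indicator_one (hsW W _)]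
      _ ≤ ENNReal.ofReal (1 / K) * ∫⁻ p, ∑ t ∈ Finset.Icc 1 K,
          (t : ℝ≥0∞) * (errorEvent L t c W).indicator 1 p ∂(fadingNoise n K L) := by
          gcongr with p
          exact sum_indicator_wrong_le hdec hgood p
      _ = _ := by
          rw [lintegral_finsetSum _ fun t _ => (measurable_one.indicator (hE t)).const_mul _,
            Finset.mul_sum]
          refine Finset.sum_congr rfl fun t _ => ?_
          rw [lintegral_const_mul _ (measurable_one.indicator (hE t)),
            lintegral_indicator_one (hE t), ← mul_assoc, ← ENNReal.ofReal_natCast t,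
            ← ENNReal.ofReal_mul (by positivity)]
          congr 2
          ring

/-- The average of the random coding bound over the codebooks. -/
theorem lintegral_randomCoding_le [NeZero M] (hn : 0 < n) (hL : 0 < L) {P P' : ℝ} (hP' : 0 < P')
    {S : ℕ → Finset (Fin K)} (hS : ∀ t ∈ Finset.Icc 1 K, (S t).card = t) {w w' : Fin K → Fin M}
    (hw : ∀ k, w' k ≠ w k) :
    ∫⁻ c, ((M : ℝ≥0∞) ^ K)⁻¹ * ∑ W : Fin K → Fin M,
        ({c : Fin n → Fin K × Fin M → ℂ | ∃ k, n * P < sqn fun i => c i (k, W k)}.indicator 1 c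
          + ∑ t ∈ Finset.Icc 1 K,
            ENNReal.ofReal (t / K) * fadingNoise n K L (errorEvent L t c W))
        ∂(gaussianMatrix (Fin n) (Fin K × Fin M) P')
      ≤ ENNReal.ofReal (p0 n K P P' + ∑ t ∈ Finset.Icc 1 K,
        (t / K : ℝ) * min 1 (min (p1 n L t P' (S t) w w') (p2 n M K L t P'))) := by
  have hM : 0 < M := Nat.pos_of_neZero M
  have hbadm : ∀ W : Fin K → Fin M, MeasurableSet {c : Fin n → Fin K × Fin M → ℂ |
      ∃ k, n * P < sqn fun i => c i (k, W k)} := fun W => by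
    rw [Set.ofPred_exists]
    exact MeasurableSet.iUnion fun k => measurableSet_lt measurable_const
      (measurable_sqn.comp (by fun_prop))
  have hind : ∀ W : Fin K → Fin M, Measurable ({c : Fin n → Fin K × Fin M → ℂ |
      ∃ k, n * P < sqn fun i => c i (k, W k)}.indicator (1 : (Fin n → Fin K × Fin M → ℂ) → ℝ≥0∞)) := fun W =>
    measurable_one.indicator (hbadm W)
  have hterm : ∀ (W : Fin K → Fin M) (t : ℕ), Measurable fun c : Fin n → Fin K × Fin M → ℂ =>
      ENNReal.ofReal (t / K) * fadingNoise n K L (errorEvent L t c W) := fun W t =>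
    (measurable_fadingNoise_errorEvent L t W).const_mul _
  have hsum : ∀ W : Fin K → Fin M, Measurable fun c : Fin n → Fin K × Fin M → ℂ =>
      ∑ t ∈ Finset.Icc 1 K, ENNReal.ofReal (t / K) * fadingNoise n K L (errorEvent L t c W) :=
    fun W => Finset.measurable_sum _ fun t _ => hterm W t
  have hall : ∀ W : Fin K → Fin M, Measurable fun c : Fin n → Fin K × Fin M → ℂ =>
      {c : Fin n → Fin K × Fin M → ℂ | ∃ k, n * P < sqn fun i => c i (k, W k)}.indicator
        (1 : (Fin n → Fin K × Fin M → ℂ) → ℝ≥0∞) c + ∑ t ∈ Finset.Icc 1 K,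
          ENNReal.ofReal (t / K) * fadingNoise n K L (errorEvent L t c W) := fun W =>
    (hind W).add (hsum W)
  rw [lintegral_const_mul _ (Finset.measurable_sum _ fun W _ => hall W),
    lintegral_finsetSum _ fun W _ => hall W]
  -- The averaged bound is the same for every transmitted vector, so the mean over the `M ^ K`
  -- messages disappears.
  have hW : ∀ W ∈ (Finset.univ : Finset (Fin K → Fin M)),
      ∫⁻ c, {c : Fin n → Fin K × Fin M → ℂ | ∃ k, n * P < sqn fun i => c i (k, W k)}.indicator
        (1 : (Fin n → Fin K × Fin M → ℂ) → ℝ≥0∞) c + ∑ t ∈ Finset.Icc 1 K,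
          ENNReal.ofReal (t / K) * fadingNoise n K L (errorEvent L t c W)
          ∂(gaussianMatrix (Fin n) (Fin K × Fin M) P')
      ≤ ENNReal.ofReal (p0 n K P P' + ∑ t ∈ Finset.Icc 1 K,
        (t / K : ℝ) * min 1 (min (p1 n L t P' (S t) w w') (p2 n M K L t P'))) := by
    intro W _
    rw [lintegral_add_left (hind W), lintegral_indicator_one (hbadm W),
      lintegral_finsetSum _ fun t _ => hterm W t]
    have hmin : ∀ t ∈ Finset.Icc 1 K,
        ∫⁻ c, ENNReal.ofReal (t / K) * fadingNoise n K L (errorEvent L t c W)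
          ∂(gaussianMatrix (Fin n) (Fin K × Fin M) P')
        ≤ ENNReal.ofReal ((t / K : ℝ) *
          min 1 (min (p1 n L t P' (S t) w w') (p2 n M K L t P'))) ∧
        0 ≤ (t / K : ℝ) * min 1 (min (p1 n L t P' (S t) w w') (p2 n M K L t P')) := by
      intro t ht
      have hle := lintegral_errorEvent_le hn hL hM (Finset.mem_Icc.1 ht).1 hP' (hS t ht) hw W
      have htK : (0 : ℝ) ≤ t / K := by positivity
      refine ⟨?_, mul_nonneg htK (ENNReal.toReal_nonneg.trans hle)⟩
      rw [lintegral_const_mul _ (measurable_fadingNoise_errorEvent L t W), ENNReal.ofReal_mul htK]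
      gcongr
      refine (ENNReal.le_ofReal_iff_toReal_le ?_ (ENNReal.toReal_nonneg.trans hle)).2 hle
      refine ne_top_of_le_ne_top ENNReal.one_ne_top ?_
      calc _ ≤ ∫⁻ _, 1 ∂(gaussianMatrix (Fin n) (Fin K × Fin M) P') :=
          lintegral_mono fun _ => prob_le_one
        _ = _ := by simp
    rw [ENNReal.ofReal_add (p0_nonneg hn P P') (Finset.sum_nonneg fun t ht => (hmin t ht).2),
      ENNReal.ofReal_sum_of_nonneg fun t ht => (hmin t ht).2]
    exact add_le_add (gaussianMatrix_exists_lt_sqn_le hn hP' P W)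
      (Finset.sum_le_sum fun t ht => (hmin t ht).1)
  refine (mul_le_mul_right (Finset.sum_le_sum hW) _).trans (le_of_eq ?_)
  have hM0 : (M : ℝ≥0∞) ^ K ≠ 0 := pow_ne_zero _ (Nat.cast_ne_zero.2 hM.ne')
  rw [Finset.sum_const, Finset.card_univ, nsmul_eq_mul, ← mul_assoc]
  simp only [Fintype.card_pi, Fintype.card_fin, Finset.prod_const, Finset.card_univ, Nat.cast_pow]
  rw [ENNReal.inv_mul_cancel hM0 (ENNReal.pow_ne_top (ENNReal.natCast_ne_top M)), one_mul]

/-- An optimal code has PUPE at most that of any truncated random codebook, hence at most the bound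
for every `P'` and so at most their infimum, attained or not. -/
theorem nonempty_code_of_pupeBound_le [NeZero M] (hn : 0 < n) (hK : 0 < K) (hL : 0 < L) {ε P : ℝ}
    (hP : 0 < P) {S : ℕ → Finset (Fin K)} (hS : ∀ t ∈ Finset.Icc 1 K, (S t).card = t)
    {w w' : Fin K → Fin M} (hw : ∀ k, w' k ≠ w k) (h : pupeBound n L P S w w' ≤ ε) :
    Nonempty (Code n M K L ε P) := by
  obtain ⟨c₀, dec₀, hc₀, hdec₀, hopt⟩ :=
    exists_optimal_code (n := n) (M := M) (K := K) (L := L) hK hP.le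
  refine ⟨⟨c₀, hc₀, dec₀, hdec₀, le_trans (le_csInf ?_ ?_) h⟩⟩
  -- Any value strictly between `0` and `P` shows that the set of bounds is nonempty, as required to
  -- pass to its infimum.
  · exact ⟨_, P / 2, by positivity, by linarith, rfl⟩
  · rintro x ⟨P', hP', hlt, rfl⟩
    have hM : 0 < M := Nat.pos_of_neZero M
    have hx : 0 ≤ p0 n K P P' + ∑ t ∈ Finset.Icc 1 K,
        (t / K : ℝ) * min 1 (min (p1 n L t P' (S t) w w') (p2 n M K L t P')) :=
      add_nonneg (p0_nonneg hn P P') (Finset.sum_nonneg fun t ht => mul_nonneg (by positivity)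
        (ENNReal.toReal_nonneg.trans (lintegral_errorEvent_le hn hL hM (Finset.mem_Icc.1 ht).1 hP'
          (hS t ht) hw w)))
    refine (ENNReal.ofReal_le_ofReal_iff hx).1 (le_trans ?_
      (lintegral_randomCoding_le (P := P) hn hL hP' hS hw))
    calc ENNReal.ofReal (pupe c₀ dec₀)
        = ∫⁻ _, ENNReal.ofReal (pupe c₀ dec₀) ∂(gaussianMatrix (Fin n) (Fin K × Fin M) P') := by
          simp
      _ ≤ _ := by
          refine lintegral_mono fun c => ?_
          obtain ⟨dec, hm, hle⟩ := exists_dec_pupe_truncate_le (L := L) hK (n * P) c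
          exact (ENNReal.ofReal_le_ofReal (hopt _ _
            (truncate_power_le (by positivity) c) hm)).trans hle

end RandomCoding

end MassiveAccess

/-! ### The achievability bound and its closed form -/

theorem mainTheorem4 (n J K L : ℕ) (hn : 0 < n) (hJ : 0 < J) (hK : 0 < K) (hL : 0 < L) (ε : ℝ)
    (S : ℕ → Finset (Fin K)) (hS : ∀ t ∈ Finset.Icc 1 K, (S t).card = t)
    (w w' : Fin K → Fin (2 ^ J)) (hw : ∀ k, w' k ≠ w k) :
    minEnergyPerBit n J K L ε ≤
        ⨅ P ∈ {P : ℝ | 0 < P ∧ pupeBound n L P S w w' ≤ ε}, ((n * P / J : ℝ) : EReal) ∧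
      ∀ t ∈ Finset.Icc 1 K, ∀ P' : ℝ, 0 < P' →
        min 1 (p2 n (2 ^ J) K L t P') ≤ p2u n (2 ^ J) K L t P' ∧
        ∀ (ρ : ℝ) (m : ℕ), 0 ≤ ρ → ρ ≤ 1 → ρ * n = m → (t + L ≤ m ∨ m + L ≤ t) →
          p2 n (2 ^ J) K L t P' ≤ qClosed (2 ^ J) K L t P' ρ m := by
  have : NeZero (2 ^ J) := ⟨by positivity⟩
  -- Each power admitted by the bound carries a code, so the infimum on the left runs over a larger
  -- set of powers.
  exact ⟨le_iInf₂ fun P hP => iInf₂_le P ⟨hP.1, nonempty_code_of_pupeBound_le hn hK hL hP.1 hS hw hP.2⟩,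
    fun t _ P' hP' => ⟨min_one_p2_le_p2u hP', fun ρ m h0 h1 hm h => p2_le_qClosed hP' h0 h1 hm h⟩⟩
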